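/- **Setting.** Let $k$ be a commutative unital ring and let $A$ be an involutive $k$-algebra: an associative unital $k$-algebra with a $k$-linear map $a\mapsto\overline a$ such that $\overline{ab}=\overline b\,\overline a$ and $\overline{\overline a}=a$. *The categories.* Let $C_2=\{1,t\}$. The hyperoctahedral category $\Delta H$ has objects $[n]=\{0,\dots,n\}$, $n\ge 0$. A morphism $[n]\to[m]$ is a pair $(\varphi,g)$, with $\varphi\colon[n]\to[m]$ order preserving and $g=(z_0,\dots,z_n;\sigma)\in C_2^{n+1}\rtimes\Sigma_{n+1}$. Equivalently, it is the map of sets $\varphi\sigma$ together with the labels $z_i$ and a total order on each fibre ($i$ before $i'$ if $\sigma(i)<\sigma(i')$). In a composite, labels multiply, the fibres are concatenated in the order of the outer map, and a fibre is reversed when the outer map labels its image by $t$. $\Delta H_+$ is $\Delta H$ with an added initial object $[-1]$; it is symmetric strict monoidal under disjoint union $\times$ of ordered sets. $\mathbf S$ is the symmetric groupoid, with objects $\underline n=\{1,\dots,n\}$, $n\ge 0$, and the bijections as morphisms. $\mathbf S$ is included in $\Delta H_+$ by $\underline n\mapsto[n-1]$. *The bar construction and homology.* $\mathsf H_{A+}\colon\Delta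 H_+\to\mathbf{Mod}_k$ sends $[n]$ to $A^{\otimes(n+1)}$ (and $[-1]$ to $k$). A morphism $(\varphi,g)\colon [n]\to[m]$ sends $a_0\otimes\cdots\otimes a_n$ to the tensor whose $j$-th factor, $0\le j\le m$, is the product of the $a_i^{z_i}$ over $i\in(\varphi\sigma)^{-1}(j)$ in the order of the fibre, where $a^1=a$, $a^t=\overline a$ and an empty product is $1$. $\mathsf H_A$ is the restriction of $\mathsf H_{A+}$ to $\Delta H$. For a small category $\mathbf C$, $G\colon\mathbf C^{op}\to\mathbf{Mod}_k$ and $F\colon\mathbf C\to\mathbf{Mod}_k$, let $G\otimes_{\mathbf C}F$ be the quotient of $\bigoplus_C G(C)\otimes_k F(C)$ by the elements $G(\alpha)(x)\otimes y-x\otimes F(\alpha)(y)$, and let $\mathrm{Tor}^{\mathbf C}_\star$ be its left derived functors. Hyperoctahedral homology is $HO_n(A)=\mathrm{Tor}_n^{\Delta H}(k^\star,\mathsf H_A)$, where $k^\star$ is the constant functor at $k$. The simplicial $k$-module $C_\star(\Delta H_+,\mathsf H_{A+})$ is in degree $p$ the sum of the modules $\mathsf H_{A+}(C_0)$ over all strings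 $C_0\xrightarrow{f_1}\cdots\xrightarrow{f_p}C_p$ in $\Delta H_+$. Here $\partial_0(f_p,\dots,f_1,x)=(f_p,\dots,f_2,\mathsf H_{A+}(f_1)(x))$, the other faces compose two adjacent morphisms or drop $f_p$, and degeneracies insert identities. *Operads.* Let $\mathbf{sMod}_k$ be the category of simplicial $k$-modules with the level-wise tensor product. An operad $\mathcal O$ in $\mathbf{sMod}_k$ is a functor $\mathbf S^{op}\to\mathbf{sMod}_k$ with a unit and composition maps that satisfy May's associativity, unit and equivariance axioms, and with $\mathcal O(0)$ the monoidal unit. It is an $E_\infty$-operad if each $\mathcal O(n)$ is weakly equivalent to the monoidal unit (through maps inducing isomorphisms on homology) and is in each degree a free right $k[\Sigma_n]$-module. An $\mathcal O$-algebra is an object $X$ with maps $\mathcal O(m)\otimes X^{\otimes m}\to X$ that satisfy the usual naturality, unit, associativity and equivariance axioms; for an $E_\infty$-operad $\mathcal O$ it is called an $E_\infty$-algebra. For a group $G$ let $\mathbb EG$ be the category with object set $G$ and exactly one morphism between any two objects. The Barratt–Eccles operad $\mathcal D_{\mathbf{Mod}}$ has $\mathcal D_{\mathbf{Mod}}(m)=k[N_\star(\mathbb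 E\Sigma_m)]$, with $\Sigma_m$ acting by right multiplication. Its composition is induced by the functors given on objects by $(\sigma,\tau_1,\dots,\tau_m)\mapsto\tau_{\sigma^{-1}(1)}\times\cdots\times\tau_{\sigma^{-1}(m)}$: each $\tau_i$ acts on a block of size $j_i$, and the blocks are then permuted according to $\sigma$. *The Schur-type construction.* Let $\widetilde{\mathcal{IF}}(m)=k[N_\star([m-1]\downarrow\Delta H_+)]$, where $[m-1]\downarrow\Delta H_+$ is the under-category, with $\Sigma_m$ acting by precomposition. Put $\widetilde{\mathcal{IF}}\langle A\rangle=\bigoplus_{m\ge0}\widetilde{\mathcal{IF}}(m)\otimes_{\Sigma_m}A^{\otimes m}$. Let $$\lambda\colon\mathbb E\Sigma_m\times\prod_{i=1}^m\bigl([j_i-1]\downarrow\Delta H_+\bigr)\to[j_1+\cdots+j_m-1]\downarrow\Delta H_+$$ be the functor $\lambda(\sigma,f_1,\dots,f_m)=f_{\sigma^{-1}(1)}\times\cdots\times f_{\sigma^{-1}(m)}$ on objects ($f_i$ acts on the $i$-th block of size $j_i$, and the blocks are then permuted according to $\sigma$). A morphism from $(\sigma,f_1,\dots,f_m)$ to $(\tau,g_1f_1,\dots,g_mf_m)$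 given by $g_1,\dots,g_m$ is sent to the morphism that applies $g_i$ to the block in position $\sigma(i)$ and moves it to position $\tau(i)$. Let $q\colon\widetilde{\mathcal{IF}}\langle A\rangle\to C_\star(\Delta H_+,\mathsf H_{A+})$ be the map of simplicial $k$-modules that sends the class of a string $[m-1]\xrightarrow{f_0}C_0\to\cdots\to C_p$ tensored with $x\in A^{\otimes m}$ to $(C_0\to\cdots\to C_p,\ \mathsf H_{A+}(f_0)(x))$. **Theorem.** Let $A$ be an involutive $k$-algebra. 1. $C_\star(\Delta H_+,\mathsf H_{A+})$ computes hyperoctahedral homology: $H_n\bigl(C_\star(\Delta H_+,\mathsf H_{A+})\bigr)\cong HO_n(A)$ as $k$-modules for every $n\ge0$. 2. $\mathcal D_{\mathbf{Mod}}$ is an $E_\infty$-operad in $\mathbf{sMod}_k$. 3. $C_\star(\Delta H_+,\mathsf H_{A+})$ carries the structure of a $\mathcal D_{\mathbf{Mod}}$-algebra, and so of an $E_\infty$-algebra in $\mathbf{sMod}_k$, which is the quotient along $q$ of a $\mathcal D_{\mathbf{Mod}}$-algebra structure on $\widetilde{\mathcal{IF}}\langle A\rangle$. More precisely, $\widetilde{\mathcal{IF}}\langle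 A\rangle$ has a $\mathcal D_{\mathbf{Mod}}$-algebra structure $\nu$ given on generators, in each simplicial degree, by $$\nu\bigl(s;[t_1\otimes x_1],\dots,[t_m\otimes x_m]\bigr)=\bigl[\lambda(s;t_1,\dots,t_m)\otimes(x_1\otimes\cdots\otimes x_m)\bigr],$$ the map $q$ is surjective in each degree, and $C_\star(\Delta H_+,\mathsf H_{A+})$ has a $\mathcal D_{\mathbf{Mod}}$-algebra structure for which $q$ is a map of $\mathcal D_{\mathbf{Mod}}$-algebras. -/

import Mathlib

open CategoryTheory Opposite
open scoped TensorProduct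

universe u

namespace HyperHom

/-- The objects of `ΔH₊`; the object of length `n` is `[n - 1]`, so that length `0` is the
appended initial object `[-1]`. -/
@[ext]
structure DeltaHPlus : Type where
  len : ℕ

/-- A morphism `(φ, g)` of `ΔH₊`, where `φ` is order preserving and `g = (z₀, …, zₙ; σ)` is an
element of the hyperoctahedral group; the group element acts first. The group `C₂` is `ℤˣ`,
with `t = -1`. -/
@[ext]
structure DeltaHPlus.Mor (n m : ℕ) : Type where
  φ : Fin n →o Fin m
  z : Fin n → ℤˣ
  σ : Equiv.Perm (Fin n)

namespace DeltaHPlus.Mor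

/-- The underlying map of sets `φ ∘ σ`. -/
def toFun {n m : ℕ} (F : Mor n m) (i : Fin n) : Fin m := F.φ (F.σ i)

theorem ext_of_lt {n m : ℕ} {F G : Mor n m} (hf : ∀ i, F.toFun i = G.toFun i)
    (hz : ∀ i, F.z i = G.z i) (hσ : ∀ i j, F.σ i < F.σ j ↔ G.σ i < G.σ j) : F = G := by
  have h1 : F.σ = G.σ := by
    let e : Fin n ≃o Fin n :=
      StrictMono.orderIsoOfSurjective (fun i => G.σ (F.σ.symm i))
        (fun i j hij => (hσ _ _).1 (by simpa using hij))
        (G.σ.surjective.comp F.σ.symm.surjective)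
    have he : e = OrderIso.refl _ := Subsingleton.elim _ _
    ext i
    have : e (F.σ i) = F.σ i := by rw [he]; rfl
    have h2 : e (F.σ i) = G.σ i :=
      congrArg G.σ (F.σ.symm_apply_apply i)
    rw [← h2, this]
  have h2 : F.φ = G.φ := by
    ext i
    have := hf (F.σ.symm i)
    simp only [toFun, Equiv.apply_symm_apply, ← h1] at this
    rw [this]
  exact Mor.ext h2 (funext hz) h1

/-- The identity `(id, (1, …, 1; id))`. -/
def id (n : ℕ) : Mor n n := ⟨OrderHom.id, 1, 1⟩

/-- The position of `i` in the source of `h_⋆(φ)`, for the composite `h ∘ (φ, g)` with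
`h = (w; τ)`: the blocks of the map underlying `(φ, g)` are permuted by `τ`, and a block whose
label is `t` is reversed. -/
def key {n m l : ℕ} (G : Mor m l) (F : Mor n m) (i : Fin n) : Fin m ×ₗ Fin n :=
  toLex (G.σ (F.toFun i), if G.z (F.toFun i) = 1 then F.σ i else Fin.rev (F.σ i))

theorem key_injective {n m l : ℕ} (G : Mor m l) (F : Mor n m) :
    Function.Injective (key G F) := by
  intro i j h
  have h' := congrArg ofLex h
  simp only [key, ofLex_toLex, Prod.mk.injEq, EmbeddingLike.apply_eq_iff_eq] at h'
  obtain ⟨h1, h2⟩ := h'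
  rw [h1] at h2
  split_ifs at h2 <;> simpa using h2

/-- The composite `(ψ, h) ∘ (φ, g) = (ψ ∘ h_⋆(φ), φ^⋆(h) ∘ g)` of the hyperoctahedral category.
The permutation of `φ^⋆(h) ∘ g` sorts the positions `key`, the order preserving map `h_⋆(φ)`
is the first component of the sorted positions, and the labels are multiplied. -/
def comp {n m l : ℕ} (G : Mor m l) (F : Mor n m) : Mor n l where
  φ := ⟨fun s => G.φ (ofLex (key G F (Tuple.sort (key G F) s))).1, fun _ _ h =>
    G.φ.monotone (Prod.Lex.monotone_fst _ _ (Tuple.monotone_sort (key G F) h))⟩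
  z i := F.z i * G.z (F.toFun i)
  σ := (Tuple.sort (key G F)).symm

@[simp] theorem toFun_id (n : ℕ) (i : Fin n) : (id n).toFun i = i := rfl

@[simp] theorem z_id (n : ℕ) (i : Fin n) : (id n).z i = 1 := rfl

@[simp] theorem σ_id (n : ℕ) (i : Fin n) : (id n).σ i = i := rfl

@[simp] theorem toFun_comp {n m l : ℕ} (G : Mor m l) (F : Mor n m) (i : Fin n) :
    (comp G F).toFun i = G.toFun (F.toFun i) := by
  simp [toFun, comp, key]

@[simp] theorem z_comp {n m l : ℕ} (G : Mor m l) (F : Mor n m) (i : Fin n) :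
    (comp G F).z i = F.z i * G.z (F.toFun i) := rfl

theorem σ_comp_lt_key {n m l : ℕ} (G : Mor m l) (F : Mor n m) (i j : Fin n) :
    (comp G F).σ i < (comp G F).σ j ↔ key G F i < key G F j := by
  have hm : StrictMono (key G F ∘ Tuple.sort (key G F)) :=
    (Tuple.monotone_sort _).strictMono_of_injective
      ((key_injective G F).comp (Tuple.sort _).injective)
  have := hm.lt_iff_lt (a := (Tuple.sort (key G F)).symm i) (b := (Tuple.sort (key G F)).symm j)
  simp only [Function.comp_apply, Equiv.apply_symm_apply] at this
  exact this.symm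

theorem σ_comp_lt {n m l : ℕ} (G : Mor m l) (F : Mor n m) (i j : Fin n) :
    (comp G F).σ i < (comp G F).σ j ↔
      G.σ (F.toFun i) < G.σ (F.toFun j) ∨ (F.toFun i = F.toFun j ∧
        ((G.z (F.toFun i) = 1 ∧ F.σ i < F.σ j) ∨ (G.z (F.toFun i) ≠ 1 ∧ F.σ j < F.σ i))) := by
  rw [σ_comp_lt_key, key, key, Prod.Lex.toLex_lt_toLex]
  simp only [EmbeddingLike.apply_eq_iff_eq]
  apply or_congr Iff.rfl
  apply and_congr_right
  intro h
  rw [← h]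
  split_ifs with h1 <;> simp [h1]

end DeltaHPlus.Mor

instance : SmallCategory DeltaHPlus where
  Hom X Y := DeltaHPlus.Mor X.len Y.len
  id X := DeltaHPlus.Mor.id X.len
  comp F G := DeltaHPlus.Mor.comp G F
  id_comp F := by
    apply DeltaHPlus.Mor.ext_of_lt
    · simp
    · intro i; simp
    · intro i j
      rw [DeltaHPlus.Mor.σ_comp_lt]
      simp only [DeltaHPlus.Mor.toFun_id, DeltaHPlus.Mor.σ_id]
      grind
  comp_id F := by
    apply DeltaHPlus.Mor.ext_of_lt
    · simp
    · intro i; simp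
    · intro i j
      rw [DeltaHPlus.Mor.σ_comp_lt]
      simp only [DeltaHPlus.Mor.σ_id, DeltaHPlus.Mor.z_id, DeltaHPlus.Mor.toFun]
      have := F.φ.monotone (a := F.σ j) (b := F.σ i)
      have h2 := F.φ.monotone (a := F.σ i) (b := F.σ j)
      grind
  assoc F G H := by
    apply DeltaHPlus.Mor.ext_of_lt
    · simp
    · intro i; simp [mul_assoc]
    · intro i j
      simp only [DeltaHPlus.Mor.σ_comp_lt, DeltaHPlus.Mor.toFun_comp, DeltaHPlus.Mor.z_comp]
      have hH : ∀ a b, H.σ a < H.σ b → a ≠ b := by rintro a b h rfl; exact lt_irrefl _ h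
      have hG : ∀ a b, G.σ a < G.σ b → a ≠ b := by rintro a b h rfl; exact lt_irrefl _ h
      have key : ∀ a b : ℤˣ, a * b = 1 ↔ ((a = 1 ∧ b = 1) ∨ (a ≠ 1 ∧ b ≠ 1)) := by decide
      rw [key]
      grind


/-- The elements of the fibre over `j` of the map underlying `(φ, g)`, in the order of `φ`. -/
def DeltaHPlus.Mor.fib {n m : ℕ} (F : Mor n m) (j : Fin m) : List (Fin n) :=
  ((List.finRange n).filter (fun s => F.φ s = j)).map F.σ.symm

namespace DeltaHPlus.Mor

theorem mem_fib {n m : ℕ} (F : Mor n m) (j : Fin m) (i : Fin n) :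
    i ∈ F.fib j ↔ F.toFun i = j := by
  simp only [fib, List.mem_map, List.mem_filter, List.mem_finRange, true_and, decide_eq_true_eq,
    toFun]
  constructor
  · rintro ⟨s, hs, rfl⟩; simpa using hs
  · intro h; exact ⟨F.σ i, h, by simp⟩

theorem pairwise_fib {n m : ℕ} (F : Mor n m) (j : Fin m) :
    (F.fib j).Pairwise (fun i i' => F.σ i < F.σ i') := by
  unfold fib
  rw [List.pairwise_map]
  simp only [Equiv.apply_symm_apply]
  exact (List.pairwise_lt_finRange n).filter _

theorem fib_comp {n m l : ℕ} (G : Mor m l) (F : Mor n m) (j : Fin l) :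
    (comp G F).fib j =
      (G.fib j).flatMap (fun b => if G.z b = 1 then F.fib b else (F.fib b).reverse) := by
  have hp : ((G.fib j).flatMap (fun b => if G.z b = 1 then F.fib b else (F.fib b).reverse)).Pairwise
      (fun i i' => (comp G F).σ i < (comp G F).σ i') := by
    rw [List.pairwise_flatMap]
    constructor
    · intro b _
      split_ifs with h
      · refine (List.Pairwise.and_mem.1 (F.pairwise_fib b)).imp ?_
        rintro x y ⟨hx, hy, hxy⟩
        rw [mem_fib] at hx hy
        rw [σ_comp_lt]
        right; exact ⟨by rw [hx, hy], Or.inl ⟨by rw [hx]; exact h, hxy⟩⟩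
      · rw [List.pairwise_reverse]
        refine (List.Pairwise.and_mem.1 (F.pairwise_fib b)).imp ?_
        rintro x y ⟨hx, hy, hxy⟩
        rw [mem_fib] at hx hy
        rw [σ_comp_lt]
        right; exact ⟨by rw [hx, hy], Or.inr ⟨by rw [hy]; exact h, hxy⟩⟩
    · refine (G.pairwise_fib j).imp ?_
      intro b c hbc x hx y hy
      have hx' : x ∈ F.fib b := by split_ifs at hx <;> simpa using hx
      have hy' : y ∈ F.fib c := by split_ifs at hy <;> simpa using hy
      rw [mem_fib] at hx' hy'
      rw [σ_comp_lt]
      left; rw [hx', hy']; exact hbc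
  have hn : ∀ {L : List (Fin n)}, L.Pairwise (fun i i' => (comp G F).σ i < (comp G F).σ i') →
      L.Nodup := fun h => h.imp (by rintro x y hxy rfl; exact lt_irrefl _ hxy)
  refine List.Perm.eq_of_pairwise (le := fun i i' => (comp G F).σ i < (comp G F).σ i') ?_
    (pairwise_fib _ j) hp ?_
  · intro a b _ _ h1 h2; exact absurd h1 (lt_asymm h2)
  · rw [List.perm_ext_iff_of_nodup (hn (pairwise_fib _ j)) (hn hp)]
    intro x
    rw [mem_fib, List.mem_flatMap, toFun_comp]
    constructor
    · intro h
      refine ⟨F.toFun x, (mem_fib _ _ _).2 h, ?_⟩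
      split_ifs <;> simp [mem_fib]
    · rintro ⟨b, hb, hx⟩
      have hx' : x ∈ F.fib b := by split_ifs at hx <;> simpa using hx
      rw [mem_fib] at hb hx'
      rw [hx', hb]

end DeltaHPlus.Mor

/-- A `k`-linear involution of an associative unital `k`-algebra. -/
structure Involution (k A : Type*) [CommRing k] [Ring A] [Algebra k A] where
  toLin : A →ₗ[k] A
  map_mul : ∀ a b, toLin (a * b) = toLin b * toLin a
  invol : ∀ a, toLin (toLin a) = a

section Bar

variable {k A : Type*} [CommRing k] [Ring A] [Algebra k A] (τ : Involution k A)

/-- `a ↦ a ^ z`, that is `a` for `z = 1` and the conjugate of `a` for `z = t`. -/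
def Involution.act (z : ℤˣ) : A →ₗ[k] A := if z = 1 then LinearMap.id else τ.toLin

theorem Involution.map_one : τ.toLin 1 = 1 := by
  have h := τ.map_mul (τ.toLin 1) 1
  rw [mul_one, τ.invol, mul_one] at h
  exact h.symm

theorem Involution.act_act (z w : ℤˣ) (a : A) : τ.act z (τ.act w a) = τ.act (w * z) a := by
  rcases Int.units_eq_one_or z with rfl | rfl <;> rcases Int.units_eq_one_or w with rfl | rfl <;>
    simp [Involution.act, τ.invol]

theorem Involution.act_prod (z : ℤˣ) (L : List A) :
    τ.act z L.prod = ((if z = 1 then L else L.reverse).map (τ.act z)).prod := by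
  split_ifs with h
  · simp [Involution.act, h]
  · simp only [Involution.act, h, if_false]
    induction L with
    | nil => simpa using τ.map_one
    | cons a L ih => simp [τ.map_mul, ih]

/-- The factor of index `j` in the image of `a₀ ⊗ ⋯ ⊗ aₙ`, namely the ordered product of the
`a_i ^ z_i` over the fibre of `j`. -/
def barProd {n m : ℕ} (F : DeltaHPlus.Mor n m) (a : Fin n → A) (j : Fin m) : A :=
  ((F.fib j).map fun i => τ.act (F.z i) (a i)).prod

theorem barProd_id {n : ℕ} (a : Fin n → A) :
    barProd τ (DeltaHPlus.Mor.id n) a = a := by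
  funext j
  have : (DeltaHPlus.Mor.id n).fib j = [j] := by
    have h : (DeltaHPlus.Mor.id n).fib j = (List.finRange n).filter (fun s => s = j) := by
      simp only [DeltaHPlus.Mor.fib, DeltaHPlus.Mor.id]
      exact List.map_id _
    rw [h]
    apply List.perm_singleton.1
    rw [List.perm_ext_iff_of_nodup ((List.nodup_finRange n).filter _) (List.nodup_singleton j)]
    simp
  simp [barProd, this, Involution.act]

theorem barProd_comp {n m l : ℕ} (G : DeltaHPlus.Mor m l) (F : DeltaHPlus.Mor n m)
    (a : Fin n → A) : barProd τ (G.comp F) a = barProd τ G (barProd τ F a) := by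
  funext j
  rw [barProd, DeltaHPlus.Mor.fib_comp, barProd, List.flatMap_def, List.map_flatten,
    List.prod_flatten, List.map_map, List.map_map]
  congr 1
  apply List.map_congr_left
  intro b _
  simp only [Function.comp_apply]
  rw [barProd, Involution.act_prod]
  congr 1
  have key : ∀ L : List (Fin n), (∀ i ∈ L, F.toFun i = b) →
      L.map (fun i => τ.act ((G.comp F).z i) (a i)) =
        (L.map fun i => τ.act (F.z i) (a i)).map (τ.act (G.z b)) := by
    intro L hL
    rw [List.map_map]
    apply List.map_congr_left
    intro i hi
    simp [Involution.act_act, hL i hi]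
  split_ifs with h
  · exact key _ fun i hi => (DeltaHPlus.Mor.mem_fib _ _ _).1 hi
  · rw [← List.map_reverse]
    exact key _ fun i hi => (DeltaHPlus.Mor.mem_fib _ _ _).1 (List.mem_reverse.1 hi)

theorem barProd_eq_ofFn {n m : ℕ} (F : DeltaHPlus.Mor n m) (a : Fin n → A) (j : Fin m) :
    barProd τ F a j = MultilinearMap.mkPiAlgebraFin k n A (fun s =>
      if F.φ s = j then τ.act (F.z (F.σ.symm s)) (a (F.σ.symm s)) else 1) := by
  rw [MultilinearMap.mkPiAlgebraFin_apply, List.ofFn_eq_map, barProd, DeltaHPlus.Mor.fib,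
    List.map_map]
  induction List.finRange n with
  | nil => rfl
  | cons s L ih =>
    by_cases h : F.φ s = j <;> simp [h, ih]

theorem barProd_update {n m : ℕ} (F : DeltaHPlus.Mor n m) (a : Fin n → A) (i : Fin n) :
    ∃ f : A →ₗ[k] A, ∀ x, barProd τ F (Function.update a i x) =
      Function.update (barProd τ F a) (F.toFun i) (f x) := by
  let b : Fin n → A := fun s =>
    if F.φ s = F.toFun i then τ.act (F.z (F.σ.symm s)) (a (F.σ.symm s)) else 1
  refine ⟨((MultilinearMap.mkPiAlgebraFin k n A).toLinearMap b (F.σ i)) ∘ₗ τ.act (F.z i), ?_⟩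
  intro x
  funext j
  by_cases hj : j = F.toFun i
  · subst hj
    rw [Function.update_self, barProd_eq_ofFn]
    simp only [LinearMap.comp_apply, MultilinearMap.toLinearMap_apply]
    congr 1
    funext s
    by_cases hs : s = F.σ i
    · subst hs
      simp [DeltaHPlus.Mor.toFun]
    · have : F.σ.symm s ≠ i := fun h => hs (by rw [← h]; simp)
      simp [Function.update_of_ne hs, Function.update_of_ne this, b]
  · rw [Function.update_of_ne hj, barProd, barProd]
    congr 1
    apply List.map_congr_left
    intro i' hi'
    rw [DeltaHPlus.Mor.mem_fib] at hi'
    have : i' ≠ i := by rintro rfl; exact hj hi'.symm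
    rw [Function.update_of_ne this]

/-- The map `A^{⊗ n} → A^{⊗ m}` of the hyperoctahedral bar construction. -/
noncomputable def barMap {n m : ℕ} (F : DeltaHPlus.Mor n m) :
    (⨂[k] _ : Fin n, A) →ₗ[k] (⨂[k] _ : Fin m, A) :=
  PiTensorProduct.lift
    { toFun := fun a => PiTensorProduct.tprod k (barProd τ F a)
      map_update_add' := by
        intro inst a i x y
        rw [Subsingleton.elim inst (instDecidableEqFin n)]
        obtain ⟨f, hf⟩ := barProd_update τ F a i
        rw [hf, hf, hf, map_add, MultilinearMap.map_update_add]
      map_update_smul' := by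
        intro inst a i c x
        rw [Subsingleton.elim inst (instDecidableEqFin n)]
        obtain ⟨f, hf⟩ := barProd_update τ F a i
        rw [hf, hf, map_smul, MultilinearMap.map_update_smul] }

@[simp] theorem barMap_tprod {n m : ℕ} (F : DeltaHPlus.Mor n m) (a : Fin n → A) :
    barMap τ F (PiTensorProduct.tprod k a) = PiTensorProduct.tprod k (barProd τ F a) := by
  simp [barMap]

end Bar

/-- The extended hyperoctahedral bar construction `H_{A+}`, with `[n - 1] ↦ A^{⊗ n}`; its value
at `[-1]` is the empty tensor product, that is `k`. -/
noncomputable def barFunctor (k A : Type u) [CommRing k] [Ring A] [Algebra k A]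
    (τ : Involution k A) : DeltaHPlus ⥤ ModuleCat.{u} k where
  obj X := ModuleCat.of k (⨂[k] _ : Fin X.len, A)
  map F := ModuleCat.ofHom (barMap τ F)
  map_id X := by
    apply ModuleCat.hom_ext
    apply PiTensorProduct.ext
    ext a
    exact (barMap_tprod τ _ a).trans (congrArg _ (barProd_id τ a))
  map_comp F G := by
    apply ModuleCat.hom_ext
    apply PiTensorProduct.ext
    ext a
    refine (barMap_tprod τ _ a).trans ((congrArg _ (barProd_comp τ G F a)).trans ?_)
    simp


open Limits

section FunctorHomology

variable {k : Type u} [CommRing k] {C : Type} [SmallCategory C]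

open Classical in
/-- The submodule spanned by `G(α)(x) ⊗ y - x ⊗ F(α)(y)`. -/
def tensorRel (G : Cᵒᵖ ⥤ ModuleCat.{u} k) (F : C ⥤ ModuleCat.{u} k) :
    Submodule k (DirectSum C fun c => (G.obj (op c) : Type u) ⊗[k] (F.obj c : Type u)) :=
  Submodule.span k {w | ∃ (c d : C) (α : c ⟶ d) (x : G.obj (op d)) (y : F.obj c),
    w = DirectSum.lof k C (fun c => (G.obj (op c) : Type u) ⊗[k] (F.obj c : Type u)) c
          ((G.map α.op).hom x ⊗ₜ[k] y) -
        DirectSum.lof k C (fun c => (G.obj (op c) : Type u) ⊗[k] (F.obj c : Type u)) d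
          (x ⊗ₜ[k] (F.map α).hom y)}

/-- The tensor product `G ⊗_C F` of a right and a left `C`-module. -/
abbrev tensorObj (G : Cᵒᵖ ⥤ ModuleCat.{u} k) (F : C ⥤ ModuleCat.{u} k) : Type u :=
  (DirectSum C fun c => (G.obj (op c) : Type u) ⊗[k] (F.obj c : Type u)) ⧸ tensorRel G F

open Classical in
/-- The class `[x ⊗ y]` in `G ⊗_C F`. -/
noncomputable def tensorMk (G : Cᵒᵖ ⥤ ModuleCat.{u} k) (F : C ⥤ ModuleCat.{u} k) (c : C)
    (x : G.obj (op c)) (y : F.obj c) : tensorObj G F :=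
  (tensorRel G F).mkQ
    (DirectSum.lof k C (fun c => (G.obj (op c) : Type u) ⊗[k] (F.obj c : Type u)) c (x ⊗ₜ[k] y))

theorem tensorMk_map {G : Cᵒᵖ ⥤ ModuleCat.{u} k} {F : C ⥤ ModuleCat.{u} k} {c d : C} (α : c ⟶ d)
    (x : G.obj (op d)) (y : F.obj c) :
    tensorMk G F c ((G.map α.op).hom x) y = tensorMk G F d x ((F.map α).hom y) := by
  rw [tensorMk, tensorMk, ← sub_eq_zero, ← map_sub, Submodule.mkQ_apply,
    Submodule.Quotient.mk_eq_zero]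
  exact Submodule.subset_span ⟨c, d, α, x, y, rfl⟩

open Classical in
/-- Linear maps out of `G ⊗_C F`. -/
noncomputable def tensorDesc (G : Cᵒᵖ ⥤ ModuleCat.{u} k) (F : C ⥤ ModuleCat.{u} k) {M : Type u}
    [AddCommGroup M] [Module k M] (b : ∀ c : C, G.obj (op c) →ₗ[k] F.obj c →ₗ[k] M)
    (hb : ∀ (c d : C) (α : c ⟶ d) (x : G.obj (op d)) (y : F.obj c),
      b c ((G.map α.op).hom x) y = b d x ((F.map α).hom y)) : tensorObj G F →ₗ[k] M :=
  (tensorRel G F).liftQ (DirectSum.toModule k C M fun c => TensorProduct.lift (b c)) (by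
    rw [tensorRel, Submodule.span_le]
    rintro _ ⟨c, d, α, x, y, rfl⟩
    simp [hb])

@[simp] theorem tensorDesc_mk (G : Cᵒᵖ ⥤ ModuleCat.{u} k) (F : C ⥤ ModuleCat.{u} k) {M : Type u}
    [AddCommGroup M] [Module k M] (b : ∀ c : C, G.obj (op c) →ₗ[k] F.obj c →ₗ[k] M) (hb) (c : C)
    (x : G.obj (op c)) (y : F.obj c) : tensorDesc G F b hb (tensorMk G F c x y) = b c x y := by
  simp [tensorDesc, tensorMk]

theorem tensor_hom_ext {G : Cᵒᵖ ⥤ ModuleCat.{u} k} {F : C ⥤ ModuleCat.{u} k} {M : Type u}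
    [AddCommGroup M] [Module k M] {f g : tensorObj G F →ₗ[k] M}
    (h : ∀ c x y, f (tensorMk G F c x y) = g (tensorMk G F c x y)) : f = g := by
  classical
  apply Submodule.linearMap_qext
  apply DirectSum.linearMap_ext
  intro c
  apply TensorProduct.ext'
  intro x y
  exact h c x y

/-- The bilinear map `(x, y) ↦ [x ⊗ y]`. -/
noncomputable def tensorMkBilin (G : Cᵒᵖ ⥤ ModuleCat.{u} k) (F : C ⥤ ModuleCat.{u} k) (c : C) :
    G.obj (op c) →ₗ[k] F.obj c →ₗ[k] tensorObj G F :=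
  LinearMap.mk₂ k (tensorMk G F c)
    (fun _ _ _ => by simp only [tensorMk, TensorProduct.add_tmul, map_add])
    (fun _ _ _ => by simp only [tensorMk, ← TensorProduct.smul_tmul', map_smul])
    (fun _ _ _ => by simp only [tensorMk, TensorProduct.tmul_add, map_add])
    (fun _ _ _ => by simp only [tensorMk, TensorProduct.tmul_smul, map_smul])

/-- The map `[x ⊗ y] ↦ [Θ(x) ⊗ y]` induced by a map of right `C`-modules. -/
noncomputable def tensorMap {G G' : Cᵒᵖ ⥤ ModuleCat.{u} k} (Θ : G ⟶ G')
    (F : C ⥤ ModuleCat.{u} k) : tensorObj G F →ₗ[k] tensorObj G' F :=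
  tensorDesc G F (fun c => (tensorMkBilin G' F c).comp (Θ.app (op c)).hom) (by
    intro c d α x y
    change tensorMk G' F c ((Θ.app (op c)).hom ((G.map α.op).hom x)) y =
      tensorMk G' F d ((Θ.app (op d)).hom x) ((F.map α).hom y)
    rw [← tensorMk_map]
    congr 1
    exact NatTrans.naturality_apply Θ α.op x)

@[simp] theorem tensorMap_mk {G G' : Cᵒᵖ ⥤ ModuleCat.{u} k} (Θ : G ⟶ G')
    (F : C ⥤ ModuleCat.{u} k) (c : C) (x : G.obj (op c)) (y : F.obj c) :
    tensorMap Θ F (tensorMk G F c x y) = tensorMk G' F c ((Θ.app (op c)).hom x) y :=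
  tensorDesc_mk _ _ _ _ _ _ _

/-- The functor `- ⊗_C F` from right `C`-modules to `k`-modules. -/
noncomputable def tensorFunctor (F : C ⥤ ModuleCat.{u} k) :
    (Cᵒᵖ ⥤ ModuleCat.{u} k) ⥤ ModuleCat.{u} k where
  obj G := ModuleCat.of k (tensorObj G F)
  map Θ := ModuleCat.ofHom (tensorMap Θ F)
  map_id G := by
    apply ModuleCat.hom_ext
    apply tensor_hom_ext
    intro c x y
    simp
  map_comp Θ Ψ := by
    apply ModuleCat.hom_ext
    apply tensor_hom_ext
    intro c x y
    simp

instance (F : C ⥤ ModuleCat.{u} k) : (tensorFunctor F).Additive where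
  map_add {G G' Θ Ψ} := by
    apply ModuleCat.hom_ext
    apply tensor_hom_ext
    intro c x y
    have h : tensorMk G' F c ((Θ.app (op c)).hom x + (Ψ.app (op c)).hom x) y =
        tensorMk G' F c ((Θ.app (op c)).hom x) y + tensorMk G' F c ((Ψ.app (op c)).hom x) y := by
      simp only [tensorMk, TensorProduct.add_tmul, map_add]
    change tensorMap (Θ + Ψ) F (tensorMk G F c x y) =
      tensorMap Θ F (tensorMk G F c x y) + tensorMap Ψ F (tensorMk G F c x y)
    simpa using h

/-- The generators of the free right `C`-module that covers `G`. -/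
structure CoverGen (G : Cᵒᵖ ⥤ ModuleCat.{u} k) (d : Cᵒᵖ) : Type u where
  c : C
  x : G.obj (op c)
  a : d.unop ⟶ c

/-- Precomposition on the generators. -/
def CoverGen.pre {G : Cᵒᵖ ⥤ ModuleCat.{u} k} {d e : Cᵒᵖ} (f : d ⟶ e) (s : CoverGen G d) :
    CoverGen G e := ⟨s.c, s.x, f.unop ≫ s.a⟩

/-- The direct sum of the representable right `C`-modules `k[Hom(-, c)]`, over all `c` and all
elements of `G(c)`. -/
noncomputable def coverObj (G : Cᵒᵖ ⥤ ModuleCat.{u} k) : Cᵒᵖ ⥤ ModuleCat.{u} k where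
  obj d := ModuleCat.of k (CoverGen G d →₀ k)
  map f := ModuleCat.ofHom (Finsupp.lmapDomain k k (CoverGen.pre f))
  map_id d := by
    apply ModuleCat.hom_ext
    apply Finsupp.lhom_ext
    intro s r
    simp [Finsupp.mapDomain_single, CoverGen.pre]
  map_comp f g := by
    apply ModuleCat.hom_ext
    apply Finsupp.lhom_ext
    intro s r
    simp [Finsupp.mapDomain_single, CoverGen.pre]

/-- Maps out of the free right `C`-module are given by the values on the generators. -/
noncomputable def coverLift (G H : Cᵒᵖ ⥤ ModuleCat.{u} k)
    (v : ∀ c : C, G.obj (op c) → H.obj (op c)) : coverObj G ⟶ H where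
  app d := ModuleCat.ofHom (Finsupp.linearCombination k fun s : CoverGen G d =>
    (H.map s.a.op).hom (v s.c s.x))
  naturality d e f := by
    apply ModuleCat.hom_ext
    apply Finsupp.lhom_ext
    intro s r
    simp [coverObj, CoverGen.pre, Finsupp.mapDomain_single]

theorem coverLift_single (G H : Cᵒᵖ ⥤ ModuleCat.{u} k)
    (v : ∀ c : C, G.obj (op c) → H.obj (op c)) (d : Cᵒᵖ) (s : CoverGen G d) :
    ((coverLift G H v).app d).hom (Finsupp.single s (1 : k)) = (H.map s.a.op).hom (v s.c s.x) :=
  (Finsupp.linearCombination_single k (1 : k) s).trans (one_smul _ _)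

theorem cover_hom_ext {G H : Cᵒᵖ ⥤ ModuleCat.{u} k} {f g : coverObj G ⟶ H}
    (h : ∀ (c : C) (x : G.obj (op c)),
      (f.app (op c)).hom (Finsupp.single (⟨c, x, 𝟙 c⟩ : CoverGen G (op c)) (1 : k)) =
        (g.app (op c)).hom (Finsupp.single (⟨c, x, 𝟙 c⟩ : CoverGen G (op c)) (1 : k))) :
    f = g := by
  apply NatTrans.ext
  funext d
  apply ModuleCat.hom_ext
  apply Finsupp.lhom_ext'
  rintro ⟨c, x, a⟩
  apply LinearMap.ext_ring
  have e : Finsupp.single (⟨c, x, a⟩ : CoverGen G d) (1 : k) = ((coverObj G).map a.op).hom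
      (Finsupp.single (⟨c, x, 𝟙 c⟩ : CoverGen G (op c)) (1 : k)) := by
    refine Eq.symm (Finsupp.mapDomain_single.trans ?_)
    simp [CoverGen.pre]
  have hf := NatTrans.naturality_apply f a.op
    (Finsupp.single (⟨c, x, 𝟙 c⟩ : CoverGen G (op c)) (1 : k))
  have hg := NatTrans.naturality_apply g a.op
    (Finsupp.single (⟨c, x, 𝟙 c⟩ : CoverGen G (op c)) (1 : k))
  change (f.app d).hom (Finsupp.single (⟨c, x, a⟩ : CoverGen G d) (1 : k)) =
    (g.app d).hom (Finsupp.single (⟨c, x, a⟩ : CoverGen G d) (1 : k))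
  rw [e]
  exact hf.trans ((congrArg _ (h c x)).trans hg.symm)

instance (G : Cᵒᵖ ⥤ ModuleCat.{u} k) : Projective (coverObj G) where
  factors {E X} f e _ := by
    have hs : ∀ c : C, Function.Surjective (e.app (op c)).hom := fun c =>
      (ModuleCat.epi_iff_surjective _).1 inferInstance
    refine ⟨coverLift G E fun c x => (hs c ((f.app (op c)).hom
      (Finsupp.single (⟨c, x, 𝟙 c⟩ : CoverGen G (op c)) (1 : k)))).choose, ?_⟩
    apply cover_hom_ext
    intro c x
    have h := (hs c ((f.app (op c)).hom
      (Finsupp.single (⟨c, x, 𝟙 c⟩ : CoverGen G (op c)) (1 : k)))).choose_spec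
    refine (congrArg (e.app (op c)).hom (coverLift_single _ _ _ _ _)).trans ?_
    simpa using h

instance : EnoughProjectives (Cᵒᵖ ⥤ ModuleCat.{u} k) where
  presentation G := ⟨{
    p := coverObj G
    f := coverLift G G fun _ x => x
    epi := by
      have : ∀ d, Epi ((coverLift G G fun _ x => x).app d) := fun d => by
        rw [ModuleCat.epi_iff_surjective]
        intro x
        refine ⟨Finsupp.single (⟨d.unop, x, 𝟙 d.unop⟩ : CoverGen G d) (1 : k), ?_⟩
        refine (coverLift_single _ _ _ _ _).trans ?_
        simp
      exact NatTrans.epi_of_epi_app _ }⟩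

/-- The `k`-constant right `C`-module `k^⋆`. -/
abbrev constRight (k : Type u) [CommRing k] (C : Type) [SmallCategory C] :
    Cᵒᵖ ⥤ ModuleCat.{u} k :=
  (Functor.const Cᵒᵖ).obj (ModuleCat.of k k)

/-- `Tor_n^C(G, F)`, the left derived functors of `- ⊗_C F` evaluated at `G`. -/
noncomputable def tor (n : ℕ) (G : Cᵒᵖ ⥤ ModuleCat.{u} k) (F : C ⥤ ModuleCat.{u} k) :
    ModuleCat.{u} k :=
  ((tensorFunctor F).leftDerived n).obj G

/-- The simplicial structure of the nerve, on strings of composable morphisms. -/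
def pull {Δ Δ' : SimplexCategoryᵒᵖ} (θ : Δ ⟶ Δ') (s : ComposableArrows C Δ.unop.len) :
    ComposableArrows C Δ'.unop.len :=
  (nerve C).map θ s

/-- The direct sum of the modules `F(C₀)` over all strings `C₀ ⟶ ⋯ ⟶ C_p`. -/
abbrev GZ (F : C ⥤ ModuleCat.{u} k) (p : ℕ) : Type u :=
  DirectSum (ComposableArrows C p) fun s => (F.obj (s.obj 0) : Type u)

open Classical in
/-- The inclusion of the summand indexed by a string. -/
noncomputable def gzMk (F : C ⥤ ModuleCat.{u} k) (p : ℕ) (s : ComposableArrows C p) :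
    F.obj (s.obj 0) →ₗ[k] GZ F p :=
  DirectSum.lof k (ComposableArrows C p) (fun s => (F.obj (s.obj 0) : Type u)) s

/-- The morphism `C₀ ⟶ C_{θ(0)}` of a string. -/
def gzHead {Δ Δ' : SimplexCategoryᵒᵖ} (θ : Δ ⟶ Δ') (s : ComposableArrows C Δ.unop.len) :
    s.obj 0 ⟶ (pull θ s).obj 0 :=
  s.map (homOfLE (Fin.zero_le (θ.unop.toOrderHom 0)))

open Classical in
/-- The map `(s, x) ↦ (s ∘ θ, F(C₀ ⟶ C_{θ(0)})(x))`. -/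
noncomputable def gzMap (F : C ⥤ ModuleCat.{u} k) {Δ Δ' : SimplexCategoryᵒᵖ} (θ : Δ ⟶ Δ') :
    GZ F Δ.unop.len →ₗ[k] GZ F Δ'.unop.len :=
  DirectSum.toModule k _ _ fun s => gzMk F Δ'.unop.len (pull θ s) ∘ₗ (F.map (gzHead θ s)).hom

@[simp] theorem gzMap_mk (F : C ⥤ ModuleCat.{u} k) {Δ Δ' : SimplexCategoryᵒᵖ} (θ : Δ ⟶ Δ')
    (s : ComposableArrows C Δ.unop.len) (x : F.obj (s.obj 0)) :
    gzMap F θ (gzMk F _ s x) = gzMk F _ (pull θ s) ((F.map (gzHead θ s)).hom x) := by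
  simp [gzMap, gzMk]

theorem gz_hom_ext {F : C ⥤ ModuleCat.{u} k} {p : ℕ} {M : Type u}
    [AddCommGroup M] [Module k M] {f g : GZ F p →ₗ[k] M}
    (h : ∀ s x, f (gzMk F p s x) = g (gzMk F p s x)) : f = g := by
  classical
  apply DirectSum.linearMap_ext
  intro s
  ext x
  exact h s x

/-- The simplicial `k`-module `C_⋆(C, F)` of Gabriel and Zisman. The face `∂₀` sends
`(f_p, …, f₁, x)` to `(f_p, …, f₂, F(f₁)(x))`; the other faces compose two adjacent morphisms or
drop the last one, and the degeneracies insert identities. -/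
noncomputable def gabrielZisman (F : C ⥤ ModuleCat.{u} k) : SimplicialObject (ModuleCat.{u} k) where
  obj Δ := ModuleCat.of k (GZ F Δ.unop.len)
  map θ := ModuleCat.ofHom (gzMap F θ)
  map_id Δ := by
    apply ModuleCat.hom_ext
    apply gz_hom_ext
    intro s x
    refine (gzMap_mk _ _ _ _).trans ?_
    refine congrArg (gzMk F _ s) ?_
    exact congrArg (fun h => (ModuleCat.Hom.hom h) x)
      ((congrArg F.map (s.map_id 0)).trans (F.map_id _))
  map_comp {Δ Δ' Δ''} f g := by
    apply ModuleCat.hom_ext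
    apply gz_hom_ext
    intro s x
    refine (gzMap_mk _ _ _ _).trans (Eq.symm ?_)
    change gzMap F g (gzMap F f (gzMk F _ s x)) = _
    rw [gzMap_mk, gzMap_mk]
    refine congrArg (gzMk F _ (pull (f ≫ g) s)) ?_
    refine congrArg (fun h => (ModuleCat.Hom.hom h) x) ((F.map_comp _ _).symm.trans ?_)
    exact congrArg F.map (s.map_comp _ _).symm

end FunctorHomology


/-- The objects of the symmetric groupoid `S`: the finite sets `{1, …, n}`. -/
@[ext]
structure SymGrpd : Type where
  card : ℕ

/-- Morphisms of `S` are bijections (there are none between sets of different cardinality). -/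
instance : SmallCategory SymGrpd where
  Hom X Y := Fin X.card ≃ Fin Y.card
  id X := Equiv.refl _
  comp e f := e.trans f

theorem card_eq_of_equiv {n m : ℕ} (e : Fin n ≃ Fin m) : n = m := Fin.equiv_iff_eq.1 ⟨e⟩

/-- The isomorphism `(id, (1, …, 1; e))` of `ΔH₊` given by a bijection `e`. -/
def permMor {n m : ℕ} (e : Fin n ≃ Fin m) : DeltaHPlus.Mor n m where
  φ := ⟨Fin.cast (card_eq_of_equiv e), fun _ _ h => h⟩
  z := 1
  σ := e.trans (finCongr (card_eq_of_equiv e).symm)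

@[simp] theorem permMor_toFun {n m : ℕ} (e : Fin n ≃ Fin m) (i : Fin n) :
    (permMor e).toFun i = e i := rfl

@[simp] theorem permMor_z {n m : ℕ} (e : Fin n ≃ Fin m) (i : Fin n) : (permMor e).z i = 1 := rfl

theorem permMor_lt {n m : ℕ} (e : Fin n ≃ Fin m) (i j : Fin n) :
    (permMor e).σ i < (permMor e).σ j ↔ e i < e j := Iff.rfl

/-- The inclusion of `S = Aut ΔS₊` into `ΔH₊`. -/
def symToDelta : SymGrpd ⥤ DeltaHPlus where
  obj X := ⟨X.card⟩
  map e := permMor e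
  map_id X := DeltaHPlus.Mor.ext_of_lt (fun _ => rfl) (fun _ => rfl) (fun _ _ => Iff.rfl)
  map_comp {X Y Z} e f := by
    refine DeltaHPlus.Mor.ext_of_lt (G := DeltaHPlus.Mor.comp (permMor f) (permMor e)) ?_ ?_ ?_
    · intro i; rw [DeltaHPlus.Mor.toFun_comp]; rfl
    · intro i; rw [DeltaHPlus.Mor.z_comp]; rfl
    · intro i j
      rw [DeltaHPlus.Mor.σ_comp_lt, permMor_lt]
      simp only [permMor_lt, permMor_toFun]
      refine ⟨Or.inl, ?_⟩
      rintro (h | ⟨h, h' | h'⟩)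
      · exact h
      · rw [h] at h'; exact absurd h'.2 (lt_irrefl _)
      · rw [h] at h'; exact absurd h'.2 (lt_irrefl _)

theorem finSigma_lt {m : ℕ} {n : Fin m → ℕ} (x y : (i : Fin m) × Fin (n i)) :
    finSigmaFinEquiv x < finSigmaFinEquiv y ↔
      x.1 < y.1 ∨ (x.1 = y.1 ∧ (x.2 : ℕ) < (y.2 : ℕ)) := by
  have key : ∀ x y : (i : Fin m) × Fin (n i), x.1 < y.1 →
      finSigmaFinEquiv x < finSigmaFinEquiv y := by
    intro x y h
    rw [Fin.lt_def, finSigmaFinEquiv_apply, finSigmaFinEquiv_apply]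
    let f : ℕ → ℕ := fun i => if h : i < m then n ⟨i, h⟩ else 0
    have hs : ∀ x : Fin m, ∑ i : Fin x, n (Fin.castLE x.2.le i) = ∑ i ∈ Finset.range x, f i := by
      intro x
      rw [Finset.sum_range]
      apply Finset.sum_congr rfl
      intro i _
      have : (i : ℕ) < m := lt_trans i.2 x.2
      simp [f, this]
      rfl
    rw [hs, hs]
    have h1 : ∑ i ∈ Finset.range (x.1 + 1), f i ≤ ∑ i ∈ Finset.range y.1, f i :=
      Finset.sum_le_sum_of_subset (Finset.range_mono h)
    rw [Finset.sum_range_succ] at h1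
    have h2 : f x.1 = n x.1 := by simp [f]
    have h3 := x.2.2
    omega
  rcases lt_trichotomy x.1 y.1 with h | h | h
  · simp [h, key x y h]
  · obtain ⟨i, a⟩ := x
    obtain ⟨i', b⟩ := y
    obtain rfl : i = i' := h
    rw [Fin.lt_def, finSigmaFinEquiv_apply, finSigmaFinEquiv_apply]
    simp
  · have := key y x h
    constructor
    · intro h'; exact absurd h' (lt_asymm this)
    · rintro (h' | h')
      · exact absurd h' (lt_asymm h)
      · exact absurd h'.1 h.ne'

/-- The disjoint union `f₁ × ⋯ × f_m` of morphisms of `ΔH₊`: `f_i` acts on the `i`-th block. -/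
def blockSum {m : ℕ} {j p : Fin m → ℕ} (F : ∀ i, DeltaHPlus.Mor (j i) (p i)) :
    DeltaHPlus.Mor (∑ i, j i) (∑ i, p i) where
  φ := ⟨fun s => finSigmaFinEquiv
      (Sigma.map _root_.id (fun i => (F i).φ) (finSigmaFinEquiv.symm s)), by
    intro s t h
    obtain ⟨⟨i, a⟩, rfl⟩ := finSigmaFinEquiv.surjective s
    obtain ⟨⟨i', b⟩, rfl⟩ := finSigmaFinEquiv.surjective t
    beta_reduce
    rw [Equiv.symm_apply_apply, Equiv.symm_apply_apply]
    rw [← not_lt, finSigma_lt] at h ⊢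
    intro hc
    apply h
    rcases hc with hc | ⟨hc, hd⟩
    · exact Or.inl hc
    · obtain rfl : i' = i := hc
      exact Or.inr ⟨rfl, lt_of_not_ge fun hle => absurd ((F i').φ.monotone hle) (not_le.2 hd)⟩⟩
  z s := (F (finSigmaFinEquiv.symm s).1).z (finSigmaFinEquiv.symm s).2
  σ := finSigmaFinEquiv.permCongr (Equiv.sigmaCongrRight fun i => (F i).σ)

section BlockSum

variable {m : ℕ} {j p : Fin m → ℕ} (F : ∀ i, DeltaHPlus.Mor (j i) (p i))

theorem blockSum_toFun (x : (i : Fin m) × Fin (j i)) :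
    (blockSum F).toFun (finSigmaFinEquiv x) = finSigmaFinEquiv ⟨x.1, (F x.1).toFun x.2⟩ := by
  have h : (blockSum F).toFun (finSigmaFinEquiv x) = finSigmaFinEquiv
      (Sigma.map _root_.id (fun i => (F i).φ) (finSigmaFinEquiv.symm
        (finSigmaFinEquiv (Sigma.map _root_.id (fun i => (F i).σ)
          (finSigmaFinEquiv.symm (finSigmaFinEquiv x)))))) := rfl
  rw [h, Equiv.symm_apply_apply, Equiv.symm_apply_apply]
  rfl

theorem blockSum_z (x : (i : Fin m) × Fin (j i)) :
    (blockSum F).z (finSigmaFinEquiv x) = (F x.1).z x.2 :=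
  congrArg (fun y : (i : Fin m) × Fin (j i) => (F y.1).z y.2) (Equiv.symm_apply_apply _ x)

theorem blockSum_σ (x : (i : Fin m) × Fin (j i)) :
    (blockSum F).σ (finSigmaFinEquiv x) = finSigmaFinEquiv ⟨x.1, (F x.1).σ x.2⟩ := by
  simp [blockSum]

end BlockSum

/-- The `m`-fold symmetric monoidal product of `ΔH₊`. -/
def blockSumFunctor (m : ℕ) : (Fin m → DeltaHPlus) ⥤ DeltaHPlus where
  obj X := ⟨∑ i, (X i).len⟩
  map F := blockSum F
  map_id X := by
    refine DeltaHPlus.Mor.ext_of_lt (G := DeltaHPlus.Mor.id _) ?_ ?_ ?_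
    · intro s
      obtain ⟨x, rfl⟩ := finSigmaFinEquiv.surjective s
      rw [blockSum_toFun]; rfl
    · intro s
      obtain ⟨x, rfl⟩ := finSigmaFinEquiv.surjective s
      rw [blockSum_z]; rfl
    · intro s t
      obtain ⟨x, rfl⟩ := finSigmaFinEquiv.surjective s
      obtain ⟨y, rfl⟩ := finSigmaFinEquiv.surjective t
      rw [blockSum_σ, blockSum_σ]; rfl
  map_comp {X Y Z} F G := by
    refine DeltaHPlus.Mor.ext_of_lt (G := DeltaHPlus.Mor.comp (blockSum G) (blockSum F)) ?_ ?_ ?_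
    · intro s
      obtain ⟨x, rfl⟩ := finSigmaFinEquiv.surjective s
      rw [DeltaHPlus.Mor.toFun_comp, blockSum_toFun, blockSum_toFun, blockSum_toFun]
      exact congrArg (fun a => finSigmaFinEquiv (⟨x.1, a⟩ : (i : Fin m) × Fin (Z i).len))
        (DeltaHPlus.Mor.toFun_comp (G x.1) (F x.1) x.2)
    · intro s
      obtain ⟨x, rfl⟩ := finSigmaFinEquiv.surjective s
      rw [DeltaHPlus.Mor.z_comp, blockSum_toFun, blockSum_z, blockSum_z, blockSum_z]
      rfl
    · intro s t
      obtain ⟨⟨i, a⟩, rfl⟩ := finSigmaFinEquiv.surjective s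
      obtain ⟨⟨i', b⟩, rfl⟩ := finSigmaFinEquiv.surjective t
      rw [DeltaHPlus.Mor.σ_comp_lt, blockSum_toFun, blockSum_toFun, blockSum_z, blockSum_σ,
        blockSum_σ, blockSum_σ, blockSum_σ, blockSum_σ, blockSum_σ, finSigma_lt, finSigma_lt,
        finSigma_lt, finSigma_lt]
      by_cases h : i = i'
      · subst h
        simp only [lt_irrefl, true_and, false_or, ← Fin.lt_def, EmbeddingLike.apply_eq_iff_eq,
          Sigma.mk.injEq, heq_eq_eq]
        exact DeltaHPlus.Mor.σ_comp_lt (G i) (F i) a b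
      · simp only [h, false_and, or_false, EmbeddingLike.apply_eq_iff_eq, Sigma.mk.injEq]

/-- The bijection that permutes `m` blocks of sizes `p₁, …, p_m` according to `σ`; the `i`-th
block is moved to position `σ(i)`. -/
def blockPerm {m : ℕ} (σ : Equiv.Perm (Fin m)) (p : Fin m → ℕ) :
    Fin (∑ i, p i) ≃ Fin (∑ i, p (σ.symm i)) :=
  finSigmaFinEquiv.symm.trans ((Equiv.sigmaCongrLeft' σ).trans finSigmaFinEquiv)

/-- The category `𝔼G`: the objects are the elements of `G`, with a unique morphism between any
two of them. -/
abbrev EG (G : Type) : Type := Codiscrete G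

/-- The functor `𝒟_Cat` on the symmetric groupoid: `𝒟_Cat(m) = 𝔼Σ_m`, with the right action
by composition. -/
def barrattEcclesCat : SymGrpdᵒᵖ ⥤ Cat.{0, 0} where
  obj X := Cat.of (EG (Equiv.Perm (Fin X.unop.card)))
  map {X Y} e := (Codiscrete.functorOfFun fun x : Equiv.Perm (Fin X.unop.card) =>
    ((show Fin Y.unop.card ≃ Fin X.unop.card from e.unop).trans x).trans
      (finCongr (card_eq_of_equiv e.unop).symm)).toCatHom
  map_id _ := rfl
  map_comp _ _ := rfl

/-- The permutation `τ_{σ⁻¹(1)} × ⋯ × τ_{σ⁻¹(m)}` after the block permutation given by `σ`: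
`τ_i` acts on a block of size `j_i` and the blocks are permuted by `σ`. -/
def operadPerm {m : ℕ} (j : Fin m → ℕ) (σ : Equiv.Perm (Fin m))
    (τ : ∀ i, Equiv.Perm (Fin (j i))) : Equiv.Perm (Fin (∑ i, j i)) :=
  ((finSigmaFinEquiv.permCongr (Equiv.sigmaCongrRight τ)).trans (blockPerm σ j)).trans
    (finCongr (Equiv.sum_comp σ.symm j))

/-- The structure functor `𝒟_Cat(m) × 𝒟_Cat(j₁) × ⋯ × 𝒟_Cat(j_m) ⥤ 𝒟_Cat(j₁ + ⋯ + j_m)`. -/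
def barrattEcclesComp {m : ℕ} (j : Fin m → ℕ) :
    (EG (Equiv.Perm (Fin m)) × ∀ i, EG (Equiv.Perm (Fin (j i)))) ⥤
      EG (Equiv.Perm (Fin (∑ i, j i))) :=
  Codiscrete.functor fun x => operadPerm j x.1.as fun i => (x.2 i).as

/-- The functor `IF` on the symmetric groupoid: `IF(m)` is the under-category `[m - 1] ↓ ΔH₊`. -/
def underCat : SymGrpdᵒᵖ ⥤ Cat.{0, 0} := symToDelta.op ⋙ Under.mapFunctor DeltaHPlus

/-- The isomorphism of `ΔH₊` that permutes the blocks `[p₁ - 1], …, [p_m - 1]` according to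
`σ`. -/
def blockIso {m : ℕ} (σ : Equiv.Perm (Fin m)) (X : Fin m → DeltaHPlus) :
    (blockSumFunctor m).obj X ≅ (blockSumFunctor m).obj fun i => X (σ.symm i) where
  hom := permMor (blockPerm σ fun i => (X i).len)
  inv := permMor (blockPerm σ fun i => (X i).len).symm
  hom_inv_id := by
    refine (symToDelta.map_comp (X := ⟨∑ i, (X i).len⟩) (Y := ⟨∑ i, (X (σ.symm i)).len⟩)
      (Z := ⟨∑ i, (X i).len⟩) (blockPerm σ fun i => (X i).len)
      (blockPerm σ fun i => (X i).len).symm).symm.trans ?_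
    refine Eq.trans (congrArg _ ?_) (symToDelta.map_id ⟨∑ i, (X i).len⟩)
    exact Equiv.self_trans_symm _
  inv_hom_id := by
    refine (symToDelta.map_comp (X := ⟨∑ i, (X (σ.symm i)).len⟩) (Y := ⟨∑ i, (X i).len⟩)
      (Z := ⟨∑ i, (X (σ.symm i)).len⟩) (blockPerm σ fun i => (X i).len).symm
      (blockPerm σ fun i => (X i).len)).symm.trans ?_
    refine Eq.trans (congrArg _ ?_) (symToDelta.map_id ⟨∑ i, (X (σ.symm i)).len⟩)
    exact Equiv.symm_trans_self _

/-- The structure functor `λ : 𝒟_Cat(m) × IF(j₁) × ⋯ × IF(j_m) ⥤ IF(j₁ + ⋯ + j_m)`. On objects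
`f_i` acts on the `i`-th block and the blocks are then permuted by `σ`; on morphisms the source
blocks, permuted by `σ`, are sent by the `g_i` to the target blocks, permuted by `τ`. -/
def underComp {m : ℕ} (j : Fin m → ℕ) :
    (EG (Equiv.Perm (Fin m)) × ∀ i, Under (DeltaHPlus.mk (j i))) ⥤
      Under (DeltaHPlus.mk (∑ i, j i)) where
  obj x := Under.mk (Y := (blockSumFunctor m).obj fun i => (x.2 (x.1.as.symm i)).right)
    ((blockSumFunctor m).map (X := fun i => DeltaHPlus.mk (j i)) (fun i => (x.2 i).hom) ≫
      (blockIso x.1.as fun i => (x.2 i).right).hom)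
  map {x y} g := Under.homMk
    ((blockIso x.1.as fun i => (x.2 i).right).inv ≫
      (blockSumFunctor m).map (X := fun i => (x.2 i).right) (fun i => (g.2 i).right) ≫
        (blockIso y.1.as fun i => (y.2 i).right).hom)
    (by
      have h : (blockSumFunctor m).map (X := fun i => DeltaHPlus.mk (j i))
          (Y := fun i => (y.2 i).right) (fun i => (y.2 i).hom) =
          (blockSumFunctor m).map (X := fun i => DeltaHPlus.mk (j i))
            (Y := fun i => (x.2 i).right) (fun i => (x.2 i).hom) ≫
          (blockSumFunctor m).map (X := fun i => (x.2 i).right) (Y := fun i => (y.2 i).right)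
            (fun i => (g.2 i).right) := by
        rw [← Functor.map_comp]
        exact congrArg _ (funext fun i => (Under.w (g.2 i)).symm)
      simp only [Under.mk_hom]
      rw [h]
      exact (Category.assoc _ _ _).trans
        ((congrArg _ (Iso.hom_inv_id_assoc _ _)).trans (Category.assoc _ _ _).symm))
  map_id x := by
    ext1
    simp only [Under.homMk_right, Under.id_right]
    refine Eq.trans (congrArg (fun h => _ ≫ h ≫ _) ((blockSumFunctor m).map_id _)) ?_
    simp
  map_comp {x y z} f g := by
    ext1
    simp only [Under.homMk_right, Under.comp_right, Category.assoc, Iso.hom_inv_id_assoc,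
      ← Functor.map_comp_assoc]
    rfl


section Operads

variable (k : Type u) [CommRing k]

/-- The free `k`-module functor on small sets. -/
noncomputable def freeModule : Type ⥤ ModuleCat.{u} k where
  obj X := ModuleCat.of k (X →₀ k)
  map f := ModuleCat.ofHom (Finsupp.lmapDomain k k f)
  map_id X := by
    apply ModuleCat.hom_ext
    exact Finsupp.lmapDomain_id k k
  map_comp f g := by
    apply ModuleCat.hom_ext
    exact Finsupp.lmapDomain_comp k k f g

/-- The functor `k[-]` from simplicial sets to simplicial `k`-modules. -/
noncomputable def freeSimplicial : SSet.{0} ⥤ SimplicialObject (ModuleCat.{u} k) :=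
  (SimplicialObject.whiskering Type (ModuleCat.{u} k)).obj (freeModule k)

/-- The structure maps of an operad in simplicial `k`-modules with the level-wise tensor product:
the underlying functor on the symmetric groupoid, the unit, and the composition maps
`O(m) ⊗ O(j₁) ⊗ ⋯ ⊗ O(j_m) → O(j₁ + ⋯ + j_m)`, where linear maps out of a tensor product are
written as multilinear maps. -/
structure OperadData where
  obj : SymGrpdᵒᵖ ⥤ SimplicialObject (ModuleCat.{u} k)
  one : ∀ Δ : SimplexCategoryᵒᵖ, (obj.obj (op ⟨1⟩)).obj Δ
  comp : ∀ {m : ℕ} (j : Fin m → ℕ) (Δ : SimplexCategoryᵒᵖ), (obj.obj (op ⟨m⟩)).obj Δ →ₗ[k]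
    MultilinearMap k (fun i => ((obj.obj (op ⟨j i⟩)).obj Δ : Type u))
      ((obj.obj (op ⟨∑ i, j i⟩)).obj Δ)

variable {k}

namespace OperadData

variable (O : OperadData k)

/-- The simplicial `k`-module `O(n)`. -/
abbrev ar (n : ℕ) : SimplicialObject (ModuleCat.{u} k) := O.obj.obj (op ⟨n⟩)

/-- The map `a ↦ a · e` from `O(m)` to `O(n)` given by a bijection `e`; for `n = m` it is the
right action of the symmetric group. -/
def relabel {n m : ℕ} (e : Fin n ≃ Fin m) (Δ : SimplexCategoryᵒᵖ) :
    (O.ar m).obj Δ →ₗ[k] (O.ar n).obj Δ :=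
  ((O.obj.map (Quiver.Hom.op (show SymGrpd.mk n ⟶ SymGrpd.mk m from e))).app Δ).hom

end OperadData

theorem sum_sum_eq {m : ℕ} (j : Fin m → ℕ) (l : ∀ i, Fin (j i) → ℕ) :
    ∑ t : Fin (∑ i, j i), l (finSigmaFinEquiv.symm t).1 (finSigmaFinEquiv.symm t).2 =
      ∑ i, ∑ s, l i s := by
  rw [Equiv.sum_comp finSigmaFinEquiv.symm (fun x : (i : Fin m) × Fin (j i) => l x.1 x.2),
    Fintype.sum_sigma]

/-- The axioms of an operad, with arity zero component the monoidal unit. -/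
structure OperadData.IsOperad (O : OperadData k) : Prop where
  zero : Nonempty (O.ar 0 ≅ (SimplicialObject.const _).obj (ModuleCat.of k k))
  one_naturality : ∀ {Δ Δ' : SimplexCategoryᵒᵖ} (θ : Δ ⟶ Δ'),
    ((O.ar 1).map θ).hom (O.one Δ) = O.one Δ'
  comp_naturality : ∀ {m : ℕ} (j : Fin m → ℕ) {Δ Δ' : SimplexCategoryᵒᵖ} (θ : Δ ⟶ Δ')
    (a : (O.ar m).obj Δ) (b : ∀ i, (O.ar (j i)).obj Δ),
    ((O.ar (∑ i, j i)).map θ).hom (O.comp j Δ a b) =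
      O.comp j Δ' (((O.ar m).map θ).hom a) fun i => ((O.ar (j i)).map θ).hom (b i)
  one_comp : ∀ (n : ℕ) (Δ : SimplexCategoryᵒᵖ) (b : (O.ar n).obj Δ),
    O.comp (fun _ : Fin 1 => n) Δ (O.one Δ) (fun _ => b) =
      O.relabel (finCongr (by simp)) Δ b
  comp_one : ∀ (m : ℕ) (Δ : SimplexCategoryᵒᵖ) (a : (O.ar m).obj Δ),
    O.comp (fun _ : Fin m => 1) Δ a (fun _ => O.one Δ) =
      O.relabel (finCongr (by simp)) Δ a
  assoc : ∀ {m : ℕ} (j : Fin m → ℕ) (l : ∀ i, Fin (j i) → ℕ) (Δ : SimplexCategoryᵒᵖ)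
    (a : (O.ar m).obj Δ) (b : ∀ i, (O.ar (j i)).obj Δ) (c : ∀ i s, (O.ar (l i s)).obj Δ),
    O.comp (fun t : Fin (∑ i, j i) => l (finSigmaFinEquiv.symm t).1 (finSigmaFinEquiv.symm t).2) Δ
        (O.comp j Δ a b) (fun t => c (finSigmaFinEquiv.symm t).1 (finSigmaFinEquiv.symm t).2) =
      O.relabel (finCongr (sum_sum_eq j l)) Δ
        (O.comp (fun i => ∑ s, l i s) Δ a fun i => O.comp (l i) Δ (b i) (c i))
  equivariance_outer : ∀ {m : ℕ} (j : Fin m → ℕ) (σ : Equiv.Perm (Fin m)) (Δ : SimplexCategoryᵒᵖ)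
    (a : (O.ar m).obj Δ) (b : ∀ i, (O.ar (j i)).obj Δ),
    O.comp j Δ (O.relabel σ Δ a) b =
      O.relabel (blockPerm σ j) Δ (O.comp (fun i => j (σ.symm i)) Δ a fun i => b (σ.symm i))
  equivariance_inner : ∀ {m : ℕ} (j : Fin m → ℕ) (ρ : ∀ i, Equiv.Perm (Fin (j i)))
    (Δ : SimplexCategoryᵒᵖ) (a : (O.ar m).obj Δ) (b : ∀ i, (O.ar (j i)).obj Δ),
    O.comp j Δ a (fun i => O.relabel (ρ i) Δ (b i)) =
      O.relabel (finSigmaFinEquiv.permCongr (Equiv.sigmaCongrRight ρ)) Δ (O.comp j Δ a b)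

/-- The weak equivalences of simplicial `k`-modules: the maps that induce isomorphisms on the
homology of the associated chain complexes. -/
def IsWeakEquiv {X Y : SimplicialObject (ModuleCat.{u} k)} (f : X ⟶ Y) : Prop :=
  QuasiIso ((AlgebraicTopology.alternatingFaceMapComplex (ModuleCat.{u} k)).map f)

/-- Two simplicial `k`-modules are weakly equivalent if they are connected by a zigzag of weak
equivalences. -/
def WeaklyEquivalent (X Y : SimplicialObject (ModuleCat.{u} k)) : Prop :=
  Relation.EqvGen (fun X Y : SimplicialObject (ModuleCat.{u} k) =>
    ∃ f : X ⟶ Y, IsWeakEquiv f) X Y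

/-- An `E_∞`-operad in simplicial `k`-modules: each `O(n)` is weakly equivalent to the unit, and
has in each degree a basis that is permuted freely by the symmetric group. -/
structure OperadData.IsEInfinity (O : OperadData k) : Prop extends O.IsOperad where
  contractible : ∀ n : ℕ,
    WeaklyEquivalent (O.ar n) ((SimplicialObject.const _).obj (ModuleCat.of k k))
  free : ∀ (n : ℕ) (Δ : SimplexCategoryᵒᵖ), ∃ (ι : Type u)
    (b : Module.Basis (ι × Equiv.Perm (Fin n)) k ((O.ar n).obj Δ)),
    ∀ (i : ι) (g h : Equiv.Perm (Fin n)), O.relabel h Δ (b (i, g)) = b (i, g * h)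

/-- The structure of an algebra over an operad on a simplicial `k`-module, given by structure
maps `O(m) ⊗ X^{⊗ m} → X`. -/
structure AlgebraOver (O : OperadData k) (X : SimplicialObject (ModuleCat.{u} k)) where
  act : ∀ (m : ℕ) (Δ : SimplexCategoryᵒᵖ), (O.ar m).obj Δ →ₗ[k]
    MultilinearMap k (fun _ : Fin m => (X.obj Δ : Type u)) (X.obj Δ)
  naturality : ∀ (m : ℕ) {Δ Δ' : SimplexCategoryᵒᵖ} (θ : Δ ⟶ Δ') (a : (O.ar m).obj Δ)
    (x : Fin m → X.obj Δ),
    (X.map θ).hom (act m Δ a x) =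
      act m Δ' (((O.ar m).map θ).hom a) fun i => (X.map θ).hom (x i)
  one_act : ∀ (Δ : SimplexCategoryᵒᵖ) (x : X.obj Δ), act 1 Δ (O.one Δ) (fun _ => x) = x
  comp_act : ∀ {m : ℕ} (j : Fin m → ℕ) (Δ : SimplexCategoryᵒᵖ) (a : (O.ar m).obj Δ)
    (b : ∀ i, (O.ar (j i)).obj Δ) (x : Fin (∑ i, j i) → X.obj Δ),
    act (∑ i, j i) Δ (O.comp j Δ a b) x =
      act m Δ a fun i => act (j i) Δ (b i) fun s => x (finSigmaFinEquiv ⟨i, s⟩)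
  equivariance : ∀ {m : ℕ} (σ : Equiv.Perm (Fin m)) (Δ : SimplexCategoryᵒᵖ)
    (a : (O.ar m).obj Δ) (x : Fin m → X.obj Δ),
    act m Δ (O.relabel σ Δ a) x = act m Δ a fun i => x (σ.symm i)

variable (k)

open Classical in
/-- The multilinear extension of a map `Y₁ × ⋯ × Y_m → Z` to free modules. -/
noncomputable def multExt {m : ℕ} {Y : Fin m → Type} {Z : Type} (f : (∀ i, Y i) → Z) :
    MultilinearMap k (fun i => (Y i →₀ k)) (Z →₀ k) :=
  ((Finsupp.lmapDomain k k f) ∘ₗ (PiTensorProduct.ofFinsuppEquiv' (R := k) (κ := Y)).toLinearMap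
    ).compMultilinearMap (PiTensorProduct.tprod k)

theorem multExt_single {m : ℕ} {Y : Fin m → Type} {Z : Type} (f : (∀ i, Y i) → Z)
    (y : ∀ i, Y i) :
    multExt k f (fun i => Finsupp.single (y i) 1) = Finsupp.single (f y) 1 := by
  classical
  simp [multExt, Finsupp.mapDomain_single]

/-- The map of nerves `N(E) × N(C₁) × ⋯ × N(C_m) → N(D)` induced by a functor. -/
def nerveOp {m : ℕ} {E D : Type} {C : Fin m → Type} [SmallCategory E] [SmallCategory D]
    [∀ i, SmallCategory (C i)] (Φ : (E × ∀ i, C i) ⥤ D) {p : ℕ} (s : ComposableArrows E p)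
    (t : ∀ i, ComposableArrows (C i) p) : ComposableArrows D p :=
  s.prod' (Functor.pi' t) ⋙ Φ

/-- The map `k[N(E)] ⊗ k[N(C₁)] ⊗ ⋯ ⊗ k[N(C_m)] → k[N(D)]` induced by a functor. -/
noncomputable def freeNerveOp {m : ℕ} {E D : Type} {C : Fin m → Type} [SmallCategory E]
    [SmallCategory D] [∀ i, SmallCategory (C i)] (Φ : (E × ∀ i, C i) ⥤ D) (p : ℕ) :
    (ComposableArrows E p →₀ k) →ₗ[k]
      MultilinearMap k (fun i => (ComposableArrows (C i) p →₀ k)) (ComposableArrows D p →₀ k) :=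
  Finsupp.linearCombination k fun s => multExt k (nerveOp Φ s)

/-- The Barratt-Eccles operad `𝒟_Mod` in simplicial `k`-modules, obtained from `𝒟_Cat` by the
nerve and the free `k`-module functors. -/
noncomputable def barrattEccles : OperadData k where
  obj := barrattEcclesCat ⋙ nerveFunctor ⋙ freeSimplicial k
  one Δ := Finsupp.single ((Functor.const (Fin (Δ.unop.len + 1))).obj
    (Codiscrete.mk (1 : Equiv.Perm (Fin 1)))) (1 : k)
  comp j Δ := freeNerveOp k (barrattEcclesComp j) Δ.unop.len

/-- The functor `IF~` on the symmetric groupoid, with `IF~(m) = k[N([m - 1] ↓ ΔH₊)]`. -/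
noncomputable def underModule : SymGrpdᵒᵖ ⥤ SimplicialObject (ModuleCat.{u} k) :=
  underCat ⋙ nerveFunctor ⋙ freeSimplicial k

end Operads

section Main

variable (k A : Type u) [CommRing k] [Ring A] [Algebra k A] (τ : Involution k A)

/-- The simplicial `k`-module `C_⋆(ΔH₊, H_{A+})`. -/
noncomputable abbrev hyperoctahedralModule : SimplicialObject (ModuleCat.{u} k) :=
  gabrielZisman (barFunctor k A τ)

/-- The hyperoctahedral category `ΔH`, the full subcategory of `ΔH₊` on the objects `[n]` with
`n ≥ 0`. -/
abbrev DeltaH : Type := ObjectProperty.FullSubcategory fun X : DeltaHPlus => X.len ≠ 0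

/-- Hyperoctahedral homology `HO_n(A) = Tor_n^{ΔH}(k^⋆, H_A)`. -/
noncomputable def hyperoctahedralHomology (n : ℕ) : ModuleCat.{u} k :=
  tor n (constRight k DeltaH)
    (ObjectProperty.ι (fun X : DeltaHPlus => X.len ≠ 0) ⋙ barFunctor k A τ)

/-- The right modules `IF~(-)_p` over the symmetric groupoid, as a simplicial object. -/
noncomputable abbrev underLevel : SimplexCategoryᵒᵖ ⥤ SymGrpdᵒᵖ ⥤ ModuleCat.{u} k :=
  (show SymGrpdᵒᵖ ⥤ SimplexCategoryᵒᵖ ⥤ ModuleCat.{u} k from underModule k).flip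

/-- The simplicial `k`-module `IF~⟨A⟩ = ⨁ₘ IF~(m) ⊗_{Σₘ} A^{⊗ m}`, as the tensor product over the
symmetric groupoid. -/
noncomputable def schur : SimplicialObject (ModuleCat.{u} k) :=
  underLevel k ⋙ tensorFunctor (symToDelta ⋙ barFunctor k A τ)

/-- The class in `IF~⟨A⟩` of a string of the under-category of `[n - 1]` and a tensor
`a₁ ⊗ ⋯ ⊗ a_n`. -/
noncomputable def schurMk {n : ℕ} (Δ : SimplexCategoryᵒᵖ)
    (s : ComposableArrows (Under (DeltaHPlus.mk n)) Δ.unop.len) (a : Fin n → A) : (schur k A τ).obj Δ :=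
  tensorMk ((underLevel k).obj Δ) (symToDelta ⋙ barFunctor k A τ) ⟨n⟩
    (Finsupp.single s (1 : k)) (PiTensorProduct.tprod k a)

/-- The contribution of a string `[n - 1] ⟶ C₀ ⟶ ⋯ ⟶ C_p` to the quotient map:
`x ↦ (C₀ ⟶ ⋯ ⟶ C_p, H([n - 1] ⟶ C₀)(x))`. -/
noncomputable def quotTerm (X : DeltaHPlus) (p : ℕ) (s : ComposableArrows (Under X) p) :
    (barFunctor k A τ).obj X →ₗ[k] GZ (barFunctor k A τ) p :=
  gzMk (barFunctor k A τ) p (s ⋙ Under.forget X) ∘ₗ ((barFunctor k A τ).map (s.obj 0).hom).hom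

theorem quotTerm_map (p : ℕ) {X Y : DeltaHPlus} (f : X ⟶ Y)
    (s : ComposableArrows (Under Y) p) (y : (barFunctor k A τ).obj X) :
    quotTerm k A τ X p (s ⋙ Under.map f) y =
      quotTerm k A τ Y p s (((barFunctor k A τ).map f).hom y) := by
  refine congrArg (gzMk (barFunctor k A τ) p (s ⋙ Under.forget Y)) ?_
  exact congrArg (fun h => (ModuleCat.Hom.hom h) y) ((barFunctor k A τ).map_comp f _)

theorem quotTerm_naturality {Δ Δ' : SimplexCategoryᵒᵖ} (θ : Δ ⟶ Δ') (X : DeltaHPlus)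
    (s : ComposableArrows (Under X) Δ.unop.len) (y : (barFunctor k A τ).obj X) :
    quotTerm k A τ X _ (pull θ s) y =
      gzMap (barFunctor k A τ) θ (quotTerm k A τ X _ s y) := by
  refine Eq.trans ?_ (gzMap_mk _ _ _ _).symm
  refine congrArg (gzMk (barFunctor k A τ) _ (pull θ s ⋙ Under.forget X)) ?_
  refine congrArg (fun h => (ModuleCat.Hom.hom h) y) (Eq.trans ?_ ((barFunctor k A τ).map_comp _ _))
  exact congrArg _ (Under.w (gzHead θ s)).symm

/-- The bilinear map `(s, x) ↦ (C₀ ⟶ ⋯ ⟶ C_p, H([n - 1] ⟶ C₀)(x))`. -/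
noncomputable def quotBilin (X : DeltaHPlus) (p : ℕ) :
    (ComposableArrows (Under X) p →₀ k) →ₗ[k]
      (barFunctor k A τ).obj X →ₗ[k] GZ (barFunctor k A τ) p :=
  Finsupp.linearCombination k (quotTerm k A τ X p)

theorem quotBilin_map (p : ℕ) {X Y : DeltaHPlus} (f : X ⟶ Y)
    (x : ComposableArrows (Under Y) p →₀ k) (y : (barFunctor k A τ).obj X) :
    quotBilin k A τ X p (Finsupp.lmapDomain k k
      (fun s : ComposableArrows (Under Y) p =>
        (s ⋙ Under.map f : ComposableArrows (Under X) p)) x) y =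
      quotBilin k A τ Y p x (((barFunctor k A τ).map f).hom y) := by
  induction x using Finsupp.induction_linear with
  | zero => rw [map_zero, map_zero, map_zero, LinearMap.zero_apply, LinearMap.zero_apply]
  | add x x' h h' => rw [map_add, map_add, map_add, LinearMap.add_apply, LinearMap.add_apply, h, h']
  | single s c =>
    rw [Finsupp.lmapDomain_apply, Finsupp.mapDomain_single, quotBilin,
      Finsupp.linearCombination_single, quotBilin,
      Finsupp.linearCombination_single, LinearMap.smul_apply, LinearMap.smul_apply]
    exact congrArg (fun z => c • z) (quotTerm_map k A τ p f s y)

theorem quotBilin_naturality {Δ Δ' : SimplexCategoryᵒᵖ} (θ : Δ ⟶ Δ') (X : DeltaHPlus)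
    (x : ComposableArrows (Under X) Δ.unop.len →₀ k) (y : (barFunctor k A τ).obj X) :
    quotBilin k A τ X _ (Finsupp.lmapDomain k k (pull θ) x) y =
      gzMap (barFunctor k A τ) θ (quotBilin k A τ X _ x y) := by
  induction x using Finsupp.induction_linear with
  | zero => simp only [map_zero, LinearMap.zero_apply]
  | add x x' h h' =>
    rw [map_add, map_add, map_add, LinearMap.add_apply, LinearMap.add_apply, map_add, h, h']
  | single s c =>
    rw [Finsupp.lmapDomain_apply, Finsupp.mapDomain_single, quotBilin,
      Finsupp.linearCombination_single, quotBilin,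
      Finsupp.linearCombination_single, LinearMap.smul_apply, LinearMap.smul_apply, map_smul]
    exact congrArg (fun z => c • z) (quotTerm_naturality k A τ θ X s y)

/-- The quotient map `q : IF~⟨A⟩ ⟶ C_⋆(ΔH₊, H_{A+})` induced by the inclusion of `Aut ΔS₊` into
`ΔH₊`. -/
noncomputable def quotMap : schur k A τ ⟶ hyperoctahedralModule k A τ where
  app Δ := ModuleCat.ofHom (tensorDesc ((underLevel k).obj Δ) (symToDelta ⋙ barFunctor k A τ)
    (fun X => quotBilin k A τ (symToDelta.obj X) Δ.unop.len)
    (fun _ _ α x y => quotBilin_map k A τ Δ.unop.len (symToDelta.map α) x y))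
  naturality := by
    intro Δ Δ' θ
    apply ModuleCat.hom_ext
    apply tensor_hom_ext
    intro X x y
    refine (congrArg (tensorDesc ((underLevel k).obj Δ') (symToDelta ⋙ barFunctor k A τ)
      (fun X => quotBilin k A τ (symToDelta.obj X) Δ'.unop.len)
      (fun _ _ α x y => quotBilin_map k A τ Δ'.unop.len (symToDelta.map α) x y))
      (tensorMap_mk ((underLevel k).map θ) _ X x y)).trans ((tensorDesc_mk _ _ _ _ _ _ _).trans ?_)
    refine Eq.trans ?_ (congrArg (gzMap (barFunctor k A τ) θ)
      (tensorDesc_mk ((underLevel k).obj Δ) (symToDelta ⋙ barFunctor k A τ)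
        (fun X => quotBilin k A τ (symToDelta.obj X) Δ.unop.len)
        (fun _ _ α x y => quotBilin_map k A τ Δ.unop.len (symToDelta.map α) x y) X x y)).symm
    exact quotBilin_naturality k A τ θ (symToDelta.obj X) x y

end Main

end HyperHom

open HyperHom

/-! Homology. For any small category `C`, consider the simplicial right module with value `k[strings
d ⟶ C₀ ⟶ ⋯ ⟶ C_p]` at `d`. Each degree is a sum of representables, hence projective. At each fixed
`d` the module contracts onto `k` by prepending `d` to a string, so it resolves the constant module.
By the co-Yoneda lemma, tensoring it with `F` gives `C_⋆(C, F)`, which therefore computes `Tor(k^⋆,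
F)` (`torIsoHomology`). It remains to compare `ΔH` with `ΔH₊`. The functor `[0] × -` maps `ΔH₊` to
`ΔH`, and the inclusions of `X` into `[0] × X` are natural on both categories. Natural
transformations give simplicial homotopies (`gabrielZismanHomotopy`), so the inclusion of `ΔH`
induces a homotopy equivalence (`restrictHomotopyEquiv`).

Operad. A bijection of finite ordinals is determined by the order that it pulls back to its source
(`equiv_ext_lt`), and the composition of permutations in the operad is described by a lexicographic
order (`operadPerm_lt`). Strings in `𝔼Σ_m` are lists of vertices, so every operad axiom becomes, on
generators and at each vertex, an equality of two lexicographic orders. Contractibility comes from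
prepending a fixed vertex. Freeness holds because every string is a unique translate of one that
starts at the unit.

Algebra. The functor `λ` obeys the same unit, associativity and equivariance laws as the operad,
strictly, up to pulling back the source of a string along a bijection (`nerveOp_underComp_one`,
`nerveOp_underComp_assoc`, `nerveOp_underComp_relabel`, `nerveOp_underComp_inner`). The tensor
product over the symmetric groupoid turns such a pullback into a permutation of tensor factors.
Hence the formula for `ν` is well defined and gives an action on `IF~⟨A⟩` (`exists_schurAct`,
`schurAlgebra`).

Quotient. The map `q` remembers a string only without its structure morphism `f₀`, which is applied
to the tensor. The bar construction is functorial and carries disjoint unions to concatenation of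
tensors, so `q` of a product depends only on the images under `q` of the factors
(`quotMap_schurAct`). As `q` has a linear section in each degree, the action and its axioms pass to
`C_⋆(ΔH₊, H_{A+})`. -/

namespace HyperHom

/-! ### Simplicial homotopies from natural transformations. -/

section GabrielZisman

open Simplicial

variable {k : Type u} [CommRing k] {C D : Type} [SmallCategory C] [SmallCategory D]

/-- The functor of a constant-coefficient homotopy: `C × [1] ⥤ D` for a natural transformation,
restricted to a string of `C` and a map to `[1]`. -/
def mixedString {G H : C ⥤ D} (η : G ⟶ H) {Δ Δ' : SimplexCategoryᵒᵖ} (θ : Δ ⟶ Δ')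
    (χ : Δ'.unop ⟶ ⦋1⦌) (s : ComposableArrows C Δ.unop.len) :
    ComposableArrows D Δ'.unop.len :=
  Functor.prod' (χ.toOrderHom.monotone.functor) (pull θ s) ⋙
    Functor.uncurry.obj (ComposableArrows.mk₁ η)

/-- The morphism from the value at the start of a string to the start of its mixed string. -/
def mixedHead {G H : C ⥤ D} (η : G ⟶ H) {Δ Δ' : SimplexCategoryᵒᵖ} (θ : Δ ⟶ Δ')
    (χ : Δ'.unop ⟶ ⦋1⦌) (s : ComposableArrows C Δ.unop.len) :
    G.obj (s.obj 0) ⟶ (mixedString η θ χ s).obj 0 :=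
  (Functor.uncurry.obj (ComposableArrows.mk₁ η)).map
    (X := ((0 : Fin 2), s.obj 0)) (Y := (χ.toOrderHom 0, (pull θ s).obj 0))
    (homOfLE (Fin.zero_le _), gzHead θ s)

open Classical in
/-- The map of chains given by mixed strings. -/
noncomputable def mixedMap {F : C ⥤ ModuleCat.{u} k} {M : D ⥤ ModuleCat.{u} k} {G H : C ⥤ D}
    (α : F ⟶ G ⋙ M) (η : G ⟶ H) {Δ Δ' : SimplexCategoryᵒᵖ} (θ : Δ ⟶ Δ') (χ : Δ'.unop ⟶ ⦋1⦌) :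
    GZ F Δ.unop.len →ₗ[k] GZ M Δ'.unop.len :=
  DirectSum.toModule k _ _ fun s => gzMk M Δ'.unop.len (mixedString η θ χ s) ∘ₗ
    (α.app (s.obj 0) ≫ M.map (mixedHead η θ χ s)).hom

section

variable {F : C ⥤ ModuleCat.{u} k} {M : D ⥤ ModuleCat.{u} k} {G H : C ⥤ D}
    (α : F ⟶ G ⋙ M) (η : G ⟶ H)

theorem mixedMap_mk {Δ Δ' : SimplexCategoryᵒᵖ} (θ : Δ ⟶ Δ') (χ : Δ'.unop ⟶ ⦋1⦌)
    (s : ComposableArrows C Δ.unop.len) (x : F.obj (s.obj 0)) :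
    mixedMap α η θ χ (gzMk F _ s x) = gzMk M _ (mixedString η θ χ s)
      ((α.app (s.obj 0) ≫ M.map (mixedHead η θ χ s)).hom x) := by
  simp [mixedMap, gzMk]

/-- A mixed string is a string of `[1] × C` pushed to `D`, so restricting it restricts both
coordinates. Together with `mixedMap_gzMap` this turns each identity of a simplicial homotopy into
identities between monotone maps. -/
theorem gzMap_mixedMap {Δ Δ' Δ'' : SimplexCategoryᵒᵖ} (θ : Δ ⟶ Δ') (χ : Δ'.unop ⟶ ⦋1⦌)
    (ψ : Δ' ⟶ Δ'') :
    gzMap M ψ ∘ₗ mixedMap α η θ χ = mixedMap α η (θ ≫ ψ) (ψ.unop ≫ χ) := by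
  apply gz_hom_ext
  intro s x
  rw [LinearMap.comp_apply, mixedMap_mk, gzMap_mk, mixedMap_mk]
  refine congrArg (gzMk M _ (mixedString η (θ ≫ ψ) (ψ.unop ≫ χ) s)) ?_
  refine congrArg (fun h => (ModuleCat.Hom.hom h) x) (?_ : (α.app (s.obj 0) ≫ _) ≫ _ = _)
  rw [Category.assoc, ← M.map_comp]
  refine congrArg (fun h => α.app (s.obj 0) ≫ M.map h) ?_
  refine ((Functor.uncurry.obj (ComposableArrows.mk₁ η)).map_comp _ _).symm.trans ?_
  refine congrArg _ (Prod.ext (Subsingleton.elim _ _) ?_)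
  exact (s.map_comp _ _).symm

theorem mixedMap_gzMap {Δ Δ' Δ'' : SimplexCategoryᵒᵖ} (ψ : Δ ⟶ Δ') (θ : Δ' ⟶ Δ'')
    (χ : Δ''.unop ⟶ ⦋1⦌) :
    mixedMap α η θ χ ∘ₗ gzMap F ψ = mixedMap α η (ψ ≫ θ) χ := by
  apply gz_hom_ext
  intro s x
  rw [LinearMap.comp_apply, gzMap_mk, mixedMap_mk, mixedMap_mk]
  refine congrArg (gzMk M _ (mixedString η (ψ ≫ θ) χ s)) ?_
  refine congrArg (fun h => (ModuleCat.Hom.hom h) x)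
    (?_ : F.map (gzHead ψ s) ≫ (α.app ((pull ψ s).obj 0) ≫ _) = _)
  rw [← Category.assoc, α.naturality, Category.assoc, Functor.comp_map, ← M.map_comp]
  refine congrArg (fun h => α.app (s.obj 0) ≫ M.map h) ?_
  -- The `G`-image of the head of `s` is a morphism of `[1] × C` over the identity of `0`.
  -- Functoriality on `[1] × C` can then merge the two heads.
  refine Eq.trans (congrArg (fun h => h ≫ mixedHead η θ χ (pull ψ s)) (?_ : _ =
    (Functor.uncurry.obj (ComposableArrows.mk₁ η)).map (X := ((0 : Fin 2), s.obj 0))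
      (Y := ((0 : Fin 2), (pull ψ s).obj 0)) (𝟙 _, gzHead ψ s))) ?_
  · refine Eq.symm (Eq.trans (congrArg (fun h => NatTrans.app h _ ≫ _)
      ((ComposableArrows.mk₁ η).map_id _)) ?_)
    exact Category.id_comp _
  refine ((Functor.uncurry.obj (ComposableArrows.mk₁ η)).map_comp _ _).symm.trans ?_
  refine congrArg _ (Prod.ext (Subsingleton.elim _ _) ?_)
  exact (s.map_comp _ _).symm

end

open Classical in
/-- The map `(s, x) ↦ (G(s), α(x))` of simplicial modules. -/
noncomputable def gzPush {F : C ⥤ ModuleCat.{u} k} {M : D ⥤ ModuleCat.{u} k} (G : C ⥤ D)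
    (α : F ⟶ G ⋙ M) (p : ℕ) : GZ F p →ₗ[k] GZ M p :=
  DirectSum.toModule k _ _ fun s => gzMk M p (s ⋙ G) ∘ₗ (α.app (s.obj 0)).hom

theorem gzPush_mk {F : C ⥤ ModuleCat.{u} k} {M : D ⥤ ModuleCat.{u} k} (G : C ⥤ D)
    (α : F ⟶ G ⋙ M) (p : ℕ) (s : ComposableArrows C p) (x : F.obj (s.obj 0)) :
    gzPush G α p (gzMk F p s x) = gzMk M p (s ⋙ G) ((α.app (s.obj 0)).hom x) := by
  simp [gzPush, gzMk]

/-- Functoriality of `C_⋆(C, F)` in `C` and `F`. -/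
noncomputable def gabrielZismanMap {F : C ⥤ ModuleCat.{u} k} {M : D ⥤ ModuleCat.{u} k}
    (G : C ⥤ D) (α : F ⟶ G ⋙ M) : gabrielZisman F ⟶ gabrielZisman M where
  app Δ := ModuleCat.ofHom (gzPush G α Δ.unop.len)
  naturality Δ Δ' θ := by
    apply ModuleCat.hom_ext
    apply gz_hom_ext
    intro s x
    change gzPush G α _ (gzMap F θ (gzMk F _ s x)) = gzMap M θ (gzPush G α _ (gzMk F _ s x))
    rw [gzMap_mk, gzPush_mk, gzPush_mk, gzMap_mk]
    refine congrArg (gzMk M _ (pull θ s ⋙ G)) ?_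
    exact congrArg (fun h => (ModuleCat.Hom.hom h) x) (α.naturality (gzHead θ s))

/-- The map of `[n]` to `[1]` with `j ↦ 0` if and only if `j ≤ i`. -/
def stepMap {n : ℕ} (i : ℕ) : ⦋n⦌ ⟶ ⦋1⦌ :=
  SimplexCategory.mkHom ⟨fun j => if (j : ℕ) ≤ i then (0 : Fin 2) else 1, fun a b h => by
    have : (a : ℕ) ≤ b := h
    dsimp only
    split_ifs <;> first | omega | simp⟩

/-- A map to `[1]` is determined by the initial segment that it sends to `0`. -/
theorem comp_stepMap {n m : ℕ} (f : ⦋n⦌ ⟶ ⦋m⦌) (i i' : ℕ)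
    (h : ∀ j : Fin (n + 1), ((f.toOrderHom j : Fin (m + 1)) : ℕ) ≤ i' ↔ (j : ℕ) ≤ i) :
    f ≫ stepMap i' = stepMap i := by
  ext j : 3
  change (if ((f.toOrderHom j : Fin (m + 1)) : ℕ) ≤ i' then (0 : Fin 2) else 1) =
    if (j : ℕ) ≤ i then 0 else 1
  simp only [h]

/-- The summand depends on the string, so rewriting the string costs a transport of the coefficient.
-/
theorem gzMk_congr {F : C ⥤ ModuleCat.{u} k} {p : ℕ} {s s' : ComposableArrows C p} (h : s = s')
    (x : F.obj (s.obj 0)) :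
    gzMk F p s x = gzMk F p s' ((F.map (eqToHom (by rw [h]))).hom x) := by
  subst h
  simp

theorem mixedMap_const_zero {F : C ⥤ ModuleCat.{u} k} {M : D ⥤ ModuleCat.{u} k} {G H : C ⥤ D}
    (α : F ⟶ G ⋙ M) (η : G ⟶ H) (Δ : SimplexCategoryᵒᵖ) :
    mixedMap α η (𝟙 Δ) (SimplexCategory.const _ ⦋1⦌ (0 : Fin 2)) = gzPush G α _ := by
  apply gz_hom_ext
  intro s x
  rw [mixedMap_mk, gzPush_mk]
  have e : mixedString η (𝟙 Δ) (SimplexCategory.const _ ⦋1⦌ (0 : Fin 2)) s = s ⋙ G :=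
    CategoryTheory.Functor.ext (fun _ => rfl) (fun i j f =>
      (Category.id_comp (G.map (s.map f))).trans
        ((Category.id_comp _).trans (Category.comp_id _)).symm)
  rw [gzMk_congr e]
  refine congrArg (gzMk M _ (s ⋙ G)) ?_
  refine congrArg (fun h => (ModuleCat.Hom.hom h) x)
    (?_ : (α.app (s.obj 0) ≫ _) ≫ M.map (𝟙 _) = α.app (s.obj 0))
  rw [M.map_id, Category.comp_id]
  refine Eq.trans (congrArg (fun h => α.app (s.obj 0) ≫ M.map h) ?_)
    ((congrArg _ (M.map_id _)).trans (Category.comp_id _))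
  exact (Category.id_comp _).trans ((congrArg G.map (s.map_id 0)).trans (G.map_id _))

/-- At this end of the cylinder the head of the mixed string crosses from `G` to `H`, so the
coefficient picks up `η` and `α` becomes `β`. -/
theorem mixedMap_const_one {F : C ⥤ ModuleCat.{u} k} {M : D ⥤ ModuleCat.{u} k} {G H : C ⥤ D}
    (α : F ⟶ G ⋙ M) (β : F ⟶ H ⋙ M) (η : G ⟶ H) (hβ : α ≫ Functor.whiskerRight η M = β)
    (Δ : SimplexCategoryᵒᵖ) :
    mixedMap α η (𝟙 Δ) (SimplexCategory.const _ ⦋1⦌ (1 : Fin 2)) = gzPush H β _ := by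
  subst hβ
  apply gz_hom_ext
  intro s x
  rw [mixedMap_mk, gzPush_mk]
  have e : mixedString η (𝟙 Δ) (SimplexCategory.const _ ⦋1⦌ (1 : Fin 2)) s = s ⋙ H :=
    CategoryTheory.Functor.ext (fun _ => rfl) (fun i j f =>
      (Category.id_comp (H.map (s.map f))).trans
        ((Category.id_comp _).trans (Category.comp_id _)).symm)
  rw [gzMk_congr e]
  refine congrArg (gzMk M _ (s ⋙ H)) ?_
  refine congrArg (fun h => (ModuleCat.Hom.hom h) x)
    (?_ : (α.app (s.obj 0) ≫ _) ≫ M.map (𝟙 _) = α.app (s.obj 0) ≫ M.map (η.app (s.obj 0)))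
  rw [M.map_id, Category.comp_id]
  refine congrArg (fun h => α.app (s.obj 0) ≫ M.map h) ?_
  exact (congrArg (fun h => η.app (s.obj 0) ≫ h)
    ((congrArg H.map (s.map_id 0)).trans (H.map_id _))).trans (Category.comp_id _)

/-- The composites are kept as hypotheses so that a homotopy identity only needs a cosimplicial
relation for `θ` and a comparison of steps for `χ`. -/
theorem mixedMap_gabrielZisman_map {F : C ⥤ ModuleCat.{u} k} {M : D ⥤ ModuleCat.{u} k}
    {G H : C ⥤ D} (α : F ⟶ G ⋙ M) (η : G ⟶ H) {a b c : SimplexCategory} (θ : b ⟶ a)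
    (χ : b ⟶ ⦋1⦌) (ψ : c ⟶ b) (θ' : c ⟶ a) (χ' : c ⟶ ⦋1⦌) (h : ψ ≫ θ = θ') (h' : ψ ≫ χ = χ') :
    (ModuleCat.ofHom (mixedMap α η θ.op χ) : (gabrielZisman F).obj (op a) ⟶
      (gabrielZisman M).obj (op b)) ≫ (gabrielZisman M).map ψ.op =
        ModuleCat.ofHom (mixedMap α η θ'.op χ') := by
  subst h h'
  exact ModuleCat.hom_ext (gzMap_mixedMap α η θ.op χ ψ.op)

theorem gabrielZisman_map_mixedMap {F : C ⥤ ModuleCat.{u} k} {M : D ⥤ ModuleCat.{u} k}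
    {G H : C ⥤ D} (α : F ⟶ G ⋙ M) (η : G ⟶ H) {a b c : SimplexCategory} (θ : c ⟶ b)
    (χ : c ⟶ ⦋1⦌) (ψ : b ⟶ a) (θ' : c ⟶ a) (h : θ ≫ ψ = θ') :
    (gabrielZisman F).map ψ.op ≫ (ModuleCat.ofHom (mixedMap α η θ.op χ) :
      (gabrielZisman F).obj (op b) ⟶ (gabrielZisman M).obj (op c)) =
        ModuleCat.ofHom (mixedMap α η θ'.op χ) := by
  subst h
  exact ModuleCat.hom_ext (mixedMap_gzMap α η ψ.op θ.op χ)

/-- Natural transformations induce simplicial homotopies on `C_⋆(C, F)`. -/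
noncomputable def gabrielZismanHomotopy {F : C ⥤ ModuleCat.{u} k} {M : D ⥤ ModuleCat.{u} k}
    {G H : C ⥤ D} (α : F ⟶ G ⋙ M) (β : F ⟶ H ⋙ M) (η : G ⟶ H)
    (hβ : α ≫ Functor.whiskerRight η M = β) :
    SimplicialObject.Homotopy (gabrielZismanMap G α) (gabrielZismanMap H β) where
  -- The prism operator sends `C₀ ⟶ ⋯ ⟶ C_n` to `G C₀ ⟶ ⋯ ⟶ G C_i ⟶ H C_i ⟶ ⋯ ⟶ H C_n`: the
  -- degeneracy repeats `C_i`, and the step map switches from `G` to `H` just after position `i`.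
  h {n} i := ModuleCat.ofHom (mixedMap α η (SimplexCategory.σ i).op (stepMap i))
  h_zero_comp_δ_zero n := by
    refine (mixedMap_gabrielZisman_map α η _ _ _ (𝟙 _) (SimplexCategory.const _ ⦋1⦌ (1 : Fin 2))
      (SimplexCategory.δ_comp_σ_self (i := (0 : Fin (n + 1)))) ?_).trans
      (congrArg ModuleCat.ofHom (mixedMap_const_one α β η hβ (op ⦋n⦌)))
    ext j : 3
    change (if (((Fin.succAbove 0 j : Fin (n + 2))) : ℕ) ≤ 0 then (0 : Fin 2) else 1) = 1
    simp
  h_last_comp_δ_last n := by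
    refine (mixedMap_gabrielZisman_map α η _ _ _ (𝟙 _) (SimplexCategory.const _ ⦋1⦌ (0 : Fin 2))
      (SimplexCategory.δ_comp_σ_succ (i := Fin.last n)) ?_).trans
      (congrArg ModuleCat.ofHom (mixedMap_const_zero α η (op ⦋n⦌)))
    ext j : 3
    change (if (((Fin.succAbove (Fin.last (n + 1)) j : Fin (n + 2))) : ℕ) ≤ n
      then (0 : Fin 2) else 1) = 0
    have : (j : ℕ) < n + 1 := j.2
    simp
    omega
  h_succ_comp_δ_castSucc_of_lt {n} i j hij := by
    refine (mixedMap_gabrielZisman_map α η _ _ _ _ (stepMap j)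
      (SimplexCategory.δ_comp_σ_of_le hij) (comp_stepMap _ _ _ fun l => ?_)).trans
      (gabrielZisman_map_mixedMap α η _ _ _ _ rfl).symm
    change ((Fin.succAbove i.castSucc l : Fin (n + 3)) : ℕ) ≤ _ ↔ _
    grind [Fin.succAbove]
  h_succ_comp_δ_castSucc_succ {n} j := by
    refine (mixedMap_gabrielZisman_map α η _ _ _ (𝟙 _) (stepMap j)
      (SimplexCategory.δ_comp_σ_self (i := j.succ)) (comp_stepMap _ _ _ fun l => ?_)).trans
      (mixedMap_gabrielZisman_map α η _ _ _ (𝟙 _) (stepMap j)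
      (SimplexCategory.δ_comp_σ_succ (i := j.castSucc)) (comp_stepMap _ _ _ fun l => ?_)).symm
    · change ((Fin.succAbove j.succ.castSucc l : Fin (n + 3)) : ℕ) ≤ _ ↔ _
      grind [Fin.succAbove]
    · change ((Fin.succAbove j.castSucc.succ l : Fin (n + 3)) : ℕ) ≤ _ ↔ _
      grind [Fin.succAbove]
  h_castSucc_comp_δ_succ_of_lt {n} i j hji := by
    refine (mixedMap_gabrielZisman_map α η _ _ _ _ (stepMap j)
      (SimplexCategory.δ_comp_σ_of_gt hji) (comp_stepMap _ _ _ fun l => ?_)).trans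
      (gabrielZisman_map_mixedMap α η _ _ _ _ rfl).symm
    change ((Fin.succAbove i.succ l : Fin (n + 3)) : ℕ) ≤ _ ↔ _
    grind [Fin.succAbove]
  h_comp_σ_castSucc_of_le {n} i j hij := by
    refine (mixedMap_gabrielZisman_map α η _ _ _ _ (stepMap j.succ)
      (SimplexCategory.σ_comp_σ hij) (comp_stepMap _ _ _ fun l => ?_)).trans
      (gabrielZisman_map_mixedMap α η _ _ _ _ rfl).symm
    change ((Fin.predAbove i.castSucc l : Fin (n + 2)) : ℕ) ≤ _ ↔ _
    grind [Fin.predAbove, Fin.coe_castPred]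
  h_comp_σ_succ_of_lt {n} i j hji := by
    refine (mixedMap_gabrielZisman_map α η _ _ _ _ (stepMap j)
      (SimplexCategory.σ_comp_σ hji).symm (comp_stepMap _ _ _ fun l => ?_)).trans
      (gabrielZisman_map_mixedMap α η _ _ _ _ rfl).symm
    change ((Fin.predAbove i.succ l : Fin (n + 2)) : ℕ) ≤ _ ↔ _
    grind [Fin.predAbove, Fin.coe_castPred]

end GabrielZisman

end HyperHom

/-! ### Adding a point: comparison of `ΔH` with `ΔH₊`. -/

namespace HyperHom

namespace DeltaHPlus

/-- The disjoint union `[0] × F`. -/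
def Mor.pad {n m : ℕ} (F : Mor n m) : Mor (n + 1) (m + 1) where
  φ := ⟨Fin.cases 0 fun i => (F.φ i).succ, by
    intro i j h
    cases i using Fin.cases with
    | zero => exact Fin.zero_le _
    | succ i =>
      cases j using Fin.cases with
      | zero => exact absurd (Fin.le_zero_iff.1 h) (Fin.succ_ne_zero i)
      | succ j => exact Fin.succ_le_succ_iff.2 (F.φ.monotone (Fin.succ_le_succ_iff.1 h))⟩
  z := Fin.cases 1 F.z
  σ :=
    { toFun := Fin.cases 0 fun i => (F.σ i).succ
      invFun := Fin.cases 0 fun i => (F.σ.symm i).succ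
      left_inv := by intro i; cases i using Fin.cases <;> simp
      right_inv := by intro i; cases i using Fin.cases <;> simp }

namespace Mor

variable {n m : ℕ} (F : Mor n m)

@[simp] theorem pad_toFun_zero : F.pad.toFun 0 = 0 := rfl

@[simp] theorem pad_toFun_succ (i : Fin n) : F.pad.toFun i.succ = (F.toFun i).succ := rfl

@[simp] theorem pad_z_zero : F.pad.z 0 = 1 := rfl

@[simp] theorem pad_z_succ (i : Fin n) : F.pad.z i.succ = F.z i := rfl

@[simp] theorem pad_σ_zero : F.pad.σ 0 = 0 := rfl

@[simp] theorem pad_σ_succ (i : Fin n) : F.pad.σ i.succ = (F.σ i).succ := rfl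

/-- The inclusion of `[n - 1]` into `[0] × [n - 1]`. -/
def inr (n : ℕ) : Mor n (n + 1) where
  φ := ⟨Fin.succ, fun _ _ h => Fin.succ_le_succ_iff.2 h⟩
  z := 1
  σ := 1

@[simp] theorem inr_toFun (i : Fin n) : (inr n).toFun i = i.succ := rfl

@[simp] theorem inr_z (i : Fin n) : (inr n).z i = 1 := rfl

@[simp] theorem inr_σ (i : Fin n) : (inr n).σ i = i := rfl

end Mor

/-- The functor `[0] × -`, with values in `ΔH`. -/
def padFunctor : DeltaHPlus ⥤ DeltaH where
  obj X := ⟨⟨X.len + 1⟩, Nat.succ_ne_zero _⟩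
  map F := ObjectProperty.homMk (Mor.pad F)
  map_id X := by
    apply ObjectProperty.hom_ext
    refine Mor.ext_of_lt (G := Mor.id _) ?_ ?_ ?_
    · intro i; cases i using Fin.cases <;> rfl
    · intro i; cases i using Fin.cases <;> rfl
    · intro i j; cases i using Fin.cases <;> cases j using Fin.cases <;> exact Iff.rfl
  map_comp F G := by
    apply ObjectProperty.hom_ext
    refine Mor.ext_of_lt (F := Mor.pad (Mor.comp G F)) (G := Mor.comp (Mor.pad G) (Mor.pad F))
      ?_ ?_ ?_
    · intro i; cases i using Fin.cases <;> simp
    · intro i; cases i using Fin.cases <;> simp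
    · intro i j
      rw [Mor.σ_comp_lt]
      cases i using Fin.cases <;> cases j using Fin.cases <;> simp [Mor.σ_comp_lt]

end DeltaHPlus

open DeltaHPlus

/-- The inclusion of `ΔH` into `ΔH₊`. -/
abbrev deltaHIncl : DeltaH ⥤ DeltaHPlus :=
  ObjectProperty.ι (fun X : DeltaHPlus => X.len ≠ 0)

/-- The natural transformation from the identity of `ΔH₊` to `[0] × -`. -/
def padUnit : 𝟭 DeltaHPlus ⟶ padFunctor ⋙ deltaHIncl where
  app X := Mor.inr X.len
  naturality X Y F := by
    refine Mor.ext_of_lt (F := Mor.comp (Mor.inr _) F) (G := Mor.comp (Mor.pad F) (Mor.inr _))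
      ?_ ?_ ?_
    · intro i; simp
    · intro i; simp
    · intro i j
      rw [Mor.σ_comp_lt, Mor.σ_comp_lt]
      have : F.σ i < F.σ j → i ≠ j := by rintro h rfl; exact lt_irrefl _ h
      -- One composite orders by image and then by `F.σ` inside a fibre, the other by `F.σ` alone;
      -- monotonicity of `F.φ` makes these orders agree.
      have := F.φ.monotone (a := F.σ j) (b := F.σ i)
      have := F.φ.monotone (a := F.σ i) (b := F.σ j)
      simp only [Mor.pad_σ_succ, Mor.inr_toFun, Mor.inr_σ, Mor.pad_z_succ, Mor.inr_z, Fin.succ_inj,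
        Fin.succ_lt_succ_iff]
      simp only [Mor.toFun] at *
      grind

/-- The natural transformation from the identity of `ΔH` to `[0] × -`. -/
def padUnitRestrict : 𝟭 DeltaH ⟶ deltaHIncl ⋙ padFunctor where
  app X := ObjectProperty.homMk (padUnit.app X.obj)
  naturality X Y F := by
    apply ObjectProperty.hom_ext
    exact padUnit.naturality F.hom

section

variable {k : Type u} [CommRing k] (F : DeltaHPlus ⥤ ModuleCat.{u} k)

theorem gabrielZismanMap_id {C : Type} [SmallCategory C] (F : C ⥤ ModuleCat.{u} k) :
    gabrielZismanMap (F := F) (M := F) (𝟭 C) (𝟙 F) = 𝟙 (gabrielZisman F) := by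
  ext Δ : 2
  apply gz_hom_ext
  intro s x
  exact gzPush_mk _ _ _ _ _

/-- The inclusion of `C_⋆(ΔH, F)` into `C_⋆(ΔH₊, F)` is a homotopy equivalence. -/
noncomputable def restrictHomotopyEquiv :
    HomotopyEquiv
      ((AlgebraicTopology.alternatingFaceMapComplex (ModuleCat.{u} k)).obj
        (gabrielZisman (deltaHIncl ⋙ F)))
      ((AlgebraicTopology.alternatingFaceMapComplex (ModuleCat.{u} k)).obj (gabrielZisman F)) where
  hom := (AlgebraicTopology.alternatingFaceMapComplex _).map
    (gabrielZismanMap deltaHIncl (𝟙 (deltaHIncl ⋙ F)))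
  inv := (AlgebraicTopology.alternatingFaceMapComplex _).map
    (gabrielZismanMap padFunctor (Functor.whiskerRight padUnit F))
  homotopyHomInvId := by
    -- Going to `ΔH₊` and back is the map induced by `[0] × -` on `ΔH`. The homotopy given by
    -- `padUnitRestrict` starts at the identity and ends there, hence the `symm`.
    refine (Homotopy.ofEq ?_).trans ((gabrielZismanHomotopy (F := deltaHIncl ⋙ F)
      (M := deltaHIncl ⋙ F) (𝟙 _) (Functor.whiskerRight padUnitRestrict (deltaHIncl ⋙ F))
      padUnitRestrict (Category.id_comp _)).toChainHomotopy.symm.trans (Homotopy.ofEq ?_))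
    · rw [← Functor.map_comp]
      congr 1
      ext Δ : 2
      apply gz_hom_ext
      intro s x
      refine (congrArg (gzPush _ _ _) (gzPush_mk _ _ _ _ _)).trans ((gzPush_mk _ _ _ _ _).trans
        (Eq.symm (gzPush_mk _ _ _ _ _)))
    · exact (congrArg _ (gabrielZismanMap_id (deltaHIncl ⋙ F))).trans (CategoryTheory.Functor.map_id _ _)
  homotopyInvHomId := by
    refine (Homotopy.ofEq ?_).trans ((gabrielZismanHomotopy (F := F)
      (M := F) (𝟙 _) (Functor.whiskerRight padUnit F)
      padUnit (Category.id_comp _)).toChainHomotopy.symm.trans (Homotopy.ofEq ?_))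
    · rw [← Functor.map_comp]
      congr 1
      ext Δ : 2
      apply gz_hom_ext
      intro s x
      refine (congrArg (gzPush _ _ _) (gzPush_mk _ _ _ _ _)).trans ((gzPush_mk _ _ _ _ _).trans
        (Eq.symm (gzPush_mk _ _ _ _ _)))
    · exact (congrArg _ (gabrielZismanMap_id F)).trans (CategoryTheory.Functor.map_id _ _)

end

end HyperHom

/-! ### The bar resolution of the constant right module. -/

namespace HyperHom

section FunctorHomologyComplex

open Simplicial Limits AlgebraicTopology

variable (k : Type u) [CommRing k] (C : Type) [SmallCategory C]

variable {C} in
/-- A string `C₀ ⟶ ⋯ ⟶ C_p` with a morphism `d ⟶ C₀`. -/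
structure StringUnder (p : ℕ) (d : Cᵒᵖ) : Type where
  s : ComposableArrows C p
  a : d.unop ⟶ s.obj 0

/-- The right `C`-simplicial set of strings `d ⟶ C₀ ⟶ ⋯ ⟶ C_p`. -/
def underStrings : Cᵒᵖ ⥤ SSet.{0} where
  obj d :=
    { obj := fun Δ => StringUnder Δ.unop.len d
      map := fun θ => ↾fun g => ⟨pull θ g.s, g.a ≫ gzHead θ g.s⟩
      map_id := fun Δ => by
        ext g
        refine congrArg (StringUnder.mk g.s) ?_
        exact (congrArg (g.a ≫ ·) (g.s.map_id 0)).trans (Category.comp_id _)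
      map_comp := fun θ ψ => by
        ext g
        refine congrArg (StringUnder.mk (pull (θ ≫ ψ) g.s)) ?_
        exact (congrArg (g.a ≫ ·) (g.s.map_comp _ _)).trans (Category.assoc _ _ _).symm }
  map f :=
    { app := fun Δ => ↾fun g => ⟨g.s, f.unop ≫ g.a⟩
      naturality := fun Δ Δ' θ => by
        ext g
        exact congrArg (StringUnder.mk (pull θ g.s))
          (Category.assoc f.unop g.a (gzHead θ g.s)).symm }
  map_id d := by
    ext Δ g
    exact congrArg (StringUnder.mk g.s) (Category.id_comp _)
  map_comp f f' := by
    ext Δ g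
    exact congrArg (StringUnder.mk g.s) (Category.assoc _ _ _)

/-- The simplicial right `C`-module `d ↦ k[strings d ⟶ C₀ ⟶ ⋯ ⟶ C_p]`. -/
noncomputable def barResolution : SimplicialObject (Cᵒᵖ ⥤ ModuleCat.{u} k) :=
  (underStrings C ⋙ freeSimplicial k).flip

variable {C}

/-- The generator of `barResolution` given by a string. -/
noncomputable def barGen {Δ : SimplexCategoryᵒᵖ} {d : Cᵒᵖ} (s : ComposableArrows C Δ.unop.len)
    (a : d.unop ⟶ s.obj 0) : ((barResolution k C).obj Δ).obj d :=
  (Finsupp.single (⟨s, a⟩ : StringUnder Δ.unop.len d) (1 : k) : StringUnder Δ.unop.len d →₀ k)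

variable {k}

theorem barResolution_map_barGen {Δ Δ' : SimplexCategoryᵒᵖ} (θ : Δ ⟶ Δ') {d : Cᵒᵖ}
    (s : ComposableArrows C Δ.unop.len) (a : d.unop ⟶ s.obj 0) :
    (((barResolution k C).map θ).app d).hom (barGen k s a) =
      barGen k (pull θ s) (a ≫ gzHead θ s) :=
  Finsupp.mapDomain_single

theorem barResolution_obj_map_barGen {Δ : SimplexCategoryᵒᵖ} {d e : Cᵒᵖ} (f : d ⟶ e)
    (s : ComposableArrows C Δ.unop.len) (a : d.unop ⟶ s.obj 0) :
    (((barResolution k C).obj Δ).map f).hom (barGen k s a) = barGen k s (f.unop ≫ a) :=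
  Finsupp.mapDomain_single

theorem barResolution_obj_lin_ext {Δ : SimplexCategoryᵒᵖ} {d : Cᵒᵖ} {M : Type u}
    [AddCommGroup M] [Module k M] {f g : ((barResolution k C).obj Δ).obj d →ₗ[k] M}
    (h : ∀ (s : ComposableArrows C Δ.unop.len) (a : d.unop ⟶ s.obj 0),
      f (barGen k s a) = g (barGen k s a)) : f = g := by
  apply Finsupp.lhom_ext'
  rintro ⟨s, a⟩
  apply LinearMap.ext_ring
  exact h s a

/-- Linear maps out of the components of `barResolution`. -/
noncomputable def barResolutionDesc {Δ : SimplexCategoryᵒᵖ} {d : Cᵒᵖ} {M : Type u}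
    [AddCommGroup M] [Module k M]
    (v : ∀ s : ComposableArrows C Δ.unop.len, (d.unop ⟶ s.obj 0) → M) :
    ((barResolution k C).obj Δ).obj d →ₗ[k] M :=
  Finsupp.linearCombination k fun g : StringUnder Δ.unop.len d => v g.s g.a

theorem barResolutionDesc_barGen {Δ : SimplexCategoryᵒᵖ} {d : Cᵒᵖ} {M : Type u}
    [AddCommGroup M] [Module k M]
    (v : ∀ s : ComposableArrows C Δ.unop.len, (d.unop ⟶ s.obj 0) → M)
    (s : ComposableArrows C Δ.unop.len) (a : d.unop ⟶ s.obj 0) :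
    barResolutionDesc (k := k) v (barGen k s a) = v s a :=
  (Finsupp.linearCombination_single k (1 : k) _).trans (one_smul _ _)

/-- Maps out of `barResolution` are given by the values on the strings. -/
noncomputable def barResolutionLift (Δ : SimplexCategoryᵒᵖ) (H : Cᵒᵖ ⥤ ModuleCat.{u} k)
    (v : ∀ s : ComposableArrows C Δ.unop.len, H.obj (op (s.obj 0))) :
    (barResolution k C).obj Δ ⟶ H where
  app d := ModuleCat.ofHom (barResolutionDesc fun s a => (H.map a.op).hom (v s))
  naturality d e f := by
    apply ModuleCat.hom_ext
    apply barResolution_obj_lin_ext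
    intro s a
    refine (congrArg (barResolutionDesc fun s a => (H.map a.op).hom (v s))
      (barResolution_obj_map_barGen f s a)).trans ?_
    refine (barResolutionDesc_barGen _ _ _).trans ?_
    refine Eq.symm ((congrArg (H.map f).hom (barResolutionDesc_barGen _ _ _)).trans ?_)
    exact (congrArg (fun h => (ModuleCat.Hom.hom h) (v s)) (H.map_comp a.op f)).symm

theorem barResolutionLift_barGen (Δ : SimplexCategoryᵒᵖ) (H : Cᵒᵖ ⥤ ModuleCat.{u} k)
    (v : ∀ s : ComposableArrows C Δ.unop.len, H.obj (op (s.obj 0))) {d : Cᵒᵖ}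
    (s : ComposableArrows C Δ.unop.len) (a : d.unop ⟶ s.obj 0) :
    ((barResolutionLift Δ H v).app d).hom (barGen k s a) = (H.map a.op).hom (v s) :=
  barResolutionDesc_barGen _ _ _

/-- Yoneda: the strings with a given `s` span the representable module `k[Hom(-, C₀)]`, which is
generated by the identity of `C₀`. -/
theorem barResolution_hom_ext {Δ : SimplexCategoryᵒᵖ} {H : Cᵒᵖ ⥤ ModuleCat.{u} k}
    {f g : (barResolution k C).obj Δ ⟶ H}
    (h : ∀ s : ComposableArrows C Δ.unop.len,
      (f.app (op (s.obj 0))).hom (barGen k s (𝟙 _)) =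
      (g.app (op (s.obj 0))).hom (barGen k s (𝟙 _))) :
    f = g := by
  apply NatTrans.ext
  funext d
  apply ModuleCat.hom_ext
  apply barResolution_obj_lin_ext
  intro s a
  have e : barGen k s a = (((barResolution k C).obj Δ).map a.op).hom (barGen k s (𝟙 _)) :=
    Eq.symm ((barResolution_obj_map_barGen a.op s (𝟙 _)).trans
      (congrArg (barGen k s) (Category.comp_id _)))
  rw [e]
  exact (NatTrans.naturality_apply f a.op _).trans
    ((congrArg _ (h s)).trans (NatTrans.naturality_apply g a.op _).symm)

/-- A sum of representables is projective: epimorphisms of right modules are surjective at each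
object, so a lift is obtained by choosing preimages of the values on the identity generators. -/
instance (Δ : SimplexCategoryᵒᵖ) : Projective ((barResolution k C).obj Δ) where
  factors {E X} f e _ := by
    have hs : ∀ c : C, Function.Surjective (e.app (op c)).hom := fun c =>
      (ModuleCat.epi_iff_surjective _).1 inferInstance
    refine ⟨barResolutionLift Δ E fun s => (hs _ ((f.app (op (s.obj 0))).hom
      (barGen k s (𝟙 _)))).choose, ?_⟩
    apply barResolution_hom_ext
    intro s
    have h := (hs _ ((f.app (op (s.obj 0))).hom (barGen k s (𝟙 _)))).choose_spec
    refine (congrArg (e.app _).hom (barResolutionLift_barGen _ _ _ _ _)).trans ?_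
    simpa using h

/-- The augmentation `barResolution ⟶ k^⋆`. -/
noncomputable def barAugmentation : barResolution k C ⟶
    (SimplicialObject.const _).obj (constRight k C) where
  app Δ := barResolutionLift Δ (constRight k C) fun _ => (1 : k)
  naturality Δ Δ' θ := by
    apply barResolution_hom_ext
    intro s
    refine (congrArg ((barResolutionLift Δ' (constRight k C) fun _ => (1 : k)).app _).hom
      (barResolution_map_barGen θ s (𝟙 _))).trans ?_
    exact (barResolutionLift_barGen _ _ _ _ _).trans
      (barResolutionLift_barGen Δ (constRight k C) (fun _ => (1 : k)) _ _).symm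

theorem barAugmentation_barGen {Δ : SimplexCategoryᵒᵖ} {d : Cᵒᵖ}
    (s : ComposableArrows C Δ.unop.len) (a : d.unop ⟶ s.obj 0) :
    (((barAugmentation (k := k) (C := C)).app Δ).app d).hom (barGen k s a) = (1 : k) :=
  barResolutionLift_barGen Δ (constRight k C) (fun _ => (1 : k)) _ _

variable (k C) in
/-- `barResolution` as an augmented simplicial right `C`-module. -/
noncomputable def barAugmented : SimplicialObject.Augmented (Cᵒᵖ ⥤ ModuleCat.{u} k) where
  left := barResolution k C
  right := constRight k C
  hom := barAugmentation

/-- The map `[m + 1] ⟶ [n + 1]` with `0 ↦ 0` and `j + 1 ↦ θ(j) + 1`. -/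
def shiftHom {m n : ℕ} (θ : ⦋m⦌ ⟶ ⦋n⦌) : ⦋m + 1⦌ ⟶ ⦋n + 1⦌ :=
  SimplexCategory.mkHom ⟨Fin.cases 0 fun j : Fin (m + 1) => (θ.toOrderHom j).succ, by
    intro i j h
    cases i using Fin.cases with
    | zero => exact Fin.zero_le _
    | succ i =>
      cases j using Fin.cases with
      | zero => exact absurd (Fin.le_zero_iff.1 h) (Fin.succ_ne_zero i)
      | succ j => exact Fin.succ_le_succ_iff.2 (θ.toOrderHom.monotone (Fin.succ_le_succ_iff.1 h))⟩

/-- Prepending a vertex raises all indices by one; with `shiftHom_σ`, this gives the commutation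
rules demanded of an extra degeneracy. -/
theorem shiftHom_δ {n : ℕ} (i : Fin (n + 2)) :
    shiftHom (SimplexCategory.δ i) = SimplexCategory.δ i.succ := by
  ext j : 3
  cases j using Fin.cases with
  | zero => exact (Fin.succ_succAbove_zero i).symm
  | succ j => exact (Fin.succ_succAbove_succ i j).symm

theorem shiftHom_σ {n : ℕ} (i : Fin (n + 1)) :
    shiftHom (SimplexCategory.σ i) = SimplexCategory.σ i.succ := by
  ext j : 3
  cases j using Fin.cases with
  | zero => exact (show (0 : Fin (n + 2)) = Fin.predAbove i.succ 0 by simp)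
  | succ j => exact (Fin.succ_predAbove_succ i j).symm

/-- `precomp` defines its maps by cases on the target index; at `j = 0` the value is `a` alone, and
only there an identity has to be inserted. -/
theorem precomp_map_zero {n : ℕ} {d : C} (s : ComposableArrows C n) (a : d ⟶ s.left)
    (j : Fin (n + 1)) (h : (0 : Fin (n + 2)) ⟶ j.succ) :
    (s.precomp a).map h = a ≫ s.map (homOfLE (Fin.zero_le j)) := by
  obtain ⟨_ | j, hj⟩ := j
  · exact ((congrArg (a ≫ ·) (s.map_id 0)).trans (Category.comp_id a)).symm
  · rfl

/-- The prepended vertex stays fixed by the shift, and its outgoing morphism is extended to the new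
first vertex `C_{θ(0)}`. -/
theorem pull_shiftHom_precomp {m n : ℕ} {d : C} (θ : ⦋m⦌ ⟶ ⦋n⦌) (s : ComposableArrows C n)
    (a : d ⟶ s.left) :
    (pull (Δ := op ⦋n + 1⦌) (Δ' := op ⦋m + 1⦌) (shiftHom θ).op (s.precomp a) :
      ComposableArrows C (m + 1)) =
      ComposableArrows.precomp (pull (Δ := op ⦋n⦌) (Δ' := op ⦋m⦌) θ.op s)
        (a ≫ gzHead (Δ := op ⦋n⦌) (Δ' := op ⦋m⦌) θ.op s) := by
  refine ComposableArrows.ext_succ rfl rfl ?_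
  refine Eq.trans ?_ ((Category.id_comp _).trans (Category.comp_id _)).symm
  exact precomp_map_zero s a (θ.toOrderHom 0) (homOfLE (Fin.zero_le _))

variable (k) in
theorem barGen_congr {Δ : SimplexCategoryᵒᵖ} {d : Cᵒᵖ} {s s' : ComposableArrows C Δ.unop.len}
    (h : s = s') (a : d.unop ⟶ s.obj 0) :
    barGen k s a = barGen k s' (a ≫ eqToHom (by rw [h])) := by
  subst h
  simp

variable (k) in
/-- The linear map `(d ⟶ C₀ ⟶ ⋯) ↦ (d = d ⟶ C₀ ⟶ ⋯)`. -/
noncomputable def barExtra (d : Cᵒᵖ) (n : ℕ) :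
    ((barResolution k C).obj (op ⦋n⦌)).obj d →ₗ[k] ((barResolution k C).obj (op ⦋n + 1⦌)).obj d :=
  barResolutionDesc (Δ := op ⦋n⦌) (d := d) fun s a =>
    barGen k (Δ := op ⦋n + 1⦌) (d := d) (s.precomp a) (𝟙 d.unop)

/-- An arbitrary `θ` treats faces and degeneracies together; `θ'` is left free so that it can be the
literal coface or codegeneracy. -/
theorem barExtra_comp_map (d : Cᵒᵖ) {m n : ℕ} (θ : ⦋m⦌ ⟶ ⦋n⦌) (θ' : ⦋m + 1⦌ ⟶ ⦋n + 1⦌)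
    (h : shiftHom θ = θ') (s : ComposableArrows C n) (a : d.unop ⟶ s.left) :
    (((barResolution k C).map θ'.op).app d).hom
        (barExtra k d n (barGen k (Δ := op ⦋n⦌) (d := d) s a)) =
      barExtra k d m ((((barResolution k C).map θ.op).app d).hom
        (barGen k (Δ := op ⦋n⦌) (d := d) s a)) := by
  subst h
  refine (congrArg (((barResolution k C).map (shiftHom θ).op).app d).hom
    (barResolutionDesc_barGen (Δ := op ⦋n⦌) (d := d) _ s a)).trans ?_
  refine (barResolution_map_barGen (Δ := op ⦋n + 1⦌) (Δ' := op ⦋m + 1⦌) _ _ _).trans ?_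
  refine Eq.symm ((congrArg (barExtra k d m)
    (barResolution_map_barGen (Δ := op ⦋n⦌) (Δ' := op ⦋m⦌) θ.op s a)).trans ?_)
  refine (barResolutionDesc_barGen (Δ := op ⦋m⦌) (d := d) _ _ _).trans ?_
  refine Eq.symm ((barGen_congr k (Δ := op ⦋m + 1⦌) (d := d) (pull_shiftHom_precomp θ s a) _).trans
    (congrArg (barGen k (Δ := op ⦋m + 1⦌) (d := d) _) ?_))
  exact (Category.comp_id _).trans (Category.comp_id _)

/-- Dropping `C₀` leaves the one-vertex string `d`, whatever the generator was. The composite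
therefore factors through the augmentation, which is `1` on every generator. -/
theorem barExtra_δ_one (d : Cᵒᵖ) (s : ComposableArrows C 0) (a : d.unop ⟶ s.left) :
    (((barResolution k C).map (SimplexCategory.δ (1 : Fin 2)).op).app d).hom
        (barExtra k d 0 (barGen k (Δ := op ⦋0⦌) (d := d) s a)) =
      barGen k (Δ := op ⦋0⦌) (d := d) (ComposableArrows.mk₀ d.unop) (𝟙 d.unop) := by
  refine (congrArg (((barResolution k C).map (SimplexCategory.δ (1 : Fin 2)).op).app d).hom
    (barResolutionDesc_barGen (Δ := op ⦋0⦌) (d := d) _ s a)).trans ?_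
  refine (barResolution_map_barGen (Δ := op ⦋1⦌) (Δ' := op ⦋0⦌)
    (SimplexCategory.δ (1 : Fin 2)).op (s.precomp (n := 0) a) (𝟙 d.unop)).trans ?_
  have h : (pull (Δ := op ⦋1⦌) (Δ' := op ⦋0⦌) (SimplexCategory.δ (1 : Fin 2)).op
      (s.precomp (n := 0) a) : ComposableArrows C 0) = ComposableArrows.mk₀ d.unop :=
    ComposableArrows.ext₀ rfl
  refine (barGen_congr k (Δ := op ⦋0⦌) (d := d) h _).trans
    (congrArg (barGen k (Δ := op ⦋0⦌) (d := d) (ComposableArrows.mk₀ d.unop)) ?_)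
  exact (Category.comp_id _).trans (Category.comp_id _)

/-- The zeroth face deletes the vertex just prepended, and the morphism from `d` becomes the
identity followed by `a`. -/
theorem barExtra_δ_zero (d : Cᵒᵖ) (n : ℕ) (s : ComposableArrows C n) (a : d.unop ⟶ s.left) :
    (((barResolution k C).map (SimplexCategory.δ (0 : Fin (n + 2))).op).app d).hom
        (barExtra k d n (barGen k (Δ := op ⦋n⦌) (d := d) s a)) =
      barGen k (Δ := op ⦋n⦌) (d := d) s a := by
  refine (congrArg (((barResolution k C).map (SimplexCategory.δ (0 : Fin (n + 2))).op).app d).hom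
    (barResolutionDesc_barGen (Δ := op ⦋n⦌) (d := d) _ s a)).trans ?_
  refine (barResolution_map_barGen (Δ := op ⦋n + 1⦌) (Δ' := op ⦋n⦌)
    (SimplexCategory.δ (0 : Fin (n + 2))).op (s.precomp (n := n) a) (𝟙 d.unop)).trans ?_
  refine congrArg (barGen k (Δ := op ⦋n⦌) (d := d) s) ((Category.id_comp _).trans ?_)
  exact (precomp_map_zero (n := n) s a 0 (homOfLE (Fin.zero_le _))).trans
    ((congrArg (a ≫ ·) (s.map_id 0)).trans (Category.comp_id a))

/-- The extra degeneracy `(d ⟶ C₀ ⟶ ⋯) ↦ (d = d ⟶ C₀ ⟶ ⋯)`. -/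
noncomputable def barExtraDegeneracy (d : Cᵒᵖ) : SimplicialObject.Augmented.ExtraDegeneracy
    (((SimplicialObject.Augmented.whiskering _ _).obj ((evaluation _ _).obj d)).obj
      (barAugmented k C)) where
  s' := ModuleCat.ofHom (LinearMap.toSpanSingleton k _
    (barGen k (Δ := op ⦋0⦌) (d := d) (ComposableArrows.mk₀ d.unop) (𝟙 d.unop)))
  s n := ModuleCat.ofHom (barExtra k d n)
  s'_comp_ε := by
    apply ModuleCat.hom_ext
    apply LinearMap.ext_ring
    refine (congrArg (((barAugmentation (k := k) (C := C)).app (op ⦋0⦌)).app d).hom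
      (one_smul k _)).trans ?_
    exact barAugmentation_barGen _ _
  s₀_comp_δ₁ := by
    apply ModuleCat.hom_ext
    apply barResolution_obj_lin_ext
    intro s a
    exact (barExtra_δ_one d s a).trans (Eq.symm ((congrArg (LinearMap.toSpanSingleton k _ _)
      (barAugmentation_barGen (Δ := op ⦋0⦌) (d := d) s a)).trans (one_smul k _)))
  s_comp_δ₀ n := by
    apply ModuleCat.hom_ext
    apply barResolution_obj_lin_ext
    intro s a
    exact barExtra_δ_zero d n s a
  s_comp_δ n i := by
    apply ModuleCat.hom_ext
    apply barResolution_obj_lin_ext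
    intro s a
    exact barExtra_comp_map d (SimplexCategory.δ i) _ (shiftHom_δ i) s a
  s_comp_σ n i := by
    apply ModuleCat.hom_ext
    apply barResolution_obj_lin_ext
    intro s a
    exact barExtra_comp_map d (SimplexCategory.σ i) _ (shiftHom_σ i) s a

end FunctorHomologyComplex

end HyperHom

/-! ### `C_⋆(C, F)` computes `Tor`. -/

namespace HyperHom

section TorComplex

open Simplicial Limits AlgebraicTopology

/-- Additive functors commute with alternating face map complexes. -/
noncomputable def mapAlternatingFaceMapComplexIso {X Y : Type*} [Category* X] [Category* Y]
    [Preadditive X] [Preadditive Y] (F : X ⥤ Y) [F.Additive] (Z : SimplicialObject X) :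
    (F.mapHomologicalComplex _).obj ((alternatingFaceMapComplex X).obj Z) ≅
      (alternatingFaceMapComplex Y).obj (((SimplicialObject.whiskering X Y).obj F).obj Z) :=
  eqToIso (Functor.congr_obj (map_alternatingFaceMapComplex F) Z)

theorem mapAlternatingFaceMapComplexIso_hom_f {X Y : Type*} [Category* X] [Category* Y]
    [Preadditive X] [Preadditive Y] (F : X ⥤ Y) [F.Additive] (Z : SimplicialObject X) (n : ℕ) :
    (mapAlternatingFaceMapComplexIso F Z).hom.f n = 𝟙 _ := by
  simp only [mapAlternatingFaceMapComplexIso, eqToIso.hom, HomologicalComplex.eqToHom_f]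
  rfl

/-- The extra degeneracy is needed only after applying `F`. This matters for evaluation at an object
`d`: the contraction prepends `d` and is not natural in it. Up to canonical isomorphisms, the image
of the augmentation is the augmentation of the image, which is a homotopy equivalence. -/
theorem quasiIso_map_ε {X Y : Type*} [Category* X] [Category* Y]
    [Abelian X] [Abelian Y] (F : X ⥤ Y) [F.Additive] (Z : SimplicialObject.Augmented X)
    (ed : SimplicialObject.Augmented.ExtraDegeneracy
      (((SimplicialObject.Augmented.whiskering _ _).obj F).obj Z)) :
    QuasiIso ((F.mapHomologicalComplex _).map (AlternatingFaceMapComplex.ε.app Z)) := by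
  let e : (alternatingFaceMapComplex Y).obj
      (((SimplicialObject.whiskering _ _).obj F).obj Z.left) ⟶
      (HomologicalComplex.single Y (ComplexShape.down ℕ) 0).obj
        (F.obj Z.right) :=
    AlternatingFaceMapComplex.ε.app (((SimplicialObject.Augmented.whiskering _ _).obj F).obj Z)
  have he : QuasiIso e := ed.homotopyEquiv.quasiIso_hom
  let i := (HomologicalComplex.singleMapHomologicalComplex F
    (ComplexShape.down ℕ) 0).app Z.right
  have h : (F.mapHomologicalComplex _).map (AlternatingFaceMapComplex.ε.app Z) =
      (mapAlternatingFaceMapComplexIso F Z.left).hom ≫ e ≫ i.inv := by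
    ext n : 1
    refine Eq.trans ?_ (HomologicalComplex.comp_f _ _ _).symm
    rw [HomologicalComplex.comp_f, mapAlternatingFaceMapComplexIso_hom_f]
    refine Eq.trans ?_ (Category.id_comp _).symm
    cases n with
    | zero =>
      refine Eq.trans ?_ (congrArg (e.f 0 ≫ ·)
        (HomologicalComplex.singleMapHomologicalComplex_inv_app_self F _ 0 Z.right)).symm
      refine (congrArg F.map (AlternatingFaceMapComplex.ε_app_f_zero Z)).trans (Eq.symm
        ((congrArg (· ≫ _) (AlternatingFaceMapComplex.ε_app_f_zero _)).trans ?_))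
      have hw : (((SimplicialObject.Augmented.whiskering X Y).obj F).obj Z).hom.app (op ⦋0⦌) =
          F.map (Z.hom.app (op ⦋0⦌)) := Category.comp_id _
      refine (congrArg (· ≫ _) hw).trans ((congrArg (F.map (Z.hom.app (op ⦋0⦌)) ≫ ·) ?_).trans
        (Category.comp_id _))
      exact (Category.id_comp _).trans (CategoryTheory.Functor.map_id F _)
    | succ n =>
      refine Eq.trans ?_ (congrArg (e.f (n + 1) ≫ ·)
        (HomologicalComplex.singleMapHomologicalComplex_inv_app_ne F _
          (Nat.succ_ne_zero n) Z.right)).symm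
      exact (F.map_zero _ _).trans Limits.comp_zero.symm
  have h3 : QuasiIso (e ≫ i.inv) := quasiIso_comp _ _
  have h1 : QuasiIso (mapAlternatingFaceMapComplexIso F Z.left).hom := inferInstance
  exact h ▸ quasiIso_comp _ _

variable (k : Type u) [CommRing k] (C : Type) [SmallCategory C]

theorem quasiIso_barAugmented :
    QuasiIso (AlternatingFaceMapComplex.ε.app (barAugmented k C)) := by
  rw [HomologicalComplex.quasiIso_iff_evaluation]
  intro d
  exact quasiIso_map_ε _ (barAugmented k C) (barExtraDegeneracy (k := k) d)

/-- The projective resolution of `k^⋆` by strings. -/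
noncomputable def barProjectiveResolution : ProjectiveResolution (constRight k C) where
  complex := (alternatingFaceMapComplex _).obj (barResolution k C)
  projective n := inferInstanceAs (Projective ((barResolution k C).obj (op ⦋n⦌)))
  π := AlternatingFaceMapComplex.ε.app (barAugmented k C)
  quasiIso := quasiIso_barAugmented k C

variable {k C} (F : C ⥤ ModuleCat.{u} k)

/-- The map `k[strings d ⟶ C₀ ⟶ ⋯] ⊗_C F ⟶ C_⋆(C, F)`. -/
noncomputable def barTensorDesc (Δ : SimplexCategoryᵒᵖ) :
    tensorObj ((barResolution k C).obj Δ) F →ₗ[k] GZ F Δ.unop.len :=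
  tensorDesc _ F (fun c => barResolutionDesc (d := op c) fun s a =>
    gzMk F Δ.unop.len s ∘ₗ (F.map a).hom) (by
    intro c d α x y
    suffices h : (barResolutionDesc (d := op c) fun s a =>
        gzMk F Δ.unop.len s ∘ₗ (F.map a).hom) ∘ₗ (((barResolution k C).obj Δ).map α.op).hom =
        LinearMap.lcomp k (GZ F Δ.unop.len) (F.map α).hom ∘ₗ (barResolutionDesc (d := op d) fun s a =>
          gzMk F Δ.unop.len s ∘ₗ (F.map a).hom) from
      congrArg (fun h => h y) (LinearMap.congr_fun h x)
    apply barResolution_obj_lin_ext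
    intro s a
    refine (congrArg (barResolutionDesc (d := op c) fun s a =>
        gzMk F Δ.unop.len s ∘ₗ (F.map a).hom) (barResolution_obj_map_barGen α.op s a)).trans
      ((barResolutionDesc_barGen _ _ _).trans ?_)
    refine Eq.symm ((congrArg (LinearMap.lcomp k (GZ F Δ.unop.len) (F.map α).hom) (barResolutionDesc_barGen _ _ _)).trans ?_)
    refine LinearMap.ext fun z => ?_
    exact congrArg (fun h => gzMk F Δ.unop.len s (ModuleCat.Hom.hom h z)) (F.map_comp α a).symm)

theorem barTensorDesc_mk {Δ : SimplexCategoryᵒᵖ} {c : C} (s : ComposableArrows C Δ.unop.len)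
    (a : c ⟶ s.obj 0) (y : F.obj c) :
    barTensorDesc F Δ (tensorMk ((barResolution k C).obj Δ) F c (barGen k (d := op c) s a) y) =
      gzMk F Δ.unop.len s ((F.map a).hom y) :=
  (tensorDesc_mk _ _ _ _ _ _ _).trans
    (LinearMap.congr_fun (barResolutionDesc_barGen (d := op c) _ s a) y)

open Classical in
/-- The inverse of `barTensorDesc`. -/
noncomputable def barTensorInv (Δ : SimplexCategoryᵒᵖ) :
    GZ F Δ.unop.len →ₗ[k] tensorObj ((barResolution k C).obj Δ) F :=
  DirectSum.toModule k _ _ fun s =>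
    tensorMkBilin ((barResolution k C).obj Δ) F (s.obj 0) (barGen k (d := op (s.obj 0)) s (𝟙 _))

theorem barTensorInv_mk {Δ : SimplexCategoryᵒᵖ} (s : ComposableArrows C Δ.unop.len)
    (y : F.obj (s.obj 0)) :
    barTensorInv F Δ (gzMk F _ s y) = tensorMk ((barResolution k C).obj Δ) F (s.obj 0)
      (barGen k (d := op (s.obj 0)) s (𝟙 _)) y := by
  simp [barTensorInv, gzMk]
  rfl

/-- Co-Yoneda: in the tensor product, a generator with morphism `a` tensored with `y` equals the
identity generator tensored with `F(a)(y)`. -/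
theorem barTensor_hom_ext {Δ : SimplexCategoryᵒᵖ} {M : Type u} [AddCommGroup M] [Module k M]
    {f g : tensorObj ((barResolution k C).obj Δ) F →ₗ[k] M}
    (h : ∀ (s : ComposableArrows C Δ.unop.len) (y : F.obj (s.obj 0)),
      f (tensorMk _ F (s.obj 0) (barGen k (d := op (s.obj 0)) s (𝟙 _)) y) =
      g (tensorMk _ F (s.obj 0) (barGen k (d := op (s.obj 0)) s (𝟙 _)) y)) : f = g := by
  apply tensor_hom_ext
  intro c x y
  suffices h : f ∘ₗ (tensorMkBilin ((barResolution k C).obj Δ) F c).flip y =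
      g ∘ₗ (tensorMkBilin ((barResolution k C).obj Δ) F c).flip y from LinearMap.congr_fun h x
  apply barResolution_obj_lin_ext
  intro s a
  have e : tensorMk ((barResolution k C).obj Δ) F c (barGen k (d := op c) s a) y =
      tensorMk ((barResolution k C).obj Δ) F (s.obj 0) (barGen k (d := op (s.obj 0)) s (𝟙 _))
        ((F.map a).hom y) := by
    refine Eq.trans (congrArg (fun x => tensorMk ((barResolution k C).obj Δ) F c x y) ?_)
      (tensorMk_map a _ y)
    exact Eq.symm ((barResolution_obj_map_barGen a.op s (𝟙 _)).trans
      (congrArg (barGen k s) (Category.comp_id a)))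
  exact (congrArg f e).trans ((h s _).trans (congrArg g e).symm)

/-- The isomorphism `k[strings d ⟶ C₀ ⟶ ⋯] ⊗_C F ≅ C_⋆(C, F)`. -/
noncomputable def barTensorIso :
    ((SimplicialObject.whiskering _ _).obj (tensorFunctor F)).obj (barResolution k C) ≅
      gabrielZisman F :=
  NatIso.ofComponents (fun Δ => LinearEquiv.toModuleIso
    (LinearEquiv.ofLinearMap (barTensorDesc F Δ) (barTensorInv F Δ)
      (by
        apply gz_hom_ext
        intro s x
        refine (congrArg (barTensorDesc F Δ) (barTensorInv_mk F s x)).trans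
          ((barTensorDesc_mk F _ _ _).trans ?_)
        exact congrArg (fun h => gzMk F _ s (ModuleCat.Hom.hom h x)) (F.map_id _))
      (by
        apply barTensor_hom_ext
        intro s y
        refine (congrArg (barTensorInv F Δ) (barTensorDesc_mk F _ _ _)).trans
          ((barTensorInv_mk F _ _).trans ?_)
        exact congrArg (fun h => tensorMk _ F (s.obj 0) (barGen k (d := op (s.obj 0)) s (𝟙 _))
          (ModuleCat.Hom.hom h y)) (F.map_id _)))) (by
    intro Δ Δ' θ
    apply ModuleCat.hom_ext
    apply barTensor_hom_ext
    intro s y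
    refine (congrArg (barTensorDesc F Δ') ((tensorMap_mk _ _ _ _ _).trans
      (congrArg (fun x => tensorMk _ F (s.obj 0) x y)
        (barResolution_map_barGen θ s (𝟙 _))))).trans ?_
    refine (barTensorDesc_mk F _ _ _).trans (Eq.symm ((congrArg (gzMap F θ)
      (barTensorDesc_mk F _ _ _)).trans ((gzMap_mk F θ _ _).trans ?_)))
    refine congrArg (gzMk F _ (pull θ s)) ?_
    refine congrArg (fun h => ModuleCat.Hom.hom h y) (?_ : F.map (𝟙 _) ≫ F.map _ = _)
    exact (F.map_comp _ _).symm)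

/-- The simplicial module `C_⋆(C, F)` computes `Tor^C(k^⋆, F)`. -/
noncomputable def torIsoHomology (n : ℕ) :
    tor n (constRight k C) F ≅
      ((alternatingFaceMapComplex (ModuleCat.{u} k)).obj (gabrielZisman F)).homology n :=
  (barProjectiveResolution k C).isoLeftDerivedObj (tensorFunctor F) n ≪≫
    (HomologicalComplex.homologyFunctor _ _ n).mapIso
      (mapAlternatingFaceMapComplexIso (tensorFunctor F) (barResolution k C) ≪≫
        (alternatingFaceMapComplex _).mapIso (barTensorIso F))

end TorComplex

/-- The simplicial module `C_⋆(ΔH₊, H_{A+})` computes hyperoctahedral homology. -/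
noncomputable def hyperoctahedralHomologyIso (k A : Type u) [CommRing k] [Ring A] [Algebra k A]
    (τ : Involution k A) (n : ℕ) :
    ((AlgebraicTopology.alternatingFaceMapComplex (ModuleCat.{u} k)).obj
        (hyperoctahedralModule k A τ)).homology n ≅ hyperoctahedralHomology k A τ n :=
  (restrictHomotopyEquiv (barFunctor k A τ)).symm.toHomologyIso n ≪≫
    (torIsoHomology (deltaHIncl ⋙ barFunctor k A τ) n).symm

end HyperHom

/-! ### Bijections of finite ordinals and lexicographic orders. -/

namespace HyperHom

section OrderOfEquiv

/-- Two bijections between finite ordinals that induce the same order on the source agree. -/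
theorem equiv_ext_lt {n m : ℕ} {e f : Fin n ≃ Fin m} (h : ∀ i j, e i < e j ↔ f i < f j) :
    e = f := by
  have hm : StrictMono (e.symm.trans f) := fun a b hab => by
    simpa using (h (e.symm a) (e.symm b)).1 (by simpa using hab)
  have : hm.orderIsoOfSurjective _ (Equiv.surjective _) = OrderIso.refl _ := Subsingleton.elim _ _
  ext i : 1
  have h2 := congrArg (fun E : Fin m ≃o Fin m => E (e i)) this
  simpa using h2.symm

theorem val_eqRec_fin {ι : Type*} {p : ι → ℕ} {i i' : ι} (h : i = i') (a : Fin (p i)) :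
    ((h ▸ a : Fin (p i')) : ℕ) = a := by
  subst h
  rfl

theorem blockPerm_apply {m : ℕ} (σ : Equiv.Perm (Fin m)) (p : Fin m → ℕ) (i : Fin m)
    (a : Fin (p i)) : blockPerm σ p (finSigmaFinEquiv ⟨i, a⟩) =
      finSigmaFinEquiv ⟨σ i, Fin.cast (by rw [Equiv.symm_apply_apply]) a⟩ := by
  simp only [blockPerm, Equiv.trans_apply, Equiv.symm_apply_apply]
  refine congrArg finSigmaFinEquiv (?_ : (⟨σ i, _⟩ : (i : Fin m) × Fin (p (σ.symm i))) = ⟨σ i, _⟩)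
  refine Sigma.ext rfl (heq_of_eq ?_)
  apply Fin.ext
  simp [val_eqRec_fin]

/-- Blocks move rigidly, so the order inside a block is unchanged. Entries are compared in `ℕ`
because those of different blocks have different types. -/
theorem blockPerm_lt {m : ℕ} (σ : Equiv.Perm (Fin m)) (p : Fin m → ℕ)
    (x y : (i : Fin m) × Fin (p i)) :
    blockPerm σ p (finSigmaFinEquiv x) < blockPerm σ p (finSigmaFinEquiv y) ↔
      σ x.1 < σ y.1 ∨ (x.1 = y.1 ∧ (x.2 : ℕ) < (y.2 : ℕ)) := by
  obtain ⟨i, a⟩ := x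
  obtain ⟨i', b⟩ := y
  rw [blockPerm_apply, blockPerm_apply, finSigma_lt]
  simp

/-- By `equiv_ext_lt` this order determines the permutation; the identities for `operadPerm` are all
proved through it. -/
theorem operadPerm_lt {m : ℕ} (j : Fin m → ℕ) (σ : Equiv.Perm (Fin m))
    (τ : ∀ i, Equiv.Perm (Fin (j i))) (x y : (i : Fin m) × Fin (j i)) :
    operadPerm j σ τ (finSigmaFinEquiv x) < operadPerm j σ τ (finSigmaFinEquiv y) ↔
      σ x.1 < σ y.1 ∨ (x.1 = y.1 ∧ (τ x.1 x.2 : ℕ) < (τ y.1 y.2 : ℕ)) := by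
  have h : ∀ x : (i : Fin m) × Fin (j i), operadPerm j σ τ (finSigmaFinEquiv x) =
      Fin.cast (Equiv.sum_comp σ.symm j) (blockPerm σ j (finSigmaFinEquiv ⟨x.1, τ x.1 x.2⟩)) := by
    intro x
    simp [operadPerm]
  rw [h, h, Fin.cast_lt_cast, blockPerm_lt]

theorem finCongr_sigma_one {n : ℕ} (h : ∑ _ : Fin 1, n = n) (i : Fin 1) (a : Fin n) :
    finCongr h (finSigmaFinEquiv (n := fun _ : Fin 1 => n) ⟨i, a⟩) = a := by
  apply Fin.ext
  rw [finCongr_apply_coe, finSigmaFinEquiv_apply]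
  fin_cases i
  simp

theorem finCongr_sigma_const_one {m : ℕ} (h : ∑ _ : Fin m, 1 = m) (i : Fin m) (a : Fin 1) :
    finCongr h (finSigmaFinEquiv (n := fun _ : Fin m => 1) ⟨i, a⟩) = i := by
  apply Fin.ext
  rw [finCongr_apply_coe, finSigmaFinEquiv_apply]
  simp

/-- The lexicographic order on triples does not depend on the bracketing. Hence the rebracketing
bijection `E` preserves order, and it must be the cast. -/
theorem finCongr_sigma_sigma {m : ℕ} (j : Fin m → ℕ) (l : ∀ i, Fin (j i) → ℕ)
    (t : Fin (∑ i, j i)) (a : Fin (l (finSigmaFinEquiv.symm t).1 (finSigmaFinEquiv.symm t).2)) :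
    finCongr (sum_sum_eq j l) (finSigmaFinEquiv (n := fun t : Fin (∑ i, j i) =>
      l (finSigmaFinEquiv.symm t).1 (finSigmaFinEquiv.symm t).2) ⟨t, a⟩) =
      finSigmaFinEquiv ⟨(finSigmaFinEquiv.symm t).1,
        finSigmaFinEquiv ⟨(finSigmaFinEquiv.symm t).2, a⟩⟩ := by
  let E : Fin (∑ t : Fin (∑ i, j i), l (finSigmaFinEquiv.symm t).1 (finSigmaFinEquiv.symm t).2) ≃
      Fin (∑ i, ∑ s, l i s) :=
    finSigmaFinEquiv.symm.trans (((Equiv.sigmaCongrLeft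
      (β := fun x : (i : Fin m) × Fin (j i) => Fin (l x.1 x.2))
      finSigmaFinEquiv.symm).trans (Equiv.sigmaAssoc fun i s => Fin (l i s))).trans
      ((Equiv.sigmaCongrRight fun i => finSigmaFinEquiv).trans finSigmaFinEquiv))
  have hE : ∀ t a, E (finSigmaFinEquiv (n := fun t : Fin (∑ i, j i) =>
      l (finSigmaFinEquiv.symm t).1 (finSigmaFinEquiv.symm t).2) ⟨t, a⟩) =
      finSigmaFinEquiv ⟨(finSigmaFinEquiv.symm t).1,
        finSigmaFinEquiv ⟨(finSigmaFinEquiv.symm t).2, a⟩⟩ := by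
    intro t a
    simp only [E, Equiv.trans_apply, Equiv.symm_apply_apply]
    rfl
  rw [← hE]
  refine congrArg (fun e : _ ≃ _ => e _) (equiv_ext_lt (f := E) fun x y => ?_)
  obtain ⟨⟨t, a⟩, rfl⟩ := finSigmaFinEquiv.surjective x
  obtain ⟨⟨t', b⟩, rfl⟩ := finSigmaFinEquiv.surjective y
  rw [hE, hE, finSigma_lt, finCongr_apply, finCongr_apply, Fin.cast_lt_cast, finSigma_lt]
  dsimp only
  have h1 := finSigma_lt (finSigmaFinEquiv.symm t) (finSigmaFinEquiv.symm t')
  rw [Equiv.apply_symm_apply, Equiv.apply_symm_apply] at h1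
  have h2 : t = t' ↔ finSigmaFinEquiv.symm t = finSigmaFinEquiv.symm t' := by simp
  rw [h1, h2]
  generalize finSigmaFinEquiv.symm t = u at *
  generalize finSigmaFinEquiv.symm t' = v at *
  obtain ⟨u1, u2⟩ := u
  obtain ⟨v1, v2⟩ := v
  by_cases h : u1 = v1
  · subst h
    simp only [lt_irrefl, false_or, true_and, ← Fin.lt_def, finSigma_lt, Sigma.mk.injEq,
      heq_eq_eq]
  · simp [h]

end OrderOfEquiv

/-! ### Tools for checking multilinear identities on generators. -/

section MultilinearExtension

variable {k : Type*} [CommRing k]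

/-- Reindexing of a multilinear map along a bijection of the index types. -/
def multReindex {ι κ : Type*} (e : ι ≃ κ) {M : κ → Type*} {N : Type*} [∀ i, AddCommGroup (M i)]
    [∀ i, Module k (M i)] [AddCommGroup N] [Module k N]
    (f : MultilinearMap k (fun i => M (e i)) N) : MultilinearMap k M N where
  toFun v := f fun i => v (e i)
  map_update_add' v j x y := by
    classical
    obtain ⟨i, rfl⟩ := e.surjective j
    simp only [Function.update_comp_eq_of_injective' v e.injective]
    rw [f.map_update_add]
  map_update_smul' v j c x := by
    classical
    obtain ⟨i, rfl⟩ := e.surjective j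
    simp only [Function.update_comp_eq_of_injective' v e.injective]
    rw [f.map_update_smul]

/-- Evaluation of a linear family of multilinear maps. -/
def multEval {ι : Type*} {M : ι → Type*} {L N : Type*} [∀ i, AddCommGroup (M i)]
    [∀ i, Module k (M i)] [AddCommGroup L] [Module k L] [AddCommGroup N] [Module k N]
    (f : L →ₗ[k] MultilinearMap k M N) (v : ∀ i, M i) : L →ₗ[k] N where
  toFun a := f a v
  map_add' a b := by rw [map_add, add_apply]
  map_smul' c a := by rw [map_smul, smul_apply, RingHom.id_apply]

theorem multilinear_finsupp_ext {ι : Type*} [Finite ι] {Y : ι → Type*} {N : Type*}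
    [AddCommGroup N] [Module k N] {f g : MultilinearMap k (fun i => (Y i →₀ k)) N}
    (h : ∀ y : ∀ i, Y i, f (fun i => Finsupp.single (y i) 1) = g fun i => Finsupp.single (y i) 1) :
    f = g :=
  MultilinearMap.ext_of_span_eq_top (g := fun i (y : Y i) => Finsupp.single y (1 : k))
    (fun i => by
      rw [eq_top_iff, ← (Finsupp.basisSingleOne (R := k) (ι := Y i)).span_eq]
      apply Submodule.span_mono
      rintro _ ⟨y, rfl⟩
      exact ⟨y, by simp⟩) h

end MultilinearExtension

end HyperHom

/-! ### The composition of permutations in the Barratt-Eccles operad. -/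

namespace HyperHom

section BarrattEccles

/-- Morphisms of `𝔼X` are unique, so a string is its list of vertices. This reduces the operad
axioms to identities between permutations. -/
theorem egString_ext {X : Type} {p : ℕ} {s t : ComposableArrows (EG X) p}
    (h : ∀ q, (s.obj q).as = (t.obj q).as) : s = t :=
  CategoryTheory.Functor.ext (fun q => Codiscrete.ext (h q)) (fun _ _ _ => Subsingleton.elim _ _)

/-- The right action of a bijection on `𝔼Σ_m`. -/
abbrev egPull {n m : ℕ} (e : Fin n ≃ Fin m) :
    EG (Equiv.Perm (Fin m)) ⥤ EG (Equiv.Perm (Fin n)) :=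
  Codiscrete.functorOfFun fun x => (e.trans x).trans (finCongr (card_eq_of_equiv e).symm)

variable (k : Type u) [CommRing k]

/-- The generator of the Barratt-Eccles operad given by a string. -/
noncomputable def egGen {n : ℕ} {Δ : SimplexCategoryᵒᵖ}
    (s : ComposableArrows (EG (Equiv.Perm (Fin n))) Δ.unop.len) :
    ((barrattEccles k).ar n).obj Δ :=
  Finsupp.single s (1 : k)

variable {k}

theorem relabel_egGen {n m : ℕ} (e : Fin n ≃ Fin m) {Δ : SimplexCategoryᵒᵖ}
    (s : ComposableArrows (EG (Equiv.Perm (Fin m))) Δ.unop.len) :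
    (barrattEccles k).relabel e Δ (egGen k s) = egGen k (Δ := Δ) (s ⋙ egPull e) :=
  Finsupp.mapDomain_single

theorem map_egGen {n : ℕ} {Δ Δ' : SimplexCategoryᵒᵖ} (θ : Δ ⟶ Δ')
    (s : ComposableArrows (EG (Equiv.Perm (Fin n))) Δ.unop.len) :
    (((barrattEccles k).ar n).map θ).hom (egGen k s) = egGen k (pull θ s) :=
  Finsupp.mapDomain_single

theorem freeNerveOp_single {m : ℕ} {E D : Type} {C : Fin m → Type} [SmallCategory E]
    [SmallCategory D] [∀ i, SmallCategory (C i)] (Φ : (E × ∀ i, C i) ⥤ D) (p : ℕ)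
    (s : ComposableArrows E p) (t : ∀ i, ComposableArrows (C i) p) :
    freeNerveOp k Φ p (Finsupp.single s 1) (fun i => Finsupp.single (t i) 1) =
      Finsupp.single (nerveOp Φ s t) 1 := by
  rw [freeNerveOp, Finsupp.linearCombination_single, one_smul, multExt_single]

theorem comp_egGen {m : ℕ} (j : Fin m → ℕ) {Δ : SimplexCategoryᵒᵖ}
    (s : ComposableArrows (EG (Equiv.Perm (Fin m))) Δ.unop.len)
    (t : ∀ i, ComposableArrows (EG (Equiv.Perm (Fin (j i)))) Δ.unop.len) :
    (barrattEccles k).comp j Δ (egGen k s) (fun i => egGen k (t i)) =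
      egGen k (Δ := Δ) (nerveOp (barrattEcclesComp j) s t) :=
  freeNerveOp_single _ _ _ _

theorem nerveOp_barrattEcclesComp_obj_as {m : ℕ} (j : Fin m → ℕ) {p : ℕ}
    (s : ComposableArrows (EG (Equiv.Perm (Fin m))) p)
    (t : ∀ i, ComposableArrows (EG (Equiv.Perm (Fin (j i)))) p) (q : Fin (p + 1)) :
    ((nerveOp (barrattEcclesComp j) s t).obj q).as =
      operadPerm j (s.obj q).as fun i => ((t i).obj q).as := rfl

theorem egGen_lin_ext {n : ℕ} {Δ : SimplexCategoryᵒᵖ} {N : Type*} [AddCommGroup N] [Module k N]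
    {f g : ((barrattEccles k).ar n).obj Δ →ₗ[k] N} (h : ∀ s, f (egGen k s) = g (egGen k s)) :
    f = g :=
  Finsupp.lhom_ext' fun s => LinearMap.ext_ring (h s)

theorem egGen_multilinear_ext {ι : Type*} [Finite ι] {n : ι → ℕ} {Δ : SimplexCategoryᵒᵖ}
    {N : Type*} [AddCommGroup N] [Module k N]
    {f g : MultilinearMap k (fun i => (((barrattEccles k).ar (n i)).obj Δ : Type u)) N}
    (h : ∀ s : ∀ i, ComposableArrows (EG (Equiv.Perm (Fin (n i)))) Δ.unop.len,
      f (fun i => egGen k (s i)) = g (fun i => egGen k (s i))) : f = g :=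
  multilinear_finsupp_ext (Y := fun i => ComposableArrows (EG (Equiv.Perm (Fin (n i)))) Δ.unop.len) h

theorem egPull_comp_one {n : ℕ} (τ : Equiv.Perm (Fin n)) (h : ∑ _ : Fin 1, n = n) :
    operadPerm (fun _ : Fin 1 => n) 1 (fun _ => τ) =
      ((finCongr h).trans τ).trans (finCongr (card_eq_of_equiv (finCongr h)).symm) := by
  refine equiv_ext_lt fun x y => ?_
  obtain ⟨⟨i, a⟩, rfl⟩ := finSigmaFinEquiv.surjective x
  obtain ⟨⟨i', b⟩, rfl⟩ := finSigmaFinEquiv.surjective y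
  obtain rfl : i = i' := Subsingleton.elim _ _
  rw [operadPerm_lt]
  simp only [Equiv.trans_apply]
  rw [finCongr_sigma_one, finCongr_sigma_one]
  simp

theorem operadPerm_const_one {m : ℕ} (σ : Equiv.Perm (Fin m)) (h : ∑ _ : Fin m, 1 = m) :
    operadPerm (fun _ : Fin m => 1) σ (fun _ => 1) =
      ((finCongr h).trans σ).trans (finCongr (card_eq_of_equiv (finCongr h)).symm) := by
  refine equiv_ext_lt fun x y => ?_
  obtain ⟨⟨i, a⟩, rfl⟩ := finSigmaFinEquiv.surjective x
  obtain ⟨⟨i', b⟩, rfl⟩ := finSigmaFinEquiv.surjective y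
  rw [operadPerm_lt]
  simp only [Equiv.trans_apply]
  rw [finCongr_sigma_const_one, finCongr_sigma_const_one]
  simp

/-- Both sides order triples lexicographically, by `σ`, then `τ`, then `υ`; only the bracketing of
the three comparisons differs. -/
theorem operadPerm_assoc {m : ℕ} (j : Fin m → ℕ) (l : ∀ i, Fin (j i) → ℕ)
    (σ : Equiv.Perm (Fin m)) (τ : ∀ i, Equiv.Perm (Fin (j i)))
    (υ : ∀ i s, Equiv.Perm (Fin (l i s))) :
    operadPerm (fun t : Fin (∑ i, j i) => l (finSigmaFinEquiv.symm t).1 (finSigmaFinEquiv.symm t).2)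
        (operadPerm j σ τ) (fun t => υ (finSigmaFinEquiv.symm t).1 (finSigmaFinEquiv.symm t).2) =
      ((finCongr (sum_sum_eq j l)).trans
        (operadPerm (fun i => ∑ s, l i s) σ fun i => operadPerm (l i) (τ i) (υ i))).trans
          (finCongr (card_eq_of_equiv (finCongr (sum_sum_eq j l))).symm) := by
  refine equiv_ext_lt fun x y => ?_
  obtain ⟨⟨t, a⟩, rfl⟩ := finSigmaFinEquiv.surjective x
  obtain ⟨⟨t', b⟩, rfl⟩ := finSigmaFinEquiv.surjective y
  rw [operadPerm_lt]
  simp only [Equiv.trans_apply]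
  rw [finCongr_sigma_sigma, finCongr_sigma_sigma, finCongr_apply, finCongr_apply, Fin.cast_lt_cast,
    operadPerm_lt]
  dsimp only
  have h1 := operadPerm_lt j σ τ (finSigmaFinEquiv.symm t) (finSigmaFinEquiv.symm t')
  rw [Equiv.apply_symm_apply, Equiv.apply_symm_apply] at h1
  have h2 : t = t' ↔ finSigmaFinEquiv.symm t = finSigmaFinEquiv.symm t' := by simp
  rw [h1, h2]
  -- Replacing the two index pairs by variables allows equal first components to be identified in
  -- the types of the remaining data.
  suffices h : ∀ (u v : (i : Fin m) × Fin (j i)) (a : Fin (l u.1 u.2)) (b : Fin (l v.1 v.2)),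
      ((σ u.1 < σ v.1 ∨ u.1 = v.1 ∧ (τ u.1 u.2 : ℕ) < (τ v.1 v.2 : ℕ)) ∨
        u = v ∧ (υ u.1 u.2 a : ℕ) < (υ v.1 v.2 b : ℕ)) ↔ (σ u.1 < σ v.1 ∨ u.1 = v.1 ∧
          (operadPerm (l u.1) (τ u.1) (υ u.1) (finSigmaFinEquiv ⟨u.2, a⟩) : ℕ) <
            (operadPerm (l v.1) (τ v.1) (υ v.1) (finSigmaFinEquiv ⟨v.2, b⟩) : ℕ)) from h _ _ a b
  rintro ⟨u1, u2⟩ ⟨v1, v2⟩ a b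
  by_cases h : u1 = v1
  · subst h
    simp only [lt_irrefl, false_or, true_and, ← Fin.lt_def, operadPerm_lt, Sigma.mk.injEq,
      heq_eq_eq]
  · simp [h]

/-- Block `i` is first moved to position `σ' i`, where the reindexed family carries `τ i` again;
then `σ` compares the positions. -/
theorem operadPerm_mul {m : ℕ} (j : Fin m → ℕ) (σ σ' : Equiv.Perm (Fin m))
    (τ : ∀ i, Equiv.Perm (Fin (j i))) :
    operadPerm j (σ'.trans σ) τ = ((blockPerm σ' j).trans
      (operadPerm (fun i => j (σ'.symm i)) σ fun i => τ (σ'.symm i))).trans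
        (finCongr (card_eq_of_equiv (blockPerm σ' j)).symm) := by
  refine equiv_ext_lt fun x y => ?_
  obtain ⟨⟨i, a⟩, rfl⟩ := finSigmaFinEquiv.surjective x
  obtain ⟨⟨i', b⟩, rfl⟩ := finSigmaFinEquiv.surjective y
  rw [operadPerm_lt]
  simp only [Equiv.trans_apply]
  rw [blockPerm_apply, blockPerm_apply, finCongr_apply, finCongr_apply, Fin.cast_lt_cast,
    operadPerm_lt]
  -- The index `σ'.symm (σ' i)` equals `i` only propositionally, so the entry is cast; in `ℕ` the
  -- cast disappears.
  have h : ∀ i i' (h : i' = i) (a : Fin (j i)), ((τ i' (Fin.cast (by rw [h]) a) : Fin _) : ℕ) =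
      τ i a := by
    rintro i _ rfl a
    rfl
  rw [h _ _ (Equiv.symm_apply_apply _ _), h _ _ (Equiv.symm_apply_apply _ _)]
  simp

theorem operadPerm_inner {m : ℕ} (j : Fin m → ℕ) (σ : Equiv.Perm (Fin m))
    (τ ρ : ∀ i, Equiv.Perm (Fin (j i))) :
    operadPerm j σ (fun i => (ρ i).trans (τ i)) =
      (finSigmaFinEquiv.permCongr (Equiv.sigmaCongrRight ρ)).trans (operadPerm j σ τ) := by
  refine equiv_ext_lt fun x y => ?_
  obtain ⟨⟨i, a⟩, rfl⟩ := finSigmaFinEquiv.surjective x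
  obtain ⟨⟨i', b⟩, rfl⟩ := finSigmaFinEquiv.surjective y
  rw [operadPerm_lt]
  simp only [Equiv.trans_apply, Equiv.permCongr_apply, Equiv.symm_apply_apply,
    Equiv.sigmaCongrRight_apply, operadPerm_lt]

end BarrattEccles

end HyperHom

/-! ### The operad axioms for the Barratt-Eccles operad. -/

namespace HyperHom

section BarrattEcclesOperad

variable {k : Type u} [CommRing k]

instance (p : ℕ) : Unique (ComposableArrows (EG (Equiv.Perm (Fin 0))) p) where
  default := (Functor.const _).obj (Codiscrete.mk 1)
  uniq _ := egString_ext fun _ => Subsingleton.elim _ _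

variable (k) in
/-- The arity zero component of the Barratt-Eccles operad is the monoidal unit. -/
noncomputable def barrattEcclesZeroIso : (barrattEccles k).ar 0 ≅
    (SimplicialObject.const _).obj (ModuleCat.of k k) :=
  NatIso.ofComponents (fun Δ => LinearEquiv.toModuleIso
    (Finsupp.uniqueLinearEquiv k
      (α := ComposableArrows (EG (Equiv.Perm (Fin 0))) Δ.unop.len) k default)) (by
    intro Δ Δ' θ
    apply ModuleCat.hom_ext
    apply egGen_lin_ext
    intro s
    refine (congrArg (Finsupp.uniqueLinearEquiv k
      (α := ComposableArrows (EG (Equiv.Perm (Fin 0))) Δ'.unop.len) k default) (map_egGen θ s)).trans ?_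
    have h : ∀ (p : ℕ) (s : ComposableArrows (EG (Equiv.Perm (Fin 0))) p),
        Finsupp.uniqueLinearEquiv k k default (Finsupp.single s (1 : k)) = 1 := by
      intro p s
      rw [Subsingleton.elim s default]
      simp
    exact (h _ _).trans (h _ _).symm)

/-- On strings the composition is postcomposition with a functor, while simplicial operators act by
precomposition, so the two commute. -/
theorem barrattEccles_comp_naturality {m : ℕ} (j : Fin m → ℕ) {Δ Δ' : SimplexCategoryᵒᵖ}
    (θ : Δ ⟶ Δ') (a : ((barrattEccles k).ar m).obj Δ) (b : ∀ i, ((barrattEccles k).ar (j i)).obj Δ) :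
    (((barrattEccles k).ar (∑ i, j i)).map θ).hom ((barrattEccles k).comp j Δ a b) =
      (barrattEccles k).comp j Δ' ((((barrattEccles k).ar m).map θ).hom a)
        fun i => (((barrattEccles k).ar (j i)).map θ).hom (b i) := by
  suffices h : (LinearMap.compMultilinearMapₗ k
      (((barrattEccles k).ar (∑ i, j i)).map θ).hom) ∘ₗ (barrattEccles k).comp j Δ =
      MultilinearMap.compLinearMapₗ (fun i => (((barrattEccles k).ar (j i)).map θ).hom) ∘ₗ
        (barrattEccles k).comp j Δ' ∘ₗ (((barrattEccles k).ar m).map θ).hom from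
    congrArg (fun f => f b) (LinearMap.congr_fun h a)
  refine egGen_lin_ext fun s => egGen_multilinear_ext fun t => ?_
  refine (congrArg (((barrattEccles k).ar (∑ i, j i)).map θ).hom (comp_egGen j s t)).trans
    ((map_egGen θ _).trans (Eq.symm ?_))
  refine Eq.trans ?_ (comp_egGen j (pull θ s) fun i => pull θ (t i))
  exact congrArg₂ (fun a b => (barrattEccles k).comp j Δ' a b) (map_egGen θ s)
    (funext fun i => map_egGen θ (t i))

theorem one_comp_egGen (n : ℕ) {Δ : SimplexCategoryᵒᵖ} (h : ∑ _ : Fin 1, n = n)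
    (t : ComposableArrows (EG (Equiv.Perm (Fin n))) Δ.unop.len) :
    (barrattEccles k).comp (fun _ : Fin 1 => n) Δ ((barrattEccles k).one Δ)
      (fun _ => egGen k t) = (barrattEccles k).relabel (finCongr h) Δ (egGen k t) := by
  refine (comp_egGen (Δ := Δ) (fun _ : Fin 1 => n) ((Functor.const (Fin (Δ.unop.len + 1))).obj
      (Codiscrete.mk (1 : Equiv.Perm (Fin 1)))) (fun _ => t)).trans
    (Eq.trans ?_ (relabel_egGen (finCongr h) t).symm)
  have e : nerveOp (barrattEcclesComp fun _ : Fin 1 => n)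
      ((Functor.const (Fin (Δ.unop.len + 1))).obj (Codiscrete.mk (1 : Equiv.Perm (Fin 1))))
      (fun _ => t) = (t ⋙ egPull (finCongr h)) := egString_ext fun q =>
    (nerveOp_barrattEcclesComp_obj_as (fun _ : Fin 1 => n) _ _ q).trans
      (egPull_comp_one (t.obj q).as h)
  exact congrArg (egGen k) e

theorem barrattEccles_one_comp (n : ℕ) (Δ : SimplexCategoryᵒᵖ) (h : ∑ _ : Fin 1, n = n)
    (b : ((barrattEccles k).ar n).obj Δ) :
    (barrattEccles k).comp (fun _ : Fin 1 => n) Δ ((barrattEccles k).one Δ) (fun _ => b) =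
      (barrattEccles k).relabel (finCongr h) Δ b := by
  suffices e : (MultilinearMap.ofSubsingleton k (((barrattEccles k).ar n).obj Δ : Type u)
      (((barrattEccles k).ar (∑ _ : Fin 1, n)).obj Δ : Type u)
      (0 : Fin 1)).symm ((barrattEccles k).comp (fun _ : Fin 1 => n) Δ
      ((barrattEccles k).one Δ)) = (barrattEccles k).relabel (finCongr h) Δ from
    LinearMap.congr_fun e b
  exact egGen_lin_ext fun t => one_comp_egGen n h t

theorem barrattEccles_comp_one (m : ℕ) (Δ : SimplexCategoryᵒᵖ)
    (a : ((barrattEccles k).ar m).obj Δ) :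
    (barrattEccles k).comp (fun _ : Fin m => 1) Δ a (fun _ => (barrattEccles k).one Δ) =
      (barrattEccles k).relabel (finCongr (by simp)) Δ a := by
  suffices h : multEval ((barrattEccles k).comp (fun _ : Fin m => 1) Δ)
      (fun _ => (barrattEccles k).one Δ) = (barrattEccles k).relabel
        (finCongr ((by simp : ∑ _ : Fin m, 1 = m))) Δ from
    LinearMap.congr_fun h a
  refine egGen_lin_ext fun s => ?_
  refine (comp_egGen (fun _ : Fin m => 1) s _).trans (Eq.trans ?_ (relabel_egGen _ s).symm)
  exact congrArg (egGen k) (egString_ext fun q => operadPerm_const_one _ _)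

/-- Both sides are multilinear in `c`, then in `b`, and linear in `a`; the three are reduced to
strings in this order. The family `c` is reindexed by pairs because the left side lists it by
positions in the total sum. What remains is `operadPerm_assoc` at each vertex. -/
theorem barrattEccles_assoc {m : ℕ} (j : Fin m → ℕ) (l : ∀ i, Fin (j i) → ℕ)
    (Δ : SimplexCategoryᵒᵖ) (a : ((barrattEccles k).ar m).obj Δ)
    (b : ∀ i, ((barrattEccles k).ar (j i)).obj Δ)
    (c : ∀ i s, ((barrattEccles k).ar (l i s)).obj Δ) :
    (barrattEccles k).comp
        (fun t : Fin (∑ i, j i) => l (finSigmaFinEquiv.symm t).1 (finSigmaFinEquiv.symm t).2) Δ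
        ((barrattEccles k).comp j Δ a b)
        (fun t => c (finSigmaFinEquiv.symm t).1 (finSigmaFinEquiv.symm t).2) =
      (barrattEccles k).relabel (finCongr (sum_sum_eq j l)) Δ
        ((barrattEccles k).comp (fun i => ∑ s, l i s) Δ a
          fun i => (barrattEccles k).comp (l i) Δ (b i) (c i)) := by
  suffices h : multReindex finSigmaFinEquiv.symm
      (M := fun x : (i : Fin m) × Fin (j i) => ((barrattEccles k).ar (l x.1 x.2)).obj Δ)
      ((barrattEccles k).comp (fun t : Fin (∑ i, j i) =>
        l (finSigmaFinEquiv.symm t).1 (finSigmaFinEquiv.symm t).2) Δ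
        ((barrattEccles k).comp j Δ a b)) =
      ((barrattEccles k).relabel (finCongr (sum_sum_eq j l)) Δ).compMultilinearMap
        (((barrattEccles k).comp (fun i => ∑ s, l i s) Δ a).compMultilinearMap
          fun i => (barrattEccles k).comp (l i) Δ (b i)) from congrArg (fun f => f fun x => c x.1 x.2) h
  refine egGen_multilinear_ext fun υ => ?_
  suffices h : (multEval ((barrattEccles k).comp (fun t : Fin (∑ i, j i) =>
        l (finSigmaFinEquiv.symm t).1 (finSigmaFinEquiv.symm t).2) Δ)
        (fun t => egGen k (υ (finSigmaFinEquiv.symm t)))).compMultilinearMap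
        ((barrattEccles k).comp j Δ a) =
      ((barrattEccles k).relabel (finCongr (sum_sum_eq j l)) Δ).compMultilinearMap
        (((barrattEccles k).comp (fun i => ∑ s, l i s) Δ a).compLinearMap fun i =>
          multEval ((barrattEccles k).comp (l i) Δ) fun s => egGen k (υ ⟨i, s⟩)) from
    congrArg (fun f => f b) h
  refine egGen_multilinear_ext fun t => ?_
  suffices h : (multEval ((barrattEccles k).comp (fun t : Fin (∑ i, j i) =>
        l (finSigmaFinEquiv.symm t).1 (finSigmaFinEquiv.symm t).2) Δ)
        (fun t => egGen k (υ (finSigmaFinEquiv.symm t)))) ∘ₗ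
        multEval ((barrattEccles k).comp j Δ) (fun i => egGen k (t i)) =
      ((barrattEccles k).relabel (finCongr (sum_sum_eq j l)) Δ) ∘ₗ
        multEval ((barrattEccles k).comp (fun i => ∑ s, l i s) Δ) (fun i =>
          (barrattEccles k).comp (l i) Δ (egGen k (t i)) fun s => egGen k (υ ⟨i, s⟩)) from
    LinearMap.congr_fun h a
  refine egGen_lin_ext fun s => ?_
  refine (congrArg (multEval ((barrattEccles k).comp (fun t : Fin (∑ i, j i) =>
        l (finSigmaFinEquiv.symm t).1 (finSigmaFinEquiv.symm t).2) Δ)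
        (fun t => egGen k (υ (finSigmaFinEquiv.symm t)))) (comp_egGen j s t)).trans
    ((comp_egGen (fun t : Fin (∑ i, j i) =>
        l (finSigmaFinEquiv.symm t).1 (finSigmaFinEquiv.symm t).2) _ _).trans (Eq.symm ?_))
  refine (congrArg (fun b => (barrattEccles k).relabel (finCongr (sum_sum_eq j l)) Δ
    ((barrattEccles k).comp (fun i => ∑ s, l i s) Δ (egGen k s) b))
      (funext fun i => comp_egGen (l i) (t i) fun s => υ ⟨i, s⟩)).trans ?_
  refine (congrArg ((barrattEccles k).relabel (finCongr (sum_sum_eq j l)) Δ)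
    (comp_egGen (fun i => ∑ s, l i s) s _)).trans
    ((relabel_egGen _ _).trans (congrArg (egGen k) (egString_ext fun q => Eq.symm ?_)))
  exact operadPerm_assoc j l _ _ fun i s => ((υ ⟨i, s⟩).obj q).as

theorem barrattEccles_equivariance_outer {m : ℕ} (j : Fin m → ℕ) (σ : Equiv.Perm (Fin m))
    (Δ : SimplexCategoryᵒᵖ) (a : ((barrattEccles k).ar m).obj Δ)
    (b : ∀ i, ((barrattEccles k).ar (j i)).obj Δ) :
    (barrattEccles k).comp j Δ ((barrattEccles k).relabel σ Δ a) b =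
      (barrattEccles k).relabel (blockPerm σ j) Δ
        ((barrattEccles k).comp (fun i => j (σ.symm i)) Δ a fun i => b (σ.symm i)) := by
  suffices h : (barrattEccles k).comp j Δ ((barrattEccles k).relabel σ Δ a) =
      ((barrattEccles k).relabel (blockPerm σ j) Δ).compMultilinearMap
        (multReindex σ.symm (M := fun i => ((barrattEccles k).ar (j i)).obj Δ)
          ((barrattEccles k).comp (fun i => j (σ.symm i)) Δ a)) from
    congrArg (fun f => f b) h
  refine egGen_multilinear_ext fun t => ?_
  suffices h : multEval ((barrattEccles k).comp j Δ) (fun i => egGen k (t i)) ∘ₗ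
      (barrattEccles k).relabel σ Δ = (barrattEccles k).relabel (blockPerm σ j) Δ ∘ₗ
        multEval ((barrattEccles k).comp (fun i => j (σ.symm i)) Δ)
          (fun i => egGen k (t (σ.symm i))) from LinearMap.congr_fun h a
  refine egGen_lin_ext fun s => ?_
  refine (congrArg (fun a => (barrattEccles k).comp j Δ a fun i => egGen k (t i))
    (relabel_egGen σ s)).trans ((comp_egGen j _ t).trans (Eq.symm ?_))
  refine (congrArg ((barrattEccles k).relabel (blockPerm σ j) Δ) (comp_egGen (fun i => j (σ.symm i)) s fun i => t (σ.symm i))).trans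
    ((relabel_egGen _ _).trans (congrArg (egGen k) (egString_ext fun q => Eq.symm ?_)))
  exact operadPerm_mul j _ σ _

theorem barrattEccles_equivariance_inner {m : ℕ} (j : Fin m → ℕ)
    (ρ : ∀ i, Equiv.Perm (Fin (j i))) (Δ : SimplexCategoryᵒᵖ)
    (a : ((barrattEccles k).ar m).obj Δ) (b : ∀ i, ((barrattEccles k).ar (j i)).obj Δ) :
    (barrattEccles k).comp j Δ a (fun i => (barrattEccles k).relabel (ρ i) Δ (b i)) =
      (barrattEccles k).relabel (finSigmaFinEquiv.permCongr (Equiv.sigmaCongrRight ρ)) Δ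
        ((barrattEccles k).comp j Δ a b) := by
  suffices h : ((barrattEccles k).comp j Δ a).compLinearMap
      (fun i => (barrattEccles k).relabel (ρ i) Δ) =
      ((barrattEccles k).relabel (finSigmaFinEquiv.permCongr (Equiv.sigmaCongrRight ρ))
        Δ).compMultilinearMap ((barrattEccles k).comp j Δ a) from congrArg (fun f => f b) h
  refine egGen_multilinear_ext fun t => ?_
  suffices h : multEval ((barrattEccles k).comp j Δ)
      (fun i => (barrattEccles k).relabel (ρ i) Δ (egGen k (t i))) =
      (barrattEccles k).relabel (finSigmaFinEquiv.permCongr (Equiv.sigmaCongrRight ρ)) Δ ∘ₗ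
        multEval ((barrattEccles k).comp j Δ) (fun i => egGen k (t i)) from
    LinearMap.congr_fun h a
  refine egGen_lin_ext fun s => ?_
  refine (congrArg (fun b => (barrattEccles k).comp j Δ (egGen k s) b)
    (funext fun i => relabel_egGen (ρ i) (t i))).trans ((comp_egGen j s _).trans (Eq.symm ?_))
  refine (congrArg ((barrattEccles k).relabel _ Δ) (comp_egGen j s t)).trans
    ((relabel_egGen _ _).trans (congrArg (egGen k) (egString_ext fun q => Eq.symm ?_)))
  exact operadPerm_inner j _ _ ρ

end BarrattEcclesOperad

end HyperHom

/-! ### Contractibility and freeness of the Barratt-Eccles operad. -/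

namespace HyperHom

section Contractible

open Simplicial AlgebraicTopology

variable (X : Type)

/-- The nerve of `𝔼X`, augmented over the point. -/
def egAugmented : SimplicialObject.Augmented Type where
  left := nerve (EG X)
  right := PUnit
  hom := { app := fun _ => ↾fun _ => PUnit.unit, naturality := fun _ _ _ => rfl }

variable {X}

/-- The string `x ⟶ x₀ ⟶ ⋯ ⟶ x_p`. -/
def egCons (x : X) {p : ℕ} (s : ComposableArrows (EG X) p) : ComposableArrows (EG X) (p + 1) :=
  s.precomp (X := Codiscrete.mk x) default

theorem pull_shiftHom_egCons (x : X) {m n : ℕ} (θ : ⦋m⦌ ⟶ ⦋n⦌) (θ' : ⦋m + 1⦌ ⟶ ⦋n + 1⦌)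
    (h : shiftHom θ = θ') (s : ComposableArrows (EG X) n) :
    pull (Δ := op ⦋n + 1⦌) (Δ' := op ⦋m + 1⦌) θ'.op (egCons x s) =
      egCons x (pull (Δ := op ⦋n⦌) (Δ' := op ⦋m⦌) θ.op s) := by
  subst h
  refine egString_ext fun q => ?_
  induction q using Fin.cases <;> rfl

/-- The extra degeneracy of the nerve of `𝔼X` given by a point. -/
def egExtraDegeneracy (x : X) : SimplicialObject.Augmented.ExtraDegeneracy (egAugmented X) where
  s' := ↾fun _ => ComposableArrows.mk₀ (Codiscrete.mk x)
  s n := ↾fun s => egCons x s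
  s'_comp_ε := rfl
  s₀_comp_δ₁ := by
    ext s
    exact egString_ext fun q => by fin_cases q; rfl
  s_comp_δ₀ n := by
    ext s
    exact egString_ext fun q => rfl
  s_comp_δ n i := by
    ext s
    exact pull_shiftHom_egCons x _ _ (shiftHom_δ i) s
  s_comp_σ n i := by
    ext s
    exact pull_shiftHom_egCons x _ _ (shiftHom_σ i) s

end Contractible

section WeakEquivalences

open Simplicial AlgebraicTopology OperadData

variable {k : Type u} [CommRing k]

/-- An augmented simplicial module with an extra degeneracy is weakly equivalent to its base. -/
theorem isWeakEquiv_hom (Z : SimplicialObject.Augmented (ModuleCat.{u} k))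
    (ed : SimplicialObject.Augmented.ExtraDegeneracy Z) :
    IsWeakEquiv (Y := (SimplicialObject.const _).obj Z.right) Z.hom := by
  -- The complex of a constant object is not concentrated in degree zero, so it has to be contracted
  -- as well. Both `W` and `Z` are equivalent to the complex with `Z.right` in degree zero, and
  -- two-out-of-three gives the claim.
  let W : SimplicialObject.Augmented (ModuleCat.{u} k) :=
    { left := (SimplicialObject.const _).obj Z.right, right := Z.right, hom := 𝟙 _ }
  let ed' : SimplicialObject.Augmented.ExtraDegeneracy W :=
    { s' := 𝟙 _, s := fun _ => 𝟙 _, s'_comp_ε := Category.id_comp _, s₀_comp_δ₁ := rfl,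
      s_comp_δ₀ := fun _ => Category.id_comp _, s_comp_δ := fun _ _ => rfl,
      s_comp_σ := fun _ _ => rfl }
  let f : Z ⟶ W := { left := Z.hom, right := 𝟙 _ }
  have h : (alternatingFaceMapComplex _).map Z.hom ≫ AlternatingFaceMapComplex.ε.app W =
      AlternatingFaceMapComplex.ε.app Z :=
    (AlternatingFaceMapComplex.ε.naturality f).trans
      ((congrArg (_ ≫ ·) (CategoryTheory.Functor.map_id _ _)).trans (Category.comp_id _))
  have h1 : QuasiIso (AlternatingFaceMapComplex.ε.app W) := ed'.homotopyEquiv.quasiIso_hom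
  have h2 : QuasiIso (AlternatingFaceMapComplex.ε.app Z) := ed.homotopyEquiv.quasiIso_hom
  exact (quasiIso_iff_comp_right _ (AlternatingFaceMapComplex.ε.app W)).1 (h.symm ▸ h2)

theorem isWeakEquiv_of_isIso {X Y : SimplicialObject (ModuleCat.{u} k)} (e : X ≅ Y) :
    IsWeakEquiv e.hom :=
  inferInstanceAs (QuasiIso ((alternatingFaceMapComplex (ModuleCat.{u} k)).mapIso e).hom)

/-- The nerve of `𝔼Σ_n` contracts onto the vertex `1`, and the free module functor preserves the
extra degeneracy. The second link of the zigzag identifies `k[pt]` with `k`. -/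
theorem barrattEccles_contractible (n : ℕ) : WeaklyEquivalent ((barrattEccles k).ar n)
    ((SimplicialObject.const _).obj (ModuleCat.of k k)) := by
  let e : (freeModule k).obj PUnit.{1} ≅ ModuleCat.of k k :=
    LinearEquiv.toModuleIso (Finsupp.uniqueLinearEquiv k k PUnit.unit)
  have h := isWeakEquiv_hom _ ((egExtraDegeneracy (1 : Equiv.Perm (Fin n))).map (freeModule k))
  exact (Relation.EqvGen.rel _ _ ⟨_, h⟩).trans _ _ _
    (Relation.EqvGen.rel _ _ ⟨_, isWeakEquiv_of_isIso ((SimplicialObject.const _).mapIso e)⟩)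

/-- The strings of `𝔼G` are the translates of those that start at the unit. -/
def egStringEquiv (G : Type) [Group G] (p : ℕ) :
    {f : Fin (p + 1) → G // f 0 = 1} × G ≃ ComposableArrows (EG G) p where
  toFun x := (Codiscrete.equivFun (n := p)).symm fun q => x.1.1 q * x.2
  invFun s := (⟨fun q => (s.obj q).as * (s.obj 0).as⁻¹, mul_inv_cancel _⟩, (s.obj 0).as)
  left_inv x := by
    obtain ⟨⟨f, hf⟩, g⟩ := x
    refine Prod.ext (Subtype.ext (funext fun q => ?_)) ?_
    · exact (by rw [hf]; group : f q * g * (f 0 * g)⁻¹ = f q)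
    · exact (by rw [hf, one_mul] : f 0 * g = g)
  right_inv s := egString_ext fun q => inv_mul_cancel_right _ _

/-- The strings are a basis. Writing each as a translate by its first vertex of a string that starts
at `1`, right multiplication changes only the translating element. The index set is lifted to the
universe of `k`. -/
theorem barrattEccles_free (n : ℕ) (Δ : SimplexCategoryᵒᵖ) : ∃ (ι : Type u)
    (b : Module.Basis (ι × Equiv.Perm (Fin n)) k (((barrattEccles k).ar n).obj Δ)),
    ∀ (i : ι) (g h : Equiv.Perm (Fin n)),
      (barrattEccles k).relabel h Δ (b (i, g)) = b (i, g * h) := by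
  let E := (Equiv.prodCongr Equiv.ulift.{u} (Equiv.refl _)).trans
    (egStringEquiv (Equiv.Perm (Fin n)) Δ.unop.len)
  let b : Module.Basis _ k (((barrattEccles k).ar n).obj Δ) :=
    (Finsupp.basisSingleOne (R := k)).reindex E.symm
  have hb : ∀ x, b x = egGen k (E x) := fun x => by
    refine (Module.Basis.reindex_apply (Finsupp.basisSingleOne (R := k)) E.symm x).trans ?_
    rw [Finsupp.coe_basisSingleOne, Equiv.symm_symm]
    rfl
  refine ⟨_, b, fun i g h => ?_⟩
  rw [hb, hb]
  refine (relabel_egGen h _).trans (congrArg (egGen k) (egString_ext fun q => ?_))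
  exact mul_assoc _ _ _

theorem barrattEccles_isOperad : (barrattEccles k).IsOperad where
  zero := ⟨barrattEcclesZeroIso k⟩
  one_naturality θ := (map_egGen θ _).trans (congrArg (egGen k) (egString_ext fun _ => rfl))
  comp_naturality := barrattEccles_comp_naturality
  one_comp n Δ b := barrattEccles_one_comp n Δ _ b
  comp_one := barrattEccles_comp_one
  assoc := barrattEccles_assoc
  equivariance_outer := barrattEccles_equivariance_outer
  equivariance_inner := barrattEccles_equivariance_inner

theorem barrattEccles_isEInfinity : (barrattEccles k).IsEInfinity where
  toIsOperad := barrattEccles_isOperad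
  contractible := barrattEccles_contractible
  free := barrattEccles_free

end WeakEquivalences

end HyperHom

/-! ### Multilinear maps defined on generators modulo relations. -/

namespace HyperHom

section MultilinearDescent

variable {k : Type*} [CommRing k] {m : ℕ} {κ X N : Type*} [AddCommGroup X] [Module k X]
  [AddCommGroup N] [Module k N]

open Classical in
variable (k) in
/-- The multilinear extension to free modules of a map of generators. -/
noncomputable def multFree (F : (Fin m → κ) → N) :
    MultilinearMap k (fun _ : Fin m => (κ →₀ k)) N :=
  ((Finsupp.linearCombination k F) ∘ₗ
    (PiTensorProduct.ofFinsuppEquiv' (R := k) (κ := fun _ : Fin m => κ)).toLinearMap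
      ).compMultilinearMap (PiTensorProduct.tprod k)

theorem multFree_single (F : (Fin m → κ) → N) (y : Fin m → κ) :
    multFree k F (fun i => Finsupp.single (y i) 1) = F y := by
  classical
  simp [multFree]

open Classical in
/-- A multilinear map that vanishes whenever an argument is in the kernel of `π` takes equal values
on arguments with equal images. -/
theorem multilinear_congr_of_ker {M : Type*} [AddCommGroup M] [Module k M] (π : M →ₗ[k] X)
    (f : MultilinearMap k (fun _ : Fin m => M) N)
    (h : ∀ v i z, π z = 0 → f (Function.update v i z) = 0) (v w : Fin m → M)
    (hvw : ∀ i, π (v i) = π (w i)) : f v = f w := by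
  -- The arguments are exchanged one at a time; `s` collects the indices already exchanged.
  suffices hs : ∀ s : Finset (Fin m), f (s.piecewise w v) = f v by
    rw [← hs Finset.univ, Finset.piecewise_univ]
  intro s
  induction s using Finset.induction_on with
  | empty => rw [Finset.piecewise_empty]
  | insert i s hi ih =>
    rw [Finset.piecewise_insert, ← sub_eq_zero, ← ih]
    nth_rewrite 2 [← Function.update_eq_self i (s.piecewise w v)]
    rw [← f.map_update_sub]
    apply h
    rw [Finset.piecewise_eq_of_notMem _ _ _ hi, map_sub, hvw, sub_self]

open Classical in
/-- Multilinear maps descend along a surjection. -/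
theorem exists_multilinear_of_ker {M : Type*} [AddCommGroup M] [Module k M] (π : M →ₗ[k] X)
    (hπ : Function.Surjective π) (f : MultilinearMap k (fun _ : Fin m => M) N)
    (h : ∀ v i z, π z = 0 → f (Function.update v i z) = 0) :
    ∃ g : MultilinearMap k (fun _ : Fin m => X) N, ∀ v, g (fun i => π (v i)) = f v := by
  have hs : ∀ x, π (Function.surjInv hπ x) = x := Function.surjInv_eq hπ
  have hc := multilinear_congr_of_ker π f h
  -- Any preimage `w` of the new argument may stand in for the chosen one. Additivity follows by
  -- taking for `w` a sum of chosen preimages, which need not itself be a chosen preimage.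
  have e : ∀ (x : Fin m → X) i z w, π w = z →
      (f fun j => Function.surjInv hπ (Function.update x i z j)) =
        f (Function.update (fun j => Function.surjInv hπ (x j)) i w) := by
    intro x i z w hw
    refine hc _ _ fun j => ?_
    rw [hs]
    by_cases hj : j = i
    · subst hj
      rw [Function.update_self, Function.update_self, hw]
    · rw [Function.update_of_ne hj, Function.update_of_ne hj, hs]
  refine ⟨{ toFun := fun x => f fun i => Function.surjInv hπ (x i)
            map_update_add' := ?_
            map_update_smul' := ?_ }, fun v => hc _ _ fun i => hs _⟩
  · intro inst x i a b
    obtain rfl : inst = instDecidableEqFin m := Subsingleton.elim _ _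
    exact (e x i (a + b) (Function.surjInv hπ a + Function.surjInv hπ b) (by rw [map_add, hs, hs])).trans ((f.map_update_add _ i _ _).trans
      (congrArg₂ (· + ·) (e x i a _ (hs a)).symm (e x i b _ (hs b)).symm))
  · intro inst x i c a
    obtain rfl : inst = instDecidableEqFin m := Subsingleton.elim _ _
    exact (e x i (c • a) (c • Function.surjInv hπ a) (by rw [map_smul, hs])).trans ((f.map_update_smul _ i c _).trans
      (congrArg (c • ·) (e x i a _ (hs a)).symm))

/-- A map of generators extends to a multilinear map if it extends linearly in each variable. -/
theorem exists_multilinear_of_generators (g : κ → X) (hg : Submodule.span k (Set.range g) = ⊤)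
    (F : (Fin m → κ) → N)
    (hF : ∀ (y : Fin m → κ) (i : Fin m), ∃ φ : X →ₗ[k] N, ∀ u, φ (g u) = F (Function.update y i u)) :
    ∃ f : MultilinearMap k (fun _ : Fin m => X) N, ∀ y, f (fun i => g (y i)) = F y := by
  have hu : ∀ (y : Fin m → κ) (i : Fin m) (u : κ),
      Function.update (fun j => Finsupp.single (y j) (1 : k)) i (Finsupp.single u 1) =
        fun j => Finsupp.single (Function.update y i u j) 1 := by
    intro y i u
    funext j
    by_cases hj : j = i
    · subst hj
      simp
    · simp [hj]
  obtain ⟨f, hf⟩ := exists_multilinear_of_ker (Finsupp.linearCombination k g) (by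
      rw [← LinearMap.range_eq_top, Finsupp.range_linearCombination, hg]) (multFree k F) (by
    intro v i z hz
    -- A relation `z` in slot `i` is killed when the other slots hold generators, since there the
    -- map factors through the given `φ`.
    have h0 : ∀ y : Fin m → κ,
        multFree k F (Function.update (fun j => Finsupp.single (y j) 1) i z) = 0 := by
      intro y
      obtain ⟨φ, hφ⟩ := hF y i
      have e : (multFree k F).toLinearMap (fun j => Finsupp.single (y j) 1) i =
          φ ∘ₗ Finsupp.linearCombination k g := by
        refine Finsupp.lhom_ext' fun u => LinearMap.ext_ring ?_
        simp only [LinearMap.comp_apply, Finsupp.lsingle_apply, MultilinearMap.toLinearMap_apply,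
          Finsupp.linearCombination_single, one_smul, hφ]
        rw [hu, multFree_single]
      refine (LinearMap.congr_fun e z).trans ?_
      rw [LinearMap.comp_apply, hz, map_zero]
    by_cases hκ : Nonempty κ
    · obtain ⟨u⟩ := hκ
      -- To free the other slots, slot `i` is precomposed with the linear map that sends every
      -- generator to `z`. The new multilinear map vanishes on generators, hence everywhere; putting
      -- a generator `u` in slot `i` gives back `z`.
      have e2 : ∀ w : Fin m → κ →₀ k, (fun j => (Function.update (fun _ => LinearMap.id) i
          (Finsupp.linearCombination k fun _ : κ => z) : Fin m → (κ →₀ k) →ₗ[k] (κ →₀ k)) j (w j)) =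
          Function.update w i ((Finsupp.linearCombination k fun _ : κ => z) (w i)) := by
        intro w
        funext j
        by_cases hj : j = i
        · subst hj
          rw [Function.update_self, Function.update_self]
        · rw [Function.update_of_ne hj, Function.update_of_ne hj, LinearMap.id_apply]
      have e : (multFree k F).compLinearMap (Function.update (fun _ => LinearMap.id) i
          (Finsupp.linearCombination k fun _ : κ => z)) = 0 := by
        refine multilinear_finsupp_ext fun y => ?_
        rw [MultilinearMap.compLinearMap_apply, e2, Finsupp.linearCombination_single, one_smul]
        exact h0 y
      have e3 := congrArg (fun f => f (Function.update v i (Finsupp.single u 1))) e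
      beta_reduce at e3
      rw [MultilinearMap.compLinearMap_apply, e2, Function.update_self, Function.update_idem,
        Finsupp.linearCombination_single, one_smul] at e3
      exact e3
    · have : IsEmpty κ := not_nonempty_iff.1 hκ
      exact (multFree k F).map_coord_zero i (by simp [Subsingleton.elim z 0]))
  refine ⟨f, fun y => ?_⟩
  rw [← multFree_single (k := k) F y, ← hf]
  simp

end MultilinearDescent

end HyperHom

/-! ### Disjoint unions and block permutations in `ΔH₊`. -/

namespace HyperHom

section BlockNaturality

open DeltaHPlus

theorem DeltaHPlus.Mor.toFun_lt_of_σ_lt {n m : ℕ} (F : Mor n m) {i j : Fin n}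
    (h : F.σ i < F.σ j) : F.toFun i ≤ F.toFun j :=
  F.φ.monotone h.le

/-- Since `φ` is monotone, the order given by `σ` refines the order of the images. This form matches
the lexicographic orders of composites. -/
theorem DeltaHPlus.Mor.σ_lt_iff {n m : ℕ} (F : Mor n m) (i j : Fin n) :
    F.σ i < F.σ j ↔ F.toFun i < F.toFun j ∨ (F.toFun i = F.toFun j ∧ F.σ i < F.σ j) := by
  constructor
  · intro h
    rcases (F.toFun_lt_of_σ_lt h).lt_or_eq with h' | h'
    · exact Or.inl h'
    · exact Or.inr ⟨h', h⟩
  · rintro (h | h)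
    · by_contra hc
      exact absurd (F.φ.monotone (not_lt.1 hc)) (not_le.2 h)
    · exact h.2

/-- A square between morphisms of `ΔH₊` and bijections commutes if it does so on underlying sets,
labels and orders. -/
theorem comp_permMor_eq {n m n' m' : ℕ} (F : Mor n m) (F' : Mor n' m') (e : Fin n ≃ Fin n')
    (d : Fin m ≃ Fin m') (hf : ∀ i, d (F.toFun i) = F'.toFun (e i)) (hz : ∀ i, F.z i = F'.z (e i))
    (hσ : ∀ i j, (d (F.toFun i) < d (F.toFun j) ∨ (F.toFun i = F.toFun j ∧ F.σ i < F.σ j)) ↔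
      F'.σ (e i) < F'.σ (e j)) :
    (permMor d).comp F = F'.comp (permMor e) := by
  refine Mor.ext_of_lt (fun i => ?_) (fun i => ?_) (fun i j => ?_)
  · rw [Mor.toFun_comp, Mor.toFun_comp]
    exact hf i
  · rw [Mor.z_comp, Mor.z_comp, permMor_z, permMor_z, mul_one, one_mul]
    exact hz i
  · rw [Mor.σ_comp_lt, Mor.σ_comp_lt, permMor_lt]
    simp only [permMor_toFun, permMor_z, true_and, ne_eq, not_true_eq_false, false_and, or_false]
    rw [hσ]
    refine ⟨Or.inl, ?_⟩
    rintro (h | h)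
    · exact h
    · rw [e.injective h.1] at h
      rcases h.2 with h' | h'
      · exact absurd h'.2 (lt_irrefl _)
      · exact absurd h'.2 (lt_irrefl _)

theorem permMor_trans {n m l : ℕ} (e : Fin n ≃ Fin m) (f : Fin m ≃ Fin l) :
    permMor (e.trans f) = (permMor f).comp (permMor e) :=
  symToDelta.map_comp (X := ⟨n⟩) (Y := ⟨m⟩) (Z := ⟨l⟩) e f

theorem permMor_refl (n : ℕ) : permMor (Equiv.refl (Fin n)) = Mor.id n :=
  symToDelta.map_id ⟨n⟩

theorem permMor_symm_comp {n m : ℕ} (e : Fin n ≃ Fin m) :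
    (permMor e).comp (permMor e.symm) = Mor.id m := by
  rw [← permMor_trans, Equiv.symm_trans_self, permMor_refl]

/-- The bijection of sums given by bijections of the summands. -/
def sumPerm {m : ℕ} {n n' : Fin m → ℕ} (e : ∀ i, Fin (n i) ≃ Fin (n' i)) :
    Fin (∑ i, n i) ≃ Fin (∑ i, n' i) :=
  finSigmaFinEquiv.symm.trans ((Equiv.sigmaCongrRight e).trans finSigmaFinEquiv)

theorem sumPerm_apply {m : ℕ} {n n' : Fin m → ℕ} (e : ∀ i, Fin (n i) ≃ Fin (n' i))
    (x : (i : Fin m) × Fin (n i)) :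
    sumPerm e (finSigmaFinEquiv x) = finSigmaFinEquiv ⟨x.1, e x.1 x.2⟩ := by
  simp [sumPerm]

theorem blockSum_permMor {m : ℕ} {n n' : Fin m → ℕ} (e : ∀ i, Fin (n i) ≃ Fin (n' i)) :
    blockSum (fun i => permMor (e i)) = permMor (sumPerm e) := by
  refine Mor.ext_of_lt (fun x => ?_) (fun x => ?_) (fun x y => ?_)
  · obtain ⟨x, rfl⟩ := finSigmaFinEquiv.surjective x
    rw [blockSum_toFun]
    exact (sumPerm_apply e x).symm
  · obtain ⟨x, rfl⟩ := finSigmaFinEquiv.surjective x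
    rw [blockSum_z, permMor_z, permMor_z]
  · obtain ⟨x, rfl⟩ := finSigmaFinEquiv.surjective x
    obtain ⟨y, rfl⟩ := finSigmaFinEquiv.surjective y
    rw [blockSum_σ, blockSum_σ, permMor_lt, sumPerm_apply, sumPerm_apply, finSigma_lt, finSigma_lt]
    rfl

theorem blockSum_σ_lt {m : ℕ} {j p : Fin m → ℕ} (F : ∀ i, Mor (j i) (p i))
    (x y : (i : Fin m) × Fin (j i)) :
    (blockSum F).σ (finSigmaFinEquiv x) < (blockSum F).σ (finSigmaFinEquiv y) ↔
      x.1 < y.1 ∨ (x.1 = y.1 ∧ ((F x.1).σ x.2 : ℕ) < ((F y.1).σ y.2 : ℕ)) := by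
  rw [blockSum_σ, blockSum_σ, finSigma_lt]

/-- The disjoint union of a family with one member. -/
theorem blockSum_one {n p : ℕ} (F : Mor n p) (h : ∑ _ : Fin 1, n = n) (h' : ∑ _ : Fin 1, p = p) :
    (permMor (finCongr h')).comp (blockSum fun _ : Fin 1 => F) =
      F.comp (permMor (finCongr h)) := by
  refine comp_permMor_eq _ _ _ _ (fun x => ?_) (fun x => ?_) (fun x y => ?_)
  · obtain ⟨⟨i, a⟩, rfl⟩ := finSigmaFinEquiv.surjective x
    rw [blockSum_toFun, finCongr_sigma_one, finCongr_sigma_one]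
  · obtain ⟨⟨i, a⟩, rfl⟩ := finSigmaFinEquiv.surjective x
    rw [blockSum_z, finCongr_sigma_one]
  · obtain ⟨⟨i, a⟩, rfl⟩ := finSigmaFinEquiv.surjective x
    obtain ⟨⟨i', b⟩, rfl⟩ := finSigmaFinEquiv.surjective y
    obtain rfl : i = i' := Subsingleton.elim _ _
    rw [blockSum_σ_lt, blockSum_toFun, blockSum_toFun, finCongr_sigma_one, finCongr_sigma_one,
      finCongr_sigma_one, finCongr_sigma_one, F.σ_lt_iff]
    simp only [lt_irrefl, false_or, true_and, ← Fin.lt_def, EmbeddingLike.apply_eq_iff_eq,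
      Sigma.mk.injEq, heq_eq_eq]

/-- Disjoint unions are compatible with block permutations. -/
theorem blockSum_blockPerm {m : ℕ} {j p : Fin m → ℕ} (F : ∀ i, Mor (j i) (p i))
    (σ : Equiv.Perm (Fin m)) :
    (permMor (blockPerm σ p)).comp (blockSum F) =
      (blockSum fun i => F (σ.symm i)).comp (permMor (blockPerm σ j)) := by
  -- At position `σ i` the reindexed family is `F i` up to a cast, which none of the three pieces of
  -- data can see.
  have hc : ∀ i i' (h : i' = i) (a : Fin (j i)),
      ((F i').toFun (Fin.cast (by rw [h]) a) : ℕ) = (F i).toFun a ∧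
      ((F i').σ (Fin.cast (by rw [h]) a) : ℕ) = (F i).σ a ∧
      (F i').z (Fin.cast (by rw [h]) a) = (F i).z a := by
    rintro i _ rfl a
    exact ⟨rfl, rfl, rfl⟩
  refine comp_permMor_eq _ _ _ _ (fun x => ?_) (fun x => ?_) (fun x y => ?_)
  · obtain ⟨⟨i, a⟩, rfl⟩ := finSigmaFinEquiv.surjective x
    rw [blockSum_toFun, blockPerm_apply, blockPerm_apply, blockSum_toFun]
    refine congrArg finSigmaFinEquiv (Sigma.ext rfl (heq_of_eq (Fin.ext ?_)))
    exact (hc i _ (σ.symm_apply_apply i) a).1.symm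
  · obtain ⟨⟨i, a⟩, rfl⟩ := finSigmaFinEquiv.surjective x
    rw [blockSum_z, blockPerm_apply, blockSum_z]
    exact (hc i _ (σ.symm_apply_apply i) a).2.2.symm
  · obtain ⟨⟨i, a⟩, rfl⟩ := finSigmaFinEquiv.surjective x
    obtain ⟨⟨i', b⟩, rfl⟩ := finSigmaFinEquiv.surjective y
    rw [blockSum_σ_lt, blockSum_toFun, blockSum_toFun, blockPerm_lt, blockPerm_apply,
      blockPerm_apply, blockSum_σ_lt, (hc i _ (σ.symm_apply_apply i) a).2.1,
      (hc i' _ (σ.symm_apply_apply i') b).2.1]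
    by_cases h : i = i'
    · subst h
      simp only [lt_irrefl, false_or, true_and, ← Fin.lt_def, EmbeddingLike.apply_eq_iff_eq,
        Sigma.mk.injEq, heq_eq_eq]
      exact ((F i).σ_lt_iff a b).symm
    · simp [h]

/-- Associativity of disjoint unions. -/
theorem blockSum_blockSum {m : ℕ} (j : Fin m → ℕ) (l p : ∀ i, Fin (j i) → ℕ)
    (F : ∀ i s, Mor (l i s) (p i s)) :
    (permMor (finCongr (sum_sum_eq j p))).comp (blockSum fun t : Fin (∑ i, j i) =>
        F (finSigmaFinEquiv.symm t).1 (finSigmaFinEquiv.symm t).2) =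
      (blockSum fun i => blockSum (F i)).comp (permMor (finCongr (sum_sum_eq j l))) := by
  refine comp_permMor_eq _ _ _ _ (fun x => ?_) (fun x => ?_) (fun x y => ?_)
  · obtain ⟨⟨t, a⟩, rfl⟩ := finSigmaFinEquiv.surjective x
    rw [blockSum_toFun, finCongr_sigma_sigma, finCongr_sigma_sigma, blockSum_toFun, blockSum_toFun]
  · obtain ⟨⟨t, a⟩, rfl⟩ := finSigmaFinEquiv.surjective x
    rw [blockSum_z, finCongr_sigma_sigma, blockSum_z, blockSum_z]
  · obtain ⟨⟨t, a⟩, rfl⟩ := finSigmaFinEquiv.surjective x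
    obtain ⟨⟨t', b⟩, rfl⟩ := finSigmaFinEquiv.surjective y
    rw [blockSum_σ_lt, blockSum_toFun, blockSum_toFun, finCongr_apply, finCongr_apply,
      Fin.cast_lt_cast, finSigma_lt, finCongr_sigma_sigma, finCongr_sigma_sigma, blockSum_σ_lt]
    dsimp only
    have h1 := finSigma_lt (finSigmaFinEquiv.symm t) (finSigmaFinEquiv.symm t')
    rw [Equiv.apply_symm_apply, Equiv.apply_symm_apply] at h1
    by_cases h : t = t'
    · subst h
      simp only [lt_irrefl, false_or, true_and, ← Fin.lt_def, blockSum_σ_lt,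
        EmbeddingLike.apply_eq_iff_eq, Sigma.mk.injEq, heq_eq_eq]
      exact (Mor.σ_lt_iff _ a b).symm
    · have h2 : ¬ finSigmaFinEquiv.symm t = finSigmaFinEquiv.symm t' := fun hh =>
        h (finSigmaFinEquiv.symm.injective hh)
      -- For different summands the comparison is decided by the index pairs; the elements `a` and
      -- `b` play no role.
      suffices hs : ∀ (u v : (i : Fin m) × Fin (j i)) (a : Fin (l u.1 u.2)) (b : Fin (l v.1 v.2)),
          ¬ u = v → ((u.1 < v.1 ∨ u.1 = v.1 ∧ (u.2 : ℕ) < (v.2 : ℕ)) ↔ (u.1 < v.1 ∨ u.1 = v.1 ∧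
          ((blockSum (F u.1)).σ (finSigmaFinEquiv ⟨u.2, a⟩) : ℕ) <
            ((blockSum (F v.1)).σ (finSigmaFinEquiv ⟨v.2, b⟩) : ℕ))) by
        have := hs _ _ a b h2
        rw [← this, h1]
        simp [h]
      rintro ⟨u1, u2⟩ ⟨v1, v2⟩ a b huv
      by_cases h : u1 = v1
      · subst h
        have huv' : ¬ u2 = v2 := fun h => huv (by rw [h])
        simp only [lt_irrefl, false_or, true_and, ← Fin.lt_def, blockSum_σ_lt, huv', false_and,
          or_false]
      · simp [h]

end BlockNaturality

end HyperHom

/-! ### Equality of strings in under-categories. -/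

namespace HyperHom

section UnderStrings

variable {X : DeltaHPlus}

theorem under_ext {C : Type} [SmallCategory C] {X : C} {U V : Under X} (h : U.right = V.right)
    (w : U.hom ≫ eqToHom h = V.hom) : U = V := by
  obtain ⟨⟨⟨⟩⟩, r, f⟩ := U
  obtain ⟨⟨⟨⟩⟩, r', f'⟩ := V
  obtain rfl : r = r' := h
  obtain rfl : f = f' := (Category.comp_id f).symm.trans w
  rfl

/-- The isomorphism of `ΔH₊` given by a bijection. -/
abbrev permHom {Y Z : DeltaHPlus} (e : Fin Y.len ≃ Fin Z.len) : Y ⟶ Z := permMor e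

theorem permHom_comp {Y Z W : DeltaHPlus} (e : Fin Y.len ≃ Fin Z.len) (f : Fin Z.len ≃ Fin W.len) :
    (permHom e : Y ⟶ Z) ≫ (permHom f : Z ⟶ W) = permHom (e.trans f) :=
  (permMor_trans e f).symm

/-- Objects of `ΔH₊` are skeletal and finite ordinals are rigid. Strict equality of strings can thus
be tested by order preserving bijections instead of casts. -/
theorem permHom_eq_eqToHom {Y Z : DeltaHPlus} (c : Fin Y.len ≃ Fin Z.len)
    (hc : ∀ i i', i < i' ↔ c i < c i') :
    ∃ h : Y = Z, permHom c = eqToHom h := by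
  obtain ⟨n⟩ := Y
  obtain ⟨n'⟩ := Z
  obtain rfl : n = n' := card_eq_of_equiv c
  refine ⟨rfl, ?_⟩
  have : c = Equiv.refl _ := equiv_ext_lt fun i j => (hc i j).symm
  rw [this]
  exact permMor_refl n

/-- Two strings of an under-category of `ΔH₊` agree if they are related by order preserving
bijections. -/
theorem underString_ext {p : ℕ} {S T : ComposableArrows (Under X) p}
    (c : ∀ q, Fin (S.obj q).right.len ≃ Fin (T.obj q).right.len)
    (hc : ∀ q i i', i < i' ↔ c q i < c q i')
    (hom : ∀ q, (S.obj q).hom ≫ permHom (c q) =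
      (T.obj q).hom)
    (map : ∀ {q q'} (u : q ⟶ q'), (S.map u).right ≫
      permHom (c q') =
        permHom (c q) ≫ (T.map u).right) : S = T := by
  choose h hh using fun q => permHom_eq_eqToHom (Y := (S.obj q).right) (c q) (hc q)
  refine CategoryTheory.Functor.ext (fun q => under_ext (h q) ?_) (fun q q' u => ?_)
  · rw [← hh, hom]
  · ext1
    rw [Under.comp_right, Under.comp_right, Under.eqToHom_right, Under.eqToHom_right]
    have := map u
    rw [hh, hh] at this
    exact ((comp_eqToHom_iff _ _ _).1 this).trans (Category.assoc _ _ _)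

/-- The comparison of two strings of an under-category of `ΔH₊` whose members are relabelled by
bijections `β` and `β'`. -/
theorem underString_ext_of_relabel {p : ℕ} {S T : ComposableArrows (Under X) p}
    (Y Y' : Fin (p + 1) → DeltaHPlus) (f : ∀ q, X ⟶ Y q) (f' : ∀ q, X ⟶ Y' q)
    (G : ∀ {q q' : Fin (p + 1)}, (q ⟶ q') → (Y q ⟶ Y q'))
    (G' : ∀ {q q' : Fin (p + 1)}, (q ⟶ q') → (Y' q ⟶ Y' q'))
    (β : ∀ q, Fin (Y q).len ≃ Fin (S.obj q).right.len)
    (β' : ∀ q, Fin (Y' q).len ≃ Fin (T.obj q).right.len)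
    (hS : ∀ q, (S.obj q).hom = f q ≫ permHom (β q))
    (hT : ∀ q, (T.obj q).hom = f' q ≫ permHom (β' q))
    (hSm : ∀ {q q'} (u : q ⟶ q'), permHom (β q) ≫ (S.map u).right =
      G u ≫ permHom (β q'))
    (hTm : ∀ {q q'} (u : q ⟶ q'), permHom (β' q) ≫ (T.map u).right =
      G' u ≫ permHom (β' q'))
    (d : ∀ q, Fin (Y q).len ≃ Fin (Y' q).len)
    (hf : ∀ q, f q ≫ permHom (d q) = f' q)
    (hG : ∀ {q q'} (u : q ⟶ q'), G u ≫ permHom (d q') =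
      permHom (d q) ≫ G' u)
    (hd : ∀ q i i', β q i < β q i' ↔ β' q (d q i) < β' q (d q i')) : S = T := by
  have hc : ∀ q, (permHom (β q) : Y q ⟶ (S.obj q).right) ≫
      (permHom ((β q).symm.trans ((d q).trans (β' q))) : (S.obj q).right ⟶ (T.obj q).right) =
      (permHom (d q) : Y q ⟶ Y' q) ≫ (permHom (β' q) : Y' q ⟶ (T.obj q).right) := by
    intro q
    rw [permHom_comp, permHom_comp]
    congr 1
    ext i
    simp
  refine underString_ext (fun q => (β q).symm.trans ((d q).trans (β' q))) (fun q i i' => ?_)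
    (fun q => ?_) (fun {q q'} u => ?_)
  · simpa using hd q ((β q).symm i) ((β q).symm i')
  · rw [hS, hT, Category.assoc, hc, ← Category.assoc, hf]
  · have hm : (permHom (β q).symm : (S.obj q).right ⟶ Y q) ≫
        (permHom (β q) : Y q ⟶ (S.obj q).right) = 𝟙 _ := permMor_symm_comp (β q)
    -- Cancelling the isomorphism of `β q` brings the map of `S` into the form where it is known, as
    -- a conjugate of `G u`.
    have hi : Function.Injective fun h : (S.obj q).right ⟶ (T.obj q').right =>
        (permHom (β q) : Y q ⟶ (S.obj q).right) ≫ h := by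
      intro a b hab
      have := congrArg (fun h => (permHom (β q).symm : (S.obj q).right ⟶ Y q) ≫ h) hab
      simpa only [← Category.assoc, hm, Category.id_comp] using this
    apply hi
    dsimp only
    rw [← Category.assoc, hSm, Category.assoc, hc, ← Category.assoc, hG, Category.assoc,
      ← Category.assoc _ _ (T.map u).right, hc, Category.assoc, hTm]

end UnderStrings

end HyperHom

/-! ### Unit, equivariance and associativity of `λ` on strings. -/

namespace HyperHom

section UnderCompIdentities

/-- On morphisms `λ` conjugates the disjoint union of the `g_i` by block permutations, so these
intertwine the two. -/
theorem nerveOp_underComp_map {m : ℕ} (j : Fin m → ℕ) {p : ℕ}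
    (s : ComposableArrows (EG (Equiv.Perm (Fin m))) p)
    (t : ∀ i, ComposableArrows (Under (DeltaHPlus.mk (j i))) p) {q q' : Fin (p + 1)}
    (u : q ⟶ q') :
    (blockIso (s.obj q).as fun i => ((t i).obj q).right).hom ≫
        ((nerveOp (underComp j) s t).map u).right =
      (blockSumFunctor m).map (X := fun i => ((t i).obj q).right)
        (Y := fun i => ((t i).obj q').right) (fun i => ((t i).map u).right) ≫
          (blockIso (s.obj q').as fun i => ((t i).obj q').right).hom :=
  Iso.hom_inv_id_assoc _ _

/-- Recognition of the strings in the image of `λ`. -/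
theorem nerveOp_underComp_eq {m : ℕ} (j : Fin m → ℕ) {p : ℕ}
    (s : ComposableArrows (EG (Equiv.Perm (Fin m))) p)
    (t : ∀ i, ComposableArrows (Under (DeltaHPlus.mk (j i))) p)
    {T : ComposableArrows (Under (DeltaHPlus.mk (∑ i, j i))) p}
    (Y' : Fin (p + 1) → DeltaHPlus) (f' : ∀ q, DeltaHPlus.mk (∑ i, j i) ⟶ Y' q)
    (G' : ∀ {q q' : Fin (p + 1)}, (q ⟶ q') → (Y' q ⟶ Y' q'))
    (β' : ∀ q, Fin (Y' q).len ≃ Fin (T.obj q).right.len)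
    (hT : ∀ q, (T.obj q).hom = f' q ≫ permHom (β' q))
    (hTm : ∀ {q q'} (u : q ⟶ q'), permHom (β' q) ≫ (T.map u).right = G' u ≫ permHom (β' q'))
    (d : ∀ q, Fin (∑ i, ((t i).obj q).right.len) ≃ Fin (Y' q).len)
    (hf : ∀ q, (permMor (d q)).comp (blockSum fun i => ((t i).obj q).hom) = f' q)
    (hG : ∀ {q q'} (u : q ⟶ q'), (permMor (d q')).comp (blockSum fun i => ((t i).map u).right) =
      DeltaHPlus.Mor.comp (G' u) (permMor (d q)))
    (hd : ∀ q (x y : (i : Fin m) × Fin ((t i).obj q).right.len),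
      ((s.obj q).as x.1 < (s.obj q).as y.1 ∨ (x.1 = y.1 ∧ (x.2 : ℕ) < (y.2 : ℕ))) ↔
        β' q (d q (finSigmaFinEquiv x)) < β' q (d q (finSigmaFinEquiv y))) :
    nerveOp (underComp j) s t = T :=
  underString_ext_of_relabel
    (fun q => (blockSumFunctor m).obj fun i => ((t i).obj q).right) Y'
    (fun q => (blockSumFunctor m).map (X := fun i => DeltaHPlus.mk (j i))
      (Y := fun i => ((t i).obj q).right) fun i => ((t i).obj q).hom) f'
    (fun {q q'} u => (blockSumFunctor m).map (X := fun i => ((t i).obj q).right)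
      (Y := fun i => ((t i).obj q').right) fun i => ((t i).map u).right) G'
    (fun q => blockPerm (s.obj q).as fun i => ((t i).obj q).right.len) β' (fun q => rfl) hT
    (fun u => nerveOp_underComp_map j s t u) hTm d hf hG (fun q x y => by
      obtain ⟨x, rfl⟩ := finSigmaFinEquiv.surjective x
      obtain ⟨y, rfl⟩ := finSigmaFinEquiv.surjective y
      exact (blockPerm_lt (s.obj q).as _ x y).trans (hd q x y))

/-- A single block cannot be permuted, so `s` may be any string; only the cast from a one-term sum
is left. -/
theorem nerveOp_underComp_one {n p : ℕ} (s : ComposableArrows (EG (Equiv.Perm (Fin 1))) p)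
    (t : ComposableArrows (Under (DeltaHPlus.mk n)) p) (h : ∑ _ : Fin 1, n = n) :
    nerveOp (underComp fun _ : Fin 1 => n) s (fun _ => t) =
      (t ⋙ Under.map (X := DeltaHPlus.mk (∑ _ : Fin 1, n)) (Y := DeltaHPlus.mk n)
        (permMor (finCongr h)) : ComposableArrows _ p) := by
  have h' : ∀ q, ∑ _ : Fin 1, (t.obj q).right.len = (t.obj q).right.len := fun q =>
    Fin.sum_univ_one _
  refine nerveOp_underComp_eq (fun _ : Fin 1 => n) s (fun _ => t) (fun q => (t.obj q).right)
    (fun q => (permHom (finCongr h) : DeltaHPlus.mk (∑ _ : Fin 1, n) ⟶ DeltaHPlus.mk n) ≫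
      (t.obj q).hom)
    (fun u => (t.map u).right) (fun q => Equiv.refl _) (fun q => ?_) (fun u => ?_)
    (fun q => finCongr (h' q)) (fun q => ?_) (fun u => ?_)
    (fun q x y => ?_)
  · exact Eq.symm ((congrArg (_ ≫ ·) (permMor_refl _)).trans (Category.comp_id _))
  · exact ((congrArg (· ≫ _) (permMor_refl _)).trans (Category.id_comp _)).trans
      ((congrArg (_ ≫ ·) (permMor_refl _)).trans (Category.comp_id _)).symm
  · exact blockSum_one (t.obj q).hom h (h' q)
  · exact blockSum_one (t.map _).right _ _
  · obtain ⟨i, a⟩ := x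
    obtain ⟨i', b⟩ := y
    obtain rfl : i = i' := Subsingleton.elim _ _
    rw [finCongr_sigma_one, finCongr_sigma_one]
    simp only [lt_irrefl, false_or, true_and]
    exact Iff.rfl

theorem blockPerm_blockPerm_lt {m : ℕ} (ρ σ : Equiv.Perm (Fin m)) (p : Fin m → ℕ)
    (x y : (i : Fin m) × Fin (p i)) :
    blockPerm ρ (fun i => p (σ.symm i)) (blockPerm σ p (finSigmaFinEquiv x)) <
        blockPerm ρ (fun i => p (σ.symm i)) (blockPerm σ p (finSigmaFinEquiv y)) ↔
      ρ (σ x.1) < ρ (σ y.1) ∨ (x.1 = y.1 ∧ (x.2 : ℕ) < (y.2 : ℕ)) := by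
  obtain ⟨i, a⟩ := x
  obtain ⟨i', b⟩ := y
  rw [blockPerm_apply σ p, blockPerm_apply σ p, blockPerm_lt]
  simp

/-- Moving blocks by `σ` and then by the vertices of `s` moves them by the translated string. The
`σ`-step passes through the disjoint union by `blockSum_blockPerm` and comes out on the source. -/
theorem nerveOp_underComp_relabel {m : ℕ} (j : Fin m → ℕ) {p : ℕ} (σ : Equiv.Perm (Fin m))
    (s : ComposableArrows (EG (Equiv.Perm (Fin m))) p)
    (t : ∀ i, ComposableArrows (Under (DeltaHPlus.mk (j i))) p) :
    nerveOp (underComp j) (s ⋙ egPull σ) t =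
      (nerveOp (underComp fun i => j (σ.symm i)) s (fun i => t (σ.symm i)) ⋙
        Under.map (X := DeltaHPlus.mk (∑ i, j i)) (Y := DeltaHPlus.mk (∑ i, j (σ.symm i)))
          (permMor (blockPerm σ j)) : ComposableArrows _ p) := by
  refine nerveOp_underComp_eq j (s ⋙ egPull σ) t
    (fun q => (blockSumFunctor m).obj fun i => ((t (σ.symm i)).obj q).right)
    (fun q => (permHom (blockPerm σ j) : DeltaHPlus.mk (∑ i, j i) ⟶
      DeltaHPlus.mk (∑ i, j (σ.symm i))) ≫ (blockSumFunctor m).map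
        (X := fun i => DeltaHPlus.mk (j (σ.symm i)))
        (Y := fun i => ((t (σ.symm i)).obj q).right) fun i => ((t (σ.symm i)).obj q).hom)
    (fun {q q'} u => (blockSumFunctor m).map (X := fun i => ((t (σ.symm i)).obj q).right)
      (Y := fun i => ((t (σ.symm i)).obj q').right) fun i => ((t (σ.symm i)).map u).right)
    (fun q => blockPerm (s.obj q).as fun i => ((t (σ.symm i)).obj q).right.len)
    (fun q => (Category.assoc _ _ _).symm)
    (fun u => nerveOp_underComp_map (fun i => j (σ.symm i)) s (fun i => t (σ.symm i)) u)
    (fun q => blockPerm σ fun i => ((t i).obj q).right.len)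
    (fun q => blockSum_blockPerm (fun i => ((t i).obj q).hom) σ)
    (fun {q q'} u => blockSum_blockPerm (fun i => ((t i).map u).right) σ)
    (fun q x y => (blockPerm_blockPerm_lt (s.obj q).as σ
      (fun i => ((t i).obj q).right.len) x y).symm)

/-- Relabelling the sources changes only the structure morphisms, so the comparison on targets is
the identity. This is what makes the action respect the relations of `IF~⟨A⟩`. -/
theorem nerveOp_underComp_inner {m : ℕ} (j : Fin m → ℕ) {p : ℕ}
    (s : ComposableArrows (EG (Equiv.Perm (Fin m))) p)
    (t : ∀ i, ComposableArrows (Under (DeltaHPlus.mk (j i))) p) {j' : Fin m → ℕ}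
    (e : ∀ i, Fin (j' i) ≃ Fin (j i)) :
    nerveOp (underComp j') s (fun i => (t i ⋙ Under.map (X := DeltaHPlus.mk (j' i))
        (Y := DeltaHPlus.mk (j i)) (permMor (e i)) : ComposableArrows _ p)) =
      (nerveOp (underComp j) s t ⋙
        Under.map (X := DeltaHPlus.mk (∑ i, j' i)) (Y := DeltaHPlus.mk (∑ i, j i))
          (permMor (sumPerm e)) : ComposableArrows _ p) := by
  refine nerveOp_underComp_eq j' s (fun i => (t i ⋙ Under.map (X := DeltaHPlus.mk (j' i))
        (Y := DeltaHPlus.mk (j i)) (permMor (e i)) : ComposableArrows _ p))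
    (fun q => (blockSumFunctor m).obj fun i => ((t i).obj q).right)
    (fun q => (permHom (sumPerm e) : DeltaHPlus.mk (∑ i, j' i) ⟶
      DeltaHPlus.mk (∑ i, j i)) ≫ (blockSumFunctor m).map
        (X := fun i => DeltaHPlus.mk (j i))
        (Y := fun i => ((t i).obj q).right) fun i => ((t i).obj q).hom)
    (fun {q q'} u => (blockSumFunctor m).map (X := fun i => ((t i).obj q).right)
      (Y := fun i => ((t i).obj q').right) fun i => ((t i).map u).right)
    (fun q => blockPerm (s.obj q).as fun i => ((t i).obj q).right.len)
    (fun q => (Category.assoc _ _ _).symm)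
    (fun u => nerveOp_underComp_map j s t u)
    (fun q => Equiv.refl _) (fun q => ?_) (fun {q q'} u => ?_)
    (fun q x y => (blockPerm_lt (s.obj q).as _ x y).symm)
  · refine ((congrArg (DeltaHPlus.Mor.comp · _) (permMor_refl _)).trans
      (Category.comp_id (X := DeltaHPlus.mk (∑ i, j' i))
        (Y := (blockSumFunctor m).obj fun i => ((t i).obj q).right) _)).trans ?_
    refine ((blockSumFunctor m).map_comp (X := fun i => DeltaHPlus.mk (j' i))
      (Y := fun i => DeltaHPlus.mk (j i)) (Z := fun i => ((t i).obj q).right)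
      (fun i => permMor (e i)) (fun i => ((t i).obj q).hom)).trans ?_
    exact congrArg (DeltaHPlus.Mor.comp _ ·) (blockSum_permMor e)
  · refine ((congrArg (DeltaHPlus.Mor.comp · _) (permMor_refl _)).trans
      (Category.comp_id (X := (blockSumFunctor m).obj fun i => ((t i).obj q).right)
        (Y := (blockSumFunctor m).obj fun i => ((t i).obj q').right) _)).trans (Eq.symm ?_)
    exact (congrArg (DeltaHPlus.Mor.comp _ ·) (permMor_refl _)).trans
      (Category.id_comp (X := (blockSumFunctor m).obj fun i => ((t i).obj q).right)
        (Y := (blockSumFunctor m).obj fun i => ((t i).obj q').right) _)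

/-- Permuting all small blocks by the operadic composite has the same effect as permuting them
inside each group by `τ i` and then permuting the groups by `σ`. The target order in
`nerveOp_underComp_assoc` is checked with this. -/
theorem blockPerm_sumPerm_lt {m : ℕ} (j : Fin m → ℕ) (p : ∀ i, Fin (j i) → ℕ)
    (σ : Equiv.Perm (Fin m)) (τ : ∀ i, Equiv.Perm (Fin (j i)))
    (t t' : Fin (∑ i, j i))
    (a : Fin (p (finSigmaFinEquiv.symm t).1 (finSigmaFinEquiv.symm t).2))
    (b : Fin (p (finSigmaFinEquiv.symm t').1 (finSigmaFinEquiv.symm t').2)) :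
    (operadPerm j σ τ t < operadPerm j σ τ t' ∨ (t = t' ∧ (a : ℕ) < (b : ℕ))) ↔
      blockPerm σ (fun i => ∑ s, p i ((τ i).symm s))
          (sumPerm (fun i => blockPerm (τ i) (p i)) (finCongr (sum_sum_eq j p)
            (finSigmaFinEquiv (n := fun t : Fin (∑ i, j i) =>
              p (finSigmaFinEquiv.symm t).1 (finSigmaFinEquiv.symm t).2) ⟨t, a⟩))) <
        blockPerm σ (fun i => ∑ s, p i ((τ i).symm s))
          (sumPerm (fun i => blockPerm (τ i) (p i)) (finCongr (sum_sum_eq j p)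
            (finSigmaFinEquiv (n := fun t : Fin (∑ i, j i) =>
              p (finSigmaFinEquiv.symm t).1 (finSigmaFinEquiv.symm t).2) ⟨t', b⟩))) := by
  rw [finCongr_sigma_sigma, finCongr_sigma_sigma, sumPerm_apply, sumPerm_apply, blockPerm_lt]
  dsimp only
  have h1 := operadPerm_lt j σ τ (finSigmaFinEquiv.symm t) (finSigmaFinEquiv.symm t')
  rw [Equiv.apply_symm_apply, Equiv.apply_symm_apply] at h1
  have h2 : t = t' ↔ finSigmaFinEquiv.symm t = finSigmaFinEquiv.symm t' := by simp
  refine (or_congr h1 (and_congr_left' h2)).trans ?_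
  suffices h : ∀ (u v : (i : Fin m) × Fin (j i)) (a : Fin (p u.1 u.2)) (b : Fin (p v.1 v.2)),
      ((σ u.1 < σ v.1 ∨ u.1 = v.1 ∧ (τ u.1 u.2 : ℕ) < (τ v.1 v.2 : ℕ)) ∨
        u = v ∧ (a : ℕ) < (b : ℕ)) ↔ (σ u.1 < σ v.1 ∨ u.1 = v.1 ∧
          (blockPerm (τ u.1) (p u.1) (finSigmaFinEquiv ⟨u.2, a⟩) : ℕ) <
            (blockPerm (τ v.1) (p v.1) (finSigmaFinEquiv ⟨v.2, b⟩) : ℕ)) from h _ _ a b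
  rintro ⟨u1, u2⟩ ⟨v1, v2⟩ a b
  by_cases h : u1 = v1
  · subst h
    simp only [lt_irrefl, false_or, true_and, ← Fin.lt_def, blockPerm_lt, Sigma.mk.injEq,
      heq_eq_eq]
  · simp [h]

theorem nerveOp_underComp_assoc {m : ℕ} (j : Fin m → ℕ) (l : ∀ i, Fin (j i) → ℕ) {p : ℕ}
    (s : ComposableArrows (EG (Equiv.Perm (Fin m))) p)
    (r : ∀ i, ComposableArrows (EG (Equiv.Perm (Fin (j i)))) p)
    (t : ∀ i a, ComposableArrows (Under (DeltaHPlus.mk (l i a))) p) :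
    nerveOp (underComp fun x : Fin (∑ i, j i) =>
        l (finSigmaFinEquiv.symm x).1 (finSigmaFinEquiv.symm x).2)
        (nerveOp (barrattEcclesComp j) s r)
        (fun x => t (finSigmaFinEquiv.symm x).1 (finSigmaFinEquiv.symm x).2) =
      (nerveOp (underComp fun i => ∑ a, l i a) s (fun i => nerveOp (underComp (l i)) (r i) (t i)) ⋙
        Under.map (X := DeltaHPlus.mk _) (Y := DeltaHPlus.mk (∑ i, ∑ a, l i a))
          (permMor (finCongr (sum_sum_eq j l))) : ComposableArrows _ p) := by
  let Z : ∀ i, Fin (j i) → Fin (p + 1) → DeltaHPlus := fun i a q => ((t i a).obj q).right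
  -- `Y'` is the nested disjoint union before any block is moved. The inner and outer block
  -- permutations are separated from it, as `B'` and `blockIso`.
  let Y' : Fin (p + 1) → DeltaHPlus := fun q =>
    (blockSumFunctor m).obj fun i => (blockSumFunctor (j i)).obj fun a => Z i a q
  let F : ∀ q, DeltaHPlus.mk (∑ i, ∑ a, l i a) ⟶ Y' q := fun q =>
    (blockSumFunctor m).map (X := fun i => DeltaHPlus.mk (∑ a, l i a))
      (Y := fun i => (blockSumFunctor (j i)).obj fun a => Z i a q)
      fun i => (blockSumFunctor (j i)).map (X := fun a => DeltaHPlus.mk (l i a))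
        (Y := fun a => Z i a q) fun a => ((t i a).obj q).hom
  let G : ∀ {q q' : Fin (p + 1)}, (q ⟶ q') → (Y' q ⟶ Y' q') := fun {q q'} u =>
    (blockSumFunctor m).map (X := fun i => (blockSumFunctor (j i)).obj fun a => Z i a q)
      (Y := fun i => (blockSumFunctor (j i)).obj fun a => Z i a q')
      fun i => (blockSumFunctor (j i)).map (X := fun a => Z i a q)
        (Y := fun a => Z i a q') fun a => ((t i a).map u).right
  let B : ∀ q i, (blockSumFunctor (j i)).obj (fun a => Z i a q) ⟶
      ((nerveOp (underComp (l i)) (r i) (t i)).obj q).right := fun q i =>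
    permMor (blockPerm ((r i).obj q).as fun a => (Z i a q).len)
  let B' : ∀ q, Y' q ⟶ (blockSumFunctor m).obj
      fun i => ((nerveOp (underComp (l i)) (r i) (t i)).obj q).right := fun q =>
    permMor (sumPerm fun i => blockPerm ((r i).obj q).as fun a => (Z i a q).len)
  have hB : ∀ q, (blockSumFunctor m).map (X := fun i => (blockSumFunctor (j i)).obj
      fun a => Z i a q) (Y := fun i => ((nerveOp (underComp (l i)) (r i) (t i)).obj q).right)
        (B q) = B' q := fun q => blockSum_permMor _
  have hβ : ∀ q, (permMor ((sumPerm fun i => blockPerm ((r i).obj q).as fun a =>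
      (Z i a q).len).trans (blockPerm (s.obj q).as fun i =>
        ((nerveOp (underComp (l i)) (r i) (t i)).obj q).right.len)) : Y' q ⟶ _) =
      B' q ≫ (blockIso (s.obj q).as fun i =>
        ((nerveOp (underComp (l i)) (r i) (t i)).obj q).right).hom := fun q => permMor_trans _ _
  refine nerveOp_underComp_eq _ (nerveOp (barrattEcclesComp j) s r)
    (fun x => t (finSigmaFinEquiv.symm x).1 (finSigmaFinEquiv.symm x).2) Y'
    (fun q => (permHom (finCongr (sum_sum_eq j l)) : DeltaHPlus.mk _ ⟶
      DeltaHPlus.mk (∑ i, ∑ a, l i a)) ≫ F q) G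
    (fun q => (sumPerm fun i => blockPerm ((r i).obj q).as fun a =>
      (Z i a q).len).trans (blockPerm (s.obj q).as fun i =>
        ((nerveOp (underComp (l i)) (r i) (t i)).obj q).right.len))
    (fun q => ?_) (fun {q q'} u => ?_)
    (fun q => finCongr (sum_sum_eq j fun i a => (Z i a q).len)) (fun q => ?_) (fun {q q'} u => ?_)
    (fun q x y => ?_)
  · refine Eq.trans ?_ (congrArg (_ ≫ ·) (hβ q)).symm
    refine Eq.trans ?_ (Category.assoc _ _ _).symm
    refine congrArg ((permHom (finCongr (sum_sum_eq j l)) : DeltaHPlus.mk _ ⟶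
      DeltaHPlus.mk (∑ i, ∑ a, l i a)) ≫ ·) ?_
    refine Eq.trans ?_ (Category.assoc _ _ _)
    refine congrArg (· ≫ (blockIso (s.obj q).as fun i =>
        ((nerveOp (underComp (l i)) (r i) (t i)).obj q).right).hom) ?_
    refine Eq.trans ?_ (congrArg (F q ≫ ·) (hB q))
    exact (blockSumFunctor m).map_comp (X := fun i => DeltaHPlus.mk (∑ a, l i a))
      (Y := fun i => (blockSumFunctor (j i)).obj fun a => Z i a q)
      (Z := fun i => ((nerveOp (underComp (l i)) (r i) (t i)).obj q).right)
      (fun i => (blockSumFunctor (j i)).map (X := fun a => DeltaHPlus.mk (l i a))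
        (Y := fun a => Z i a q) fun a => ((t i a).obj q).hom) (B q)
  · refine (congrArg (· ≫ _) (hβ q)).trans (Eq.symm ((congrArg (_ ≫ ·) (hβ q')).trans ?_))
    refine Eq.symm ((Category.assoc _ _ _).trans ((congrArg (B' q ≫ ·)
      (nerveOp_underComp_map (fun i => ∑ a, l i a) s
        (fun i => nerveOp (underComp (l i)) (r i) (t i)) u)).trans ?_))
    refine (Category.assoc _ _ _).symm.trans (Eq.trans ?_ (Category.assoc _ _ _))
    refine congrArg (· ≫ (blockIso (s.obj q').as fun i =>
        ((nerveOp (underComp (l i)) (r i) (t i)).obj q').right).hom) ?_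
    refine (congrArg (· ≫ _) (hB q).symm).trans (Eq.trans ?_ (congrArg (G u ≫ ·) (hB q')))
    refine ((blockSumFunctor m).map_comp _ _).symm.trans
      (Eq.trans (congrArg _ (funext fun i => ?_)) ((blockSumFunctor m).map_comp _ _))
    exact nerveOp_underComp_map (l i) (r i) (t i) u
  · exact blockSum_blockSum j l (fun i a => (Z i a q).len) fun i a => ((t i a).obj q).hom
  · exact blockSum_blockSum j (fun i a => (Z i a q).len) (fun i a => (Z i a q').len)
      fun i a => ((t i a).map u).right
  · exact blockPerm_sumPerm_lt j (fun i a => (Z i a q).len) (s.obj q).as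
      (fun i => ((r i).obj q).as) x.1 y.1 x.2 y.2

end UnderCompIdentities

end HyperHom

/-! ### Generators of `IF~⟨A⟩` and the action of a single string. -/

namespace HyperHom

section SchurGenerators

/-- The generators of `IF~⟨A⟩` in a fixed degree. -/
structure SchurGen (A : Type u) (p : ℕ) : Type u where
  n : ℕ
  t : ComposableArrows (Under (DeltaHPlus.mk n)) p
  a : Fin n → A

theorem update_schurGen {A : Type u} {m p : ℕ} (y : Fin m → SchurGen A p) (i : Fin m)
    (b : Fin (y i).n → A) : Function.update y i ⟨(y i).n, (y i).t, b⟩ =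
      fun j => ⟨(y j).n, (y j).t, Function.update (fun j => (y j).a) i b j⟩ := by
  funext j
  by_cases h : j = i
  · subst h
    rw [Function.update_self, Function.update_self]
  · rw [Function.update_of_ne h, Function.update_of_ne h]

variable (k A : Type u) [CommRing k] [Ring A] [Algebra k A] (τ : Involution k A)

/-- The concatenation of a family of tuples. -/
def concatTuple {m : ℕ} {n : Fin m → ℕ} {A : Type*} (a : ∀ i, Fin (n i) → A) :
    Fin (∑ i, n i) → A :=
  fun l => a (finSigmaFinEquiv.symm l).1 (finSigmaFinEquiv.symm l).2

theorem concatTuple_apply {m : ℕ} {n : Fin m → ℕ} {A : Type*} (a : ∀ i, Fin (n i) → A)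
    (x : (i : Fin m) × Fin (n i)) : concatTuple a (finSigmaFinEquiv x) = a x.1 x.2 :=
  congrArg (fun y : (i : Fin m) × Fin (n i) => a y.1 y.2) (Equiv.symm_apply_apply _ x)

theorem concatTuple_update {m : ℕ} {n : Fin m → ℕ} {A : Type*} (a : ∀ i, Fin (n i) → A) (i : Fin m)
    (l : Fin (n i)) (x : A) :
    concatTuple (Function.update a i (Function.update (a i) l x)) =
      Function.update (concatTuple a) (finSigmaFinEquiv ⟨i, l⟩) x := by
  funext y
  obtain ⟨⟨i', l'⟩, rfl⟩ := finSigmaFinEquiv.surjective y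
  rw [concatTuple_apply]
  by_cases h : (⟨i', l'⟩ : (i : Fin m) × Fin (n i)) = ⟨i, l⟩
  · rw [h]
    simp
  · rw [Function.update_of_ne (fun h' => h (finSigmaFinEquiv.injective h')), concatTuple_apply]
    by_cases hi : i' = i
    · subst hi
      have hl : l' ≠ l := fun hl => h (by rw [hl])
      simp [hl]
    · simp [hi]

theorem concatTuple_sumPerm_symm {m : ℕ} {n n' : Fin m → ℕ} {A : Type*} (a : ∀ i, Fin (n i) → A)
    (e : ∀ i, Fin (n i) ≃ Fin (n' i)) :
    concatTuple a ∘ (sumPerm e).symm = concatTuple fun i => a i ∘ (e i).symm := by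
  funext y
  obtain ⟨y, rfl⟩ := (sumPerm e).surjective y
  obtain ⟨x, rfl⟩ := finSigmaFinEquiv.surjective y
  rw [Function.comp_apply, Equiv.symm_apply_apply, sumPerm_apply, concatTuple_apply,
    concatTuple_apply]
  simp

variable {k A}

theorem barProd_permMor {n m : ℕ} (e : Fin n ≃ Fin m) (a : Fin n → A) :
    barProd τ (permMor e) a = a ∘ e.symm := by
  funext j
  have : (permMor e).fib j = [e.symm j] := by
    apply List.perm_singleton.1
    rw [List.perm_ext_iff_of_nodup ((DeltaHPlus.Mor.pairwise_fib (permMor e) j).imp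
      (by rintro x y hxy rfl; exact lt_irrefl _ hxy)) (List.nodup_singleton _)]
    intro i
    rw [DeltaHPlus.Mor.mem_fib, permMor_toFun, List.mem_singleton, Equiv.eq_symm_apply]
  simp [barProd, this, Involution.act]

variable {Δ : SimplexCategoryᵒᵖ}

/-- The multilinear map `a ↦ [t ⊗ (a₁ ⊗ ⋯ ⊗ a_n)]`. -/
noncomputable def schurMkMultilinear {n : ℕ}
    (t : ComposableArrows (Under (DeltaHPlus.mk n)) Δ.unop.len) :
    MultilinearMap k (fun _ : Fin n => A) ((schur k A τ).obj Δ) :=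
  (tensorMkBilin ((underLevel k).obj Δ) (symToDelta ⋙ barFunctor k A τ) ⟨n⟩
    (Finsupp.single t (1 : k))).compMultilinearMap (PiTensorProduct.tprod k)

/-- The pullback of a string of an under-category along a bijection. -/
abbrev underPull {n n' p : ℕ} (e : Fin n ≃ Fin n')
    (t : ComposableArrows (Under (DeltaHPlus.mk n')) p) :
    ComposableArrows (Under (DeltaHPlus.mk n)) p :=
  t ⋙ Under.map (X := DeltaHPlus.mk n) (Y := DeltaHPlus.mk n') (permMor e)

/-- This is the defining relation of the tensor product over the symmetric groupoid, for the
bijection `e`. -/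
theorem schurMk_underPull {n n' : ℕ} (e : Fin n ≃ Fin n')
    (t : ComposableArrows (Under (DeltaHPlus.mk n')) Δ.unop.len) (a : Fin n → A) :
    schurMk k A τ Δ (underPull e t) a = schurMk k A τ Δ t (a ∘ e.symm) := by
  have h := tensorMk_map (G := (underLevel k).obj Δ) (F := symToDelta ⋙ barFunctor k A τ)
    (c := ⟨n⟩) (d := ⟨n'⟩) e (Finsupp.single t (1 : k)) (PiTensorProduct.tprod k a)
  refine Eq.trans (congrArg (fun z => tensorMk ((underLevel k).obj Δ)
    (symToDelta ⋙ barFunctor k A τ) ⟨n⟩ z (PiTensorProduct.tprod k a)) ?_) (h.trans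
      (congrArg (tensorMk ((underLevel k).obj Δ) (symToDelta ⋙ barFunctor k A τ) ⟨n'⟩
        (Finsupp.single t (1 : k))) ?_))
  · exact Finsupp.mapDomain_single.symm
  · exact (barMap_tprod τ _ a).trans (congrArg _ (barProd_permMor τ e a))

theorem underPull_refl {n p : ℕ} (t : ComposableArrows (Under (DeltaHPlus.mk n)) p) :
    underPull (Equiv.refl _) t = t := by
  have : Under.map (X := DeltaHPlus.mk n) (Y := DeltaHPlus.mk n) (permMor (Equiv.refl (Fin n))) =
      𝟭 _ := by
    rw [permMor_refl]
    exact Under.mapId_eq (DeltaHPlus.mk n)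
  rw [underPull, this]
  rfl

/-- Linear maps out of `IF~⟨A⟩` in a fixed degree. -/
noncomputable def schurDesc {N : Type u} [AddCommGroup N] [Module k N]
    (b : ∀ n : ℕ, ComposableArrows (Under (DeltaHPlus.mk n)) Δ.unop.len →
      MultilinearMap k (fun _ : Fin n => A) N)
    (hb : ∀ {n n' : ℕ} (e : Fin n ≃ Fin n')
      (t : ComposableArrows (Under (DeltaHPlus.mk n')) Δ.unop.len) (a : Fin n → A),
      b n (underPull e t) a = b n' t (a ∘ e.symm)) :
    (schur k A τ).obj Δ →ₗ[k] N :=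
  tensorDesc ((underLevel k).obj Δ) (symToDelta ⋙ barFunctor k A τ)
    (fun c => Finsupp.linearCombination k fun t => PiTensorProduct.lift (b c.card t)) (by
      intro c d α x y
      suffices h : (Finsupp.linearCombination k fun t => PiTensorProduct.lift (b c.card t)) ∘ₗ
          Finsupp.lmapDomain k k (underPull (p := Δ.unop.len) (n := c.card) (n' := d.card) α) =
          LinearMap.lcomp k N (barMap τ (permMor (n := c.card) (m := d.card) α)) ∘ₗ
            (Finsupp.linearCombination k fun t => PiTensorProduct.lift (b d.card t)) from
        congrArg (fun f => f y) (LinearMap.congr_fun h x)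
      refine Finsupp.lhom_ext' fun t => LinearMap.ext_ring (PiTensorProduct.ext ?_)
      ext a
      simp only [LinearMap.comp_apply, Finsupp.lsingle_apply, Finsupp.lmapDomain_apply,
        Finsupp.mapDomain_single, Finsupp.linearCombination_single, one_smul,
        LinearMap.compMultilinearMap_apply, PiTensorProduct.lift.tprod, LinearMap.lcomp_apply,
        barMap_tprod, hb, barProd_permMor])

theorem schurDesc_mk {N : Type u} [AddCommGroup N] [Module k N]
    (b : ∀ n : ℕ, ComposableArrows (Under (DeltaHPlus.mk n)) Δ.unop.len →
      MultilinearMap k (fun _ : Fin n => A) N) (hb) {n : ℕ}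
    (t : ComposableArrows (Under (DeltaHPlus.mk n)) Δ.unop.len) (a : Fin n → A) :
    schurDesc τ b hb (schurMk k A τ Δ t a) = b n t a := by
  refine (tensorDesc_mk _ _ _ _ _ _ _).trans ?_
  refine (congrArg (fun f : (⨂[k] _ : Fin n, A) →ₗ[k] N => f (PiTensorProduct.tprod k a))
    (Finsupp.linearCombination_single k (1 : k) t)).trans ?_
  exact (congrArg (fun f => f (PiTensorProduct.tprod k a))
    (one_smul k (PiTensorProduct.lift (b n t)))).trans (PiTensorProduct.lift.tprod _)

theorem schurMk_lin_ext {N : Type u} [AddCommGroup N] [Module k N]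
    {f g : (schur k A τ).obj Δ →ₗ[k] N}
    (h : ∀ (n : ℕ) (t : ComposableArrows (Under (DeltaHPlus.mk n)) Δ.unop.len) (a : Fin n → A),
      f (schurMk k A τ Δ t a) = g (schurMk k A τ Δ t a)) : f = g := by
  apply tensor_hom_ext
  intro c x y
  suffices h : (tensorMkBilin ((underLevel k).obj Δ) (symToDelta ⋙ barFunctor k A τ) c).compr₂ f =
      (tensorMkBilin ((underLevel k).obj Δ) (symToDelta ⋙ barFunctor k A τ) c).compr₂ g from
    congrArg (fun f => f y) (LinearMap.congr_fun h x)
  refine Finsupp.lhom_ext' fun t => LinearMap.ext_ring (PiTensorProduct.ext ?_)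
  ext a
  exact h c.card t a

/-- The class of a generator. -/
noncomputable def SchurGen.mk' (y : SchurGen A Δ.unop.len) : (schur k A τ).obj Δ :=
  schurMk k A τ Δ y.t y.a

theorem span_schurGen :
    Submodule.span k (Set.range fun y : SchurGen A Δ.unop.len => y.mk' τ) = ⊤ := by
  rw [← Submodule.ker_mkQ (Submodule.span k _), LinearMap.ker_eq_top]
  refine schurMk_lin_ext τ fun n t a => ?_
  exact (Submodule.Quotient.mk_eq_zero _).2 (Submodule.subset_span ⟨⟨n, t, a⟩, rfl⟩)

theorem schur_multilinear_ext {ι N : Type*} [Finite ι] [AddCommGroup N] [Module k N]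
    {f g : MultilinearMap k (fun _ : ι => ((schur k A τ).obj Δ : Type u)) N}
    (h : ∀ y : ι → SchurGen A Δ.unop.len, f (fun i => (y i).mk' τ) = g fun i => (y i).mk' τ) :
    f = g :=
  MultilinearMap.ext_of_span_eq_top (g := fun _ (y : SchurGen A Δ.unop.len) => y.mk' τ)
    (fun _ => span_schurGen τ) h

/-- The value of the action on a family of generators. -/
noncomputable def schurOp {m : ℕ} (s : ComposableArrows (EG (Equiv.Perm (Fin m))) Δ.unop.len)
    (n : Fin m → ℕ) (t : ∀ i, ComposableArrows (Under (DeltaHPlus.mk (n i))) Δ.unop.len)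
    (a : ∀ i, Fin (n i) → A) : (schur k A τ).obj Δ :=
  schurMk k A τ Δ (nerveOp (underComp n) s t) (concatTuple a)

/-- Relabelling the arguments relabels the result by the disjoint union of the bijections, which the
tensor product absorbs; hence the value depends only on the classes of the arguments. -/
theorem schurOp_underPull {m : ℕ} (s : ComposableArrows (EG (Equiv.Perm (Fin m))) Δ.unop.len)
    {n n' : Fin m → ℕ} (t : ∀ i, ComposableArrows (Under (DeltaHPlus.mk (n' i))) Δ.unop.len)
    (e : ∀ i, Fin (n i) ≃ Fin (n' i)) (a : ∀ i, Fin (n i) → A) :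
    schurOp τ s n (fun i => underPull (e i) (t i)) a =
      schurOp τ s n' t fun i => a i ∘ (e i).symm := by
  rw [schurOp, schurOp, ← concatTuple_sumPerm_symm, ← schurMk_underPull]
  exact congrArg (fun T => schurMk k A τ Δ T (concatTuple a)) (nerveOp_underComp_inner n' s t e)

/-- The action as a function of generators. -/
noncomputable def schurOpGen {m : ℕ} (s : ComposableArrows (EG (Equiv.Perm (Fin m))) Δ.unop.len)
    (y : Fin m → SchurGen A Δ.unop.len) : (schur k A τ).obj Δ :=
  schurOp τ s (fun i => (y i).n) (fun i => (y i).t) fun i => (y i).a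

theorem schurOpGen_congr {m : ℕ} (s : ComposableArrows (EG (Equiv.Perm (Fin m))) Δ.unop.len)
    (y y' : Fin m → SchurGen A Δ.unop.len)
    (h : ∀ i, ∃ e : Fin (y i).n ≃ Fin (y' i).n, (y i).t = underPull e (y' i).t ∧
      (y' i).a = (y i).a ∘ e.symm) : schurOpGen τ s y = schurOpGen τ s y' := by
  choose e he he' using h
  rw [schurOpGen, schurOpGen, funext he', funext he, schurOp_underPull]

/-- One entry of one tuple is one entry of the concatenation, so the value is linear in it. -/
theorem schurOpGen_update {m : ℕ} (s : ComposableArrows (EG (Equiv.Perm (Fin m))) Δ.unop.len)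
    (y : Fin m → SchurGen A Δ.unop.len) (i : Fin m) (l : Fin (y i).n) (x : A) :
    schurOpGen τ s (Function.update y i ⟨(y i).n, (y i).t, Function.update (y i).a l x⟩) =
      schurMk k A τ Δ (nerveOp (underComp fun i => (y i).n) s fun i => (y i).t)
        (Function.update (concatTuple fun i => (y i).a) (finSigmaFinEquiv ⟨i, l⟩) x) := by
  rw [update_schurGen, ← concatTuple_update]
  rfl

theorem exists_schurOpGen_update {m : ℕ}
    (s : ComposableArrows (EG (Equiv.Perm (Fin m))) Δ.unop.len)
    (y : Fin m → SchurGen A Δ.unop.len) (i : Fin m) (u : SchurGen A Δ.unop.len) (l : Fin u.n) :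
    ∃ (φ : A →ₗ[k] (schur k A τ).obj Δ), ∀ x, schurOpGen τ s
      (Function.update y i ⟨u.n, u.t, Function.update u.a l x⟩) = φ x := by
  -- The value of `y` at `i` is overwritten anyway. Making it `u` from the start lets the tuples in
  -- that slot have the right length definitionally.
  obtain ⟨y', rfl, h⟩ : ∃ y' : Fin m → SchurGen A Δ.unop.len, y' i = u ∧
      ∀ v, Function.update y i v = Function.update y' i v :=
    ⟨Function.update y i u, by simp, by simp⟩
  refine ⟨(schurMkMultilinear τ (nerveOp (underComp fun i => (y' i).n) s fun i =>
    (y' i).t)).toLinearMap (concatTuple fun i => (y' i).a) (finSigmaFinEquiv ⟨i, l⟩), fun x => ?_⟩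
  rw [h]
  exact schurOpGen_update τ s y' i l x

/-- The dependence of the action on one argument, on generators. -/
noncomputable def schurOpMultilinear {m : ℕ}
    (s : ComposableArrows (EG (Equiv.Perm (Fin m))) Δ.unop.len)
    (y : Fin m → SchurGen A Δ.unop.len) (i : Fin m) (n : ℕ)
    (t : ComposableArrows (Under (DeltaHPlus.mk n)) Δ.unop.len) :
    MultilinearMap k (fun _ : Fin n => A) ((schur k A τ).obj Δ) where
  toFun a := schurOpGen τ s (Function.update y i ⟨n, t, a⟩)
  map_update_add' {inst} a l x x' := by
    obtain rfl : inst = instDecidableEqFin n := Subsingleton.elim _ _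
    obtain ⟨φ, hφ⟩ := exists_schurOpGen_update τ s y i ⟨n, t, a⟩ l
    exact (hφ _).trans ((map_add φ x x').trans (congrArg₂ (· + ·) (hφ x).symm (hφ x').symm))
  map_update_smul' {inst} a l c x := by
    obtain rfl : inst = instDecidableEqFin n := Subsingleton.elim _ _
    obtain ⟨φ, hφ⟩ := exists_schurOpGen_update τ s y i ⟨n, t, a⟩ l
    exact (hφ _).trans ((map_smul φ c x).trans (congrArg (c • ·) (hφ x).symm))

/-- In each argument separately the formula is multilinear in the tensor entries and invariant under
relabelling, so it descends to `IF~⟨A⟩`; `exists_multilinear_of_generators` then treats all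
arguments together. -/
theorem exists_schurAct {m : ℕ} (s : ComposableArrows (EG (Equiv.Perm (Fin m))) Δ.unop.len) :
    ∃ f : MultilinearMap k (fun _ : Fin m => ((schur k A τ).obj Δ : Type u)) ((schur k A τ).obj Δ),
      ∀ y : Fin m → SchurGen A Δ.unop.len, f (fun i => (y i).mk' τ) = schurOpGen τ s y := by
  refine exists_multilinear_of_generators (fun y : SchurGen A Δ.unop.len => y.mk' τ)
    (span_schurGen τ) (schurOpGen τ s) fun y i => ?_
  refine ⟨schurDesc τ (fun n t => schurOpMultilinear τ s y i n t) (fun {n n'} e t a => ?_),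
    fun u => schurDesc_mk τ _ _ u.t u.a⟩
  refine schurOpGen_congr τ s _ _ fun j => ?_
  by_cases h : j = i
  · subst h
    rw [Function.update_self, Function.update_self]
    exact ⟨e, rfl, rfl⟩
  · rw [Function.update_of_ne h, Function.update_of_ne h]
    exact ⟨Equiv.refl _, (underPull_refl _).symm, rfl⟩

/-- The action of a string of `𝔼Σ_m` on `IF~⟨A⟩`. -/
noncomputable def schurActString {m : ℕ}
    (s : ComposableArrows (EG (Equiv.Perm (Fin m))) Δ.unop.len) :
    MultilinearMap k (fun _ : Fin m => ((schur k A τ).obj Δ : Type u)) ((schur k A τ).obj Δ) :=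
  (exists_schurAct τ s).choose

theorem schurActString_mk {m : ℕ} (s : ComposableArrows (EG (Equiv.Perm (Fin m))) Δ.unop.len)
    (n : Fin m → ℕ) (t : ∀ i, ComposableArrows (Under (DeltaHPlus.mk (n i))) Δ.unop.len)
    (a : ∀ i, Fin (n i) → A) :
    schurActString τ s (fun i => schurMk k A τ Δ (t i) (a i)) = schurOp τ s n t a :=
  (exists_schurAct τ s).choose_spec fun i => ⟨n i, t i, a i⟩

end SchurGenerators

end HyperHom

/-! ### The algebra structure on `IF~⟨A⟩`. -/

namespace HyperHom

section SchurAlgebra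

theorem concatTuple_one {n : ℕ} {A : Type*} (a : Fin n → A) (h : ∑ _ : Fin 1, n = n) :
    concatTuple (fun _ : Fin 1 => a) ∘ (finCongr h).symm = a := by
  funext x
  obtain ⟨y, rfl⟩ := (finCongr h).surjective x
  obtain ⟨⟨i, b⟩, rfl⟩ := finSigmaFinEquiv.surjective y
  rw [Function.comp_apply, Equiv.symm_apply_apply, concatTuple_apply, finCongr_sigma_one]

theorem concatTuple_concatTuple {m : ℕ} (j : Fin m → ℕ) (l : ∀ i, Fin (j i) → ℕ) {A : Type*}
    (a : ∀ i s, Fin (l i s) → A) :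
    concatTuple (fun t : Fin (∑ i, j i) => a (finSigmaFinEquiv.symm t).1 (finSigmaFinEquiv.symm t).2)
      ∘ (finCongr (sum_sum_eq j l)).symm = concatTuple fun i => concatTuple (a i) := by
  funext x
  obtain ⟨y, rfl⟩ := (finCongr (sum_sum_eq j l)).surjective x
  obtain ⟨⟨t, b⟩, rfl⟩ := finSigmaFinEquiv.surjective y
  rw [Function.comp_apply, Equiv.symm_apply_apply, concatTuple_apply, finCongr_sigma_sigma,
    concatTuple_apply, concatTuple_apply]

theorem concatTuple_blockPerm {m : ℕ} (n : Fin m → ℕ) (σ : Equiv.Perm (Fin m)) {A : Type*}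
    (a : ∀ i, Fin (n i) → A) :
    concatTuple a ∘ (blockPerm σ n).symm = concatTuple fun i => a (σ.symm i) := by
  funext x
  obtain ⟨y, rfl⟩ := (blockPerm σ n).surjective x
  obtain ⟨⟨i, b⟩, rfl⟩ := finSigmaFinEquiv.surjective y
  rw [Function.comp_apply, Equiv.symm_apply_apply, concatTuple_apply, blockPerm_apply,
    concatTuple_apply]
  have h : ∀ i' (h : i' = i), a i b = a i' (Fin.cast (by rw [h]) b) := by
    rintro _ rfl
    rfl
  exact h _ (σ.symm_apply_apply i)

variable {k A : Type u} [CommRing k] [Ring A] [Algebra k A] (τ : Involution k A)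

/-- The action of the Barratt-Eccles operad on `IF~⟨A⟩`. -/
noncomputable def schurAct (m : ℕ) (Δ : SimplexCategoryᵒᵖ) : ((barrattEccles k).ar m).obj Δ →ₗ[k]
    MultilinearMap k (fun _ : Fin m => ((schur k A τ).obj Δ : Type u)) ((schur k A τ).obj Δ) :=
  Finsupp.linearCombination k fun s : ComposableArrows (EG (Equiv.Perm (Fin m))) Δ.unop.len =>
    schurActString τ s

variable {Δ : SimplexCategoryᵒᵖ}

theorem schurAct_egGen {m : ℕ} (s : ComposableArrows (EG (Equiv.Perm (Fin m))) Δ.unop.len) :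
    schurAct τ m Δ (egGen k s) = schurActString τ s :=
  (Finsupp.linearCombination_single k (1 : k) s).trans (one_smul _ _)

theorem schurAct_mk {m : ℕ} (s : ComposableArrows (EG (Equiv.Perm (Fin m))) Δ.unop.len)
    (n : Fin m → ℕ) (t : ∀ i, ComposableArrows (Under (DeltaHPlus.mk (n i))) Δ.unop.len)
    (a : ∀ i, Fin (n i) → A) :
    schurAct τ m Δ (egGen k s) (fun i => schurMk k A τ Δ (t i) (a i)) =
      schurMk k A τ Δ (nerveOp (underComp n) s t) (concatTuple a) :=
  (congrArg (fun f => f fun i => schurMk k A τ Δ (t i) (a i)) (schurAct_egGen τ s)).trans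
    (schurActString_mk τ s n t a)

theorem schur_map_mk {Δ Δ' : SimplexCategoryᵒᵖ} (θ : Δ ⟶ Δ') {n : ℕ}
    (t : ComposableArrows (Under (DeltaHPlus.mk n)) Δ.unop.len) (a : Fin n → A) :
    ((schur k A τ).map θ).hom (schurMk k A τ Δ t a) = schurMk k A τ Δ' (pull θ t) a :=
  (tensorMap_mk ((underLevel k).map θ) _ _ _ _).trans
    (congrArg (fun z => tensorMk ((underLevel k).obj Δ') (symToDelta ⋙ barFunctor k A τ) ⟨n⟩ z
      (PiTensorProduct.tprod k a)) Finsupp.mapDomain_single)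

theorem schurAct_naturality (m : ℕ) {Δ Δ' : SimplexCategoryᵒᵖ} (θ : Δ ⟶ Δ')
    (a : ((barrattEccles k).ar m).obj Δ) (x : Fin m → (schur k A τ).obj Δ) :
    ((schur k A τ).map θ).hom (schurAct τ m Δ a x) =
      schurAct τ m Δ' ((((barrattEccles k).ar m).map θ).hom a) fun i =>
        ((schur k A τ).map θ).hom (x i) := by
  suffices h : ((schur k A τ).map θ).hom.compMultilinearMap (schurAct τ m Δ a) =
      (schurAct τ m Δ' ((((barrattEccles k).ar m).map θ).hom a)).compLinearMap
        fun _ => ((schur k A τ).map θ).hom from congrArg (fun f => f x) h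
  refine schur_multilinear_ext τ fun y => ?_
  suffices h : ((schur k A τ).map θ).hom ∘ₗ multEval (schurAct τ m Δ) (fun i => (y i).mk' τ) =
      multEval (schurAct τ m Δ') (fun i => ((schur k A τ).map θ).hom ((y i).mk' τ)) ∘ₗ
        (((barrattEccles k).ar m).map θ).hom from LinearMap.congr_fun h a
  refine egGen_lin_ext fun s => ?_
  refine (congrArg ((schur k A τ).map θ).hom (schurAct_mk τ s _ (fun i => (y i).t)
    fun i => (y i).a)).trans ((schur_map_mk τ θ _ _).trans (Eq.symm ?_))
  refine (congrArg₂ (fun a b => schurAct τ m Δ' a b) (map_egGen θ s) (funext fun i =>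
    schur_map_mk τ θ (y i).t (y i).a)).trans ?_
  exact schurAct_mk τ (pull θ s) _ (fun i => pull θ (y i).t) fun i => (y i).a

theorem schurAct_one (Δ : SimplexCategoryᵒᵖ) (x : (schur k A τ).obj Δ) :
    schurAct τ 1 Δ ((barrattEccles k).one Δ) (fun _ => x) = x := by
  suffices h : (MultilinearMap.ofSubsingleton k ((schur k A τ).obj Δ : Type u)
      ((schur k A τ).obj Δ : Type u) (0 : Fin 1)).symm
        (schurAct τ 1 Δ ((barrattEccles k).one Δ)) = LinearMap.id from LinearMap.congr_fun h x
  refine schurMk_lin_ext τ fun n t a => ?_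
  have h : ∑ _ : Fin 1, n = n := Fin.sum_univ_one _
  refine (schurAct_mk (k := k) τ ((Functor.const (Fin (Δ.unop.len + 1))).obj
      (Codiscrete.mk (1 : Equiv.Perm (Fin 1)))) (fun _ => n) (fun _ => t) fun _ => a).trans ?_
  refine (congrArg (fun T => schurMk k A τ Δ T (concatTuple fun _ : Fin 1 => a))
    (nerveOp_underComp_one _ t h)).trans ((schurMk_underPull τ (finCongr h) t _).trans ?_)
  exact congrArg (schurMk k A τ Δ t) (concatTuple_one a h)

/-- Indexing `x` by pairs makes both sides multilinear in one family. On generators the strings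
agree by `nerveOp_underComp_assoc` up to a pullback along the rebracketing cast, and this pullback
reorders the tensor as `concatTuple_concatTuple` requires. -/
theorem schurAct_comp {m : ℕ} (j : Fin m → ℕ) (Δ : SimplexCategoryᵒᵖ)
    (a : ((barrattEccles k).ar m).obj Δ) (b : ∀ i, ((barrattEccles k).ar (j i)).obj Δ)
    (x : (i : Fin m) × Fin (j i) → (schur k A τ).obj Δ) :
    schurAct τ (∑ i, j i) Δ ((barrattEccles k).comp j Δ a b) (fun t => x (finSigmaFinEquiv.symm t)) =
      schurAct τ m Δ a fun i => schurAct τ (j i) Δ (b i) fun s => x ⟨i, s⟩ := by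
  suffices h : multReindex finSigmaFinEquiv.symm
      (M := fun _ : (i : Fin m) × Fin (j i) => ((schur k A τ).obj Δ : Type u))
      (schurAct τ (∑ i, j i) Δ ((barrattEccles k).comp j Δ a b)) =
      (schurAct τ m Δ a).compMultilinearMap fun i => schurAct τ (j i) Δ (b i) from
    congrArg (fun f => f x) h
  refine schur_multilinear_ext τ fun y => ?_
  suffices h : (multEval (schurAct τ (∑ i, j i) Δ)
      fun t => (y (finSigmaFinEquiv.symm t)).mk' τ).compMultilinearMap
        ((barrattEccles k).comp j Δ a) = (schurAct τ m Δ a).compLinearMap fun i =>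
          multEval (schurAct τ (j i) Δ) fun s => (y ⟨i, s⟩).mk' τ from congrArg (fun f => f b) h
  refine egGen_multilinear_ext fun r => ?_
  suffices h : (multEval (schurAct τ (∑ i, j i) Δ)
      fun t => (y (finSigmaFinEquiv.symm t)).mk' τ) ∘ₗ
        multEval ((barrattEccles k).comp j Δ) (fun i => egGen k (r i)) =
      multEval (schurAct τ m Δ) fun i => schurAct τ (j i) Δ (egGen k (r i))
        fun s => (y ⟨i, s⟩).mk' τ from LinearMap.congr_fun h a
  refine egGen_lin_ext fun s => ?_
  let l : ∀ i, Fin (j i) → ℕ := fun i s => (y ⟨i, s⟩).n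
  refine (congrArg (fun c => schurAct τ (∑ i, j i) Δ c
    fun t => (y (finSigmaFinEquiv.symm t)).mk' τ) (comp_egGen j s r)).trans ?_
  refine (schurAct_mk τ _ (fun t : Fin (∑ i, j i) =>
    l (finSigmaFinEquiv.symm t).1 (finSigmaFinEquiv.symm t).2)
    (fun t => (y (finSigmaFinEquiv.symm t)).t) fun t => (y (finSigmaFinEquiv.symm t)).a).trans ?_
  refine Eq.symm ((congrArg (fun z => schurAct τ m Δ (egGen k s) z) (funext fun i =>
    schurAct_mk τ (r i) (l i) (fun a => (y ⟨i, a⟩).t) fun a => (y ⟨i, a⟩).a)).trans ?_)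
  refine (schurAct_mk τ s (fun i => ∑ a, l i a)
    (fun i => nerveOp (underComp (l i)) (r i) fun a => (y ⟨i, a⟩).t)
    fun i => concatTuple fun a => (y ⟨i, a⟩).a).trans (Eq.symm ?_)
  refine (congrArg (fun T => schurMk k A τ Δ T (concatTuple fun t : Fin (∑ i, j i) =>
    (y (finSigmaFinEquiv.symm t)).a))
      (nerveOp_underComp_assoc j l s r fun i a => (y ⟨i, a⟩).t)).trans ?_
  refine (schurMk_underPull τ (finCongr (sum_sum_eq j l)) _ _).trans ?_
  exact congrArg (schurMk k A τ Δ _) (concatTuple_concatTuple j l fun i a => (y ⟨i, a⟩).a)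

/-- The block permutation produced on the source of the string is traded for the same permutation of
the tensor, which lists the arguments in the new order. -/
theorem schurAct_relabel {m : ℕ} (σ : Equiv.Perm (Fin m)) (Δ : SimplexCategoryᵒᵖ)
    (a : ((barrattEccles k).ar m).obj Δ) (x : Fin m → (schur k A τ).obj Δ) :
    schurAct τ m Δ ((barrattEccles k).relabel σ Δ a) x =
      schurAct τ m Δ a fun i => x (σ.symm i) := by
  suffices h : schurAct τ m Δ ((barrattEccles k).relabel σ Δ a) = multReindex σ.symm
      (M := fun _ : Fin m => ((schur k A τ).obj Δ : Type u)) (schurAct τ m Δ a) from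
    congrArg (fun f => f x) h
  refine schur_multilinear_ext τ fun y => ?_
  suffices h : multEval (schurAct τ m Δ) (fun i => (y i).mk' τ) ∘ₗ (barrattEccles k).relabel σ Δ =
      multEval (schurAct τ m Δ) fun i => (y (σ.symm i)).mk' τ from LinearMap.congr_fun h a
  refine egGen_lin_ext fun s => ?_
  refine (congrArg (fun c => schurAct τ m Δ c fun i => (y i).mk' τ) (relabel_egGen σ s)).trans ?_
  refine (schurAct_mk τ _ (fun i => (y i).n) (fun i => (y i).t) fun i => (y i).a).trans
    (Eq.symm ((schurAct_mk τ s (fun i => (y (σ.symm i)).n) (fun i => (y (σ.symm i)).t)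
      fun i => (y (σ.symm i)).a).trans (Eq.symm ?_)))
  refine (congrArg (fun T => schurMk k A τ Δ T (concatTuple fun i => (y i).a))
      (nerveOp_underComp_relabel (fun i => (y i).n) σ s fun i => (y i).t)).trans ?_
  refine (schurMk_underPull τ (blockPerm σ fun i => (y i).n) _ _).trans ?_
  exact congrArg (schurMk k A τ Δ _) (concatTuple_blockPerm _ σ fun i => (y i).a)

/-- The structure of an algebra over the Barratt-Eccles operad on `IF~⟨A⟩`. -/
noncomputable def schurAlgebra : AlgebraOver (barrattEccles k) (schur k A τ) where
  act := schurAct τ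
  naturality := schurAct_naturality τ
  one_act := schurAct_one τ
  comp_act j Δ a b x := by
    refine Eq.trans (congrArg _ (funext fun t => ?_))
      (schurAct_comp τ j Δ a b fun p => x (finSigmaFinEquiv p))
    rw [Equiv.apply_symm_apply]
  equivariance := schurAct_relabel τ

end SchurAlgebra

end HyperHom

/-! ### Descent of the action along the quotient map. -/

namespace HyperHom

section GabrielZismanAlgebra

/-- A fibre over a point of block `i` stays in block `i`, with the order of `F i`. Both lists are
strictly sorted by the same order and have the same members. -/
theorem fib_blockSum {m : ℕ} {j p : Fin m → ℕ} (F : ∀ i, DeltaHPlus.Mor (j i) (p i))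
    (x : (i : Fin m) × Fin (p i)) :
    (blockSum F).fib (finSigmaFinEquiv x) =
      ((F x.1).fib x.2).map fun a => finSigmaFinEquiv (⟨x.1, a⟩ : (i : Fin m) × Fin (j i)) := by
  obtain ⟨i, b⟩ := x
  have hp : (((F i).fib b).map fun a =>
      finSigmaFinEquiv (⟨i, a⟩ : (i : Fin m) × Fin (j i))).Pairwise
        (fun y y' => (blockSum F).σ y < (blockSum F).σ y') := by
    rw [List.pairwise_map]
    refine ((F i).pairwise_fib b).imp fun {a a'} h => ?_
    rw [blockSum_σ_lt]
    exact Or.inr ⟨rfl, h⟩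
  have hn : ∀ {L : List (Fin (∑ i, j i))},
      L.Pairwise (fun y y' => (blockSum F).σ y < (blockSum F).σ y') → L.Nodup :=
    fun h => h.imp (by rintro x y hxy rfl; exact lt_irrefl _ hxy)
  refine List.Perm.eq_of_pairwise (le := fun y y' => (blockSum F).σ y < (blockSum F).σ y') ?_
    (DeltaHPlus.Mor.pairwise_fib _ _) hp ?_
  · intro a b _ _ h1 h2
    exact absurd h2 (lt_asymm h1)
  · rw [List.perm_ext_iff_of_nodup (hn (DeltaHPlus.Mor.pairwise_fib _ _)) (hn hp)]
    intro y
    obtain ⟨⟨i', a⟩, rfl⟩ := finSigmaFinEquiv.surjective y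
    rw [DeltaHPlus.Mor.mem_fib, blockSum_toFun, List.mem_map, EmbeddingLike.apply_eq_iff_eq]
    constructor
    · intro h
      obtain rfl : i' = i := congrArg Sigma.fst h
      exact ⟨a, (DeltaHPlus.Mor.mem_fib _ _ _).2 (eq_of_heq (Sigma.mk.inj h).2), rfl⟩
    · rintro ⟨a', ha', h⟩
      rw [EmbeddingLike.apply_eq_iff_eq] at h
      obtain rfl : i = i' := congrArg Sigma.fst h
      obtain rfl : a' = a := eq_of_heq (Sigma.mk.inj h).2
      exact congrArg (Sigma.mk i) ((DeltaHPlus.Mor.mem_fib _ _ _).1 ha')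

variable {k A : Type u} [CommRing k] [Ring A] [Algebra k A] (τ : Involution k A)

/-- The bar construction is compatible with disjoint unions and concatenation. -/
theorem barProd_blockSum {m : ℕ} {j p : Fin m → ℕ} (F : ∀ i, DeltaHPlus.Mor (j i) (p i))
    (a : ∀ i, Fin (j i) → A) :
    barProd τ (blockSum F) (concatTuple a) = concatTuple fun i => barProd τ (F i) (a i) := by
  funext y
  obtain ⟨x, rfl⟩ := finSigmaFinEquiv.surjective y
  rw [concatTuple_apply, barProd, fib_blockSum, List.map_map, barProd]
  refine congrArg List.prod (List.map_congr_left fun b _ => ?_)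
  rw [Function.comp_apply, blockSum_z, concatTuple_apply]

/-- The lift of a string to the under-category of its first object. -/
def underLift {p : ℕ} (s : ComposableArrows DeltaHPlus p) :
    ComposableArrows (Under (DeltaHPlus.mk (s.obj 0).len)) p where
  obj q := Under.mk (X := s.obj 0) (Y := s.obj q) (s.map (homOfLE (Fin.zero_le q)))
  map u := Under.homMk (s.map u) ((s.map_comp _ _).symm.trans (congrArg s.map rfl))
  map_id q := Under.UnderMorphism.ext (s.map_id q)
  map_comp u v := Under.UnderMorphism.ext (s.map_comp u v)

variable {Δ : SimplexCategoryᵒᵖ}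

theorem quotMap_mk {n : ℕ} (t : ComposableArrows (Under (DeltaHPlus.mk n)) Δ.unop.len)
    (a : Fin n → A) :
    ((quotMap k A τ).app Δ).hom (schurMk k A τ Δ t a) =
      gzMk (barFunctor k A τ) Δ.unop.len (t ⋙ Under.forget _)
        (PiTensorProduct.tprod k (barProd τ (t.obj 0).hom a)) := by
  refine (tensorDesc_mk ((underLevel k).obj Δ) (symToDelta ⋙ barFunctor k A τ)
      (fun X => quotBilin k A τ (symToDelta.obj X) Δ.unop.len)
      (fun _ _ α x y => quotBilin_map k A τ Δ.unop.len (symToDelta.map α) x y) ⟨n⟩ _ _).trans ?_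
  refine (congrArg (fun f : (⨂[k] _ : Fin n, A) →ₗ[k] GZ (barFunctor k A τ) Δ.unop.len =>
    f (PiTensorProduct.tprod k a)) ((Finsupp.linearCombination_single k (1 : k) t).trans
      (one_smul k (quotTerm k A τ (DeltaHPlus.mk n) Δ.unop.len t)))).trans ?_
  exact congrArg (gzMk (barFunctor k A τ) Δ.unop.len (t ⋙ Under.forget _))
    (barMap_tprod τ (t.obj 0).hom a)

open Classical in
/-- The section of the quotient map that lifts strings to under-categories. -/
noncomputable def quotSection (Δ : SimplexCategoryᵒᵖ) :
    GZ (barFunctor k A τ) Δ.unop.len →ₗ[k] (schur k A τ).obj Δ :=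
  DirectSum.toModule k _ _ fun s => tensorMkBilin ((underLevel k).obj Δ)
    (symToDelta ⋙ barFunctor k A τ) ⟨(s.obj 0).len⟩ (Finsupp.single (underLift s) (1 : k))

theorem quotSection_mk (s : ComposableArrows DeltaHPlus Δ.unop.len) (a : Fin (s.obj 0).len → A) :
    quotSection τ Δ (gzMk (barFunctor k A τ) Δ.unop.len s (PiTensorProduct.tprod k a)) =
      schurMk k A τ Δ (underLift s) a := by
  classical
  exact DirectSum.toModule_lof _ _ _

theorem gz_tprod_ext {p : ℕ} {M : Type u} [AddCommGroup M] [Module k M]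
    {f g : GZ (barFunctor k A τ) p →ₗ[k] M}
    (h : ∀ (s : ComposableArrows DeltaHPlus p) (a : Fin (s.obj 0).len → A),
      f (gzMk (barFunctor k A τ) p s (PiTensorProduct.tprod k a)) =
        g (gzMk (barFunctor k A τ) p s (PiTensorProduct.tprod k a))) : f = g := by
  refine gz_hom_ext fun s x => ?_
  suffices h : f ∘ₗ gzMk (barFunctor k A τ) p s = g ∘ₗ gzMk (barFunctor k A τ) p s from
    LinearMap.congr_fun h x
  refine PiTensorProduct.ext ?_
  ext a
  exact h s a

/-- The lift of a string to the under-category of its first object starts with an identity, so the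
coefficient is unchanged. -/
theorem quotMap_quotSection (x : GZ (barFunctor k A τ) Δ.unop.len) :
    ((quotMap k A τ).app Δ).hom (quotSection τ Δ x) = x := by
  suffices h : ((quotMap k A τ).app Δ).hom ∘ₗ quotSection τ Δ = LinearMap.id from
    LinearMap.congr_fun h x
  refine gz_tprod_ext τ fun s a => ?_
  refine (congrArg ((quotMap k A τ).app Δ).hom (quotSection_mk τ s a)).trans
    ((quotMap_mk τ _ _).trans ?_)
  refine congrArg (fun b => gzMk (barFunctor k A τ) Δ.unop.len s (PiTensorProduct.tprod k b)) ?_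
  exact (congrArg (barProd τ · a) (s.map_id 0)).trans (barProd_id τ a)

theorem quotMap_surjective (Δ : SimplexCategoryᵒᵖ) :
    Function.Surjective ((quotMap k A τ).app Δ).hom :=
  fun x => ⟨quotSection τ Δ x, quotMap_quotSection τ x⟩

theorem quotSection_quotMap_mk {n : ℕ}
    (t : ComposableArrows (Under (DeltaHPlus.mk n)) Δ.unop.len) (a : Fin n → A) :
    quotSection τ Δ (((quotMap k A τ).app Δ).hom (schurMk k A τ Δ t a)) =
      schurMk k A τ Δ (underLift (t ⋙ Under.forget _)) (barProd τ (t.obj 0).hom a) :=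
  (congrArg (quotSection τ Δ) (quotMap_mk τ t a)).trans (quotSection_mk τ _ _)

/-- The structure morphism of the product is a disjoint union followed by a block permutation, and
the bar construction is functorial and monoidal. -/
theorem barProd_nerveOp_underComp {m : ℕ} (j : Fin m → ℕ) {p : ℕ}
    (s : ComposableArrows (EG (Equiv.Perm (Fin m))) p)
    (t : ∀ i, ComposableArrows (Under (DeltaHPlus.mk (j i))) p) (a : ∀ i, Fin (j i) → A) :
    barProd τ ((nerveOp (underComp j) s t).obj 0).hom (concatTuple a) =
      barProd τ (blockIso (s.obj 0).as fun i => ((t i).obj 0).right).hom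
        (concatTuple fun i => barProd τ ((t i).obj 0).hom (a i)) :=
  (barProd_comp τ _ _ _).trans (congrArg _ (barProd_blockSum τ _ a))

/-- Without its structure morphism, the product string depends only on `s` and the underlying
strings of the `t i`. The structure morphisms enter only through the coefficient, where they can be
applied before or after multiplying. So each argument may be replaced by its normal form, with an
identity as structure morphism. -/
theorem quotMap_schurAct_mk {m : ℕ} (s : ComposableArrows (EG (Equiv.Perm (Fin m))) Δ.unop.len)
    (n : Fin m → ℕ) (t : ∀ i, ComposableArrows (Under (DeltaHPlus.mk (n i))) Δ.unop.len)
    (a : ∀ i, Fin (n i) → A) :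
    ((quotMap k A τ).app Δ).hom (schurMk k A τ Δ (nerveOp (underComp n) s t) (concatTuple a)) =
      ((quotMap k A τ).app Δ).hom (schurMk k A τ Δ
        (nerveOp (underComp fun i => ((t i).obj 0).right.len) s
          fun i => underLift (t i ⋙ Under.forget _))
        (concatTuple fun i => barProd τ ((t i).obj 0).hom (a i))) := by
  refine (quotMap_mk τ _ _).trans (Eq.trans ?_ (quotMap_mk τ _ _).symm)
  refine congrArg (fun b => gzMk (barFunctor k A τ) Δ.unop.len
    (nerveOp (underComp n) s t ⋙ Under.forget _) (PiTensorProduct.tprod k b)) ?_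
  refine (barProd_nerveOp_underComp τ n s t a).trans
    (Eq.trans ?_ (barProd_nerveOp_underComp τ (fun i => ((t i).obj 0).right.len) s
      (fun i => underLift (t i ⋙ Under.forget _)) fun i => barProd τ ((t i).obj 0).hom (a i)).symm)
  refine congrArg (fun b => barProd τ (blockIso (s.obj 0).as fun i => ((t i).obj 0).right).hom
    (concatTuple b)) (funext fun i => Eq.symm ?_)
  exact (congrArg (barProd τ · _) ((t i ⋙ Under.forget _).map_id 0)).trans (barProd_id τ _)

/-- The action of the Barratt-Eccles operad on `C_⋆(ΔH₊, H_{A+})`. -/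
noncomputable def gzAct (m : ℕ) (Δ : SimplexCategoryᵒᵖ) : ((barrattEccles k).ar m).obj Δ →ₗ[k]
    MultilinearMap k (fun _ : Fin m => ((hyperoctahedralModule k A τ).obj Δ : Type u))
      ((hyperoctahedralModule k A τ).obj Δ) where
  toFun d := ((quotMap k A τ).app Δ).hom.compMultilinearMap
    ((schurAct τ m Δ d).compLinearMap fun _ => quotSection τ Δ)
  map_add' d d' := by
    ext x
    exact (congrArg ((quotMap k A τ).app Δ).hom (congrArg (fun f => f fun i =>
      quotSection τ Δ (x i)) (map_add (schurAct τ m Δ) d d'))).trans (map_add _ _ _)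
  map_smul' c d := by
    ext x
    exact (congrArg ((quotMap k A τ).app Δ).hom (congrArg (fun f => f fun i =>
      quotSection τ Δ (x i)) (map_smul (schurAct τ m Δ) c d))).trans (map_smul _ _ _)

/-- The action downstairs was defined through the section, which is no algebra map; on generators
the section of the image is the normal form of `quotMap_schurAct_mk`, so the choice does not matter.
-/
theorem quotMap_schurAct (m : ℕ) (Δ : SimplexCategoryᵒᵖ) (d : ((barrattEccles k).ar m).obj Δ)
    (y : Fin m → (schur k A τ).obj Δ) :
    ((quotMap k A τ).app Δ).hom (schurAct τ m Δ d y) =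
      gzAct τ m Δ d fun i => ((quotMap k A τ).app Δ).hom (y i) := by
  suffices h : ((quotMap k A τ).app Δ).hom.compMultilinearMap (schurAct τ m Δ d) =
      (gzAct τ m Δ d).compLinearMap fun _ => ((quotMap k A τ).app Δ).hom from
    congrArg (fun f => f y) h
  refine schur_multilinear_ext τ fun y => ?_
  suffices h : ((quotMap k A τ).app Δ).hom ∘ₗ multEval (schurAct τ m Δ) (fun i => (y i).mk' τ) =
      multEval (gzAct τ m Δ) fun i => ((quotMap k A τ).app Δ).hom ((y i).mk' τ) from
    LinearMap.congr_fun h d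
  refine egGen_lin_ext fun s => ?_
  refine (congrArg ((quotMap k A τ).app Δ).hom (schurAct_mk τ s _ (fun i => (y i).t)
    fun i => (y i).a)).trans ((quotMap_schurAct_mk τ s _ _ _).trans ?_)
  refine congrArg ((quotMap k A τ).app Δ).hom (Eq.symm ?_)
  refine (congrArg (fun z => schurAct τ m Δ (egGen k s) z) (funext fun i =>
    quotSection_quotMap_mk τ (y i).t (y i).a)).trans ?_
  exact schurAct_mk τ s _ _ _

theorem quotMap_naturality_apply {Δ Δ' : SimplexCategoryᵒᵖ} (θ : Δ ⟶ Δ')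
    (y : (schur k A τ).obj Δ) :
    ((quotMap k A τ).app Δ').hom (((schur k A τ).map θ).hom y) =
      ((hyperoctahedralModule k A τ).map θ).hom (((quotMap k A τ).app Δ).hom y) :=
  congrArg (fun f => (ModuleCat.Hom.hom f) y) ((quotMap k A τ).naturality θ)

theorem exists_quotMap_lift {ι : Type*} (Δ : SimplexCategoryᵒᵖ)
    (x : ι → (hyperoctahedralModule k A τ).obj Δ) :
    ∃ y : ι → (schur k A τ).obj Δ, (fun i => ((quotMap k A τ).app Δ).hom (y i)) = x :=
  ⟨fun i => quotSection τ Δ (x i), funext fun i => quotMap_quotSection τ (x i)⟩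

/-- The structure of an algebra over the Barratt-Eccles operad on `C_⋆(ΔH₊, H_{A+})`. -/
noncomputable def gzAlgebra : AlgebraOver (barrattEccles k) (hyperoctahedralModule k A τ) where
  act := gzAct τ
  naturality m {Δ Δ'} θ d x := by
    -- As the quotient map is surjective in each degree and intertwines the two actions, each axiom
    -- is the image of the axiom for `IF~⟨A⟩`.
    obtain ⟨y, rfl⟩ := exists_quotMap_lift τ Δ x
    refine (congrArg ((hyperoctahedralModule k A τ).map θ).hom
      (quotMap_schurAct τ m Δ d y).symm).trans ((quotMap_naturality_apply τ θ _).symm.trans ?_)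
    refine (congrArg ((quotMap k A τ).app Δ').hom (schurAct_naturality τ m θ d y)).trans ?_
    refine (quotMap_schurAct τ m Δ' _ _).trans ?_
    exact congrArg (fun z => gzAct τ m Δ' ((((barrattEccles k).ar m).map θ).hom d) z)
      (funext fun i => quotMap_naturality_apply τ θ (y i))
  one_act Δ x := by
    obtain ⟨y, rfl⟩ := quotMap_surjective τ Δ x
    exact (quotMap_schurAct τ 1 Δ _ fun _ => y).symm.trans
      (congrArg ((quotMap k A τ).app Δ).hom (schurAct_one τ Δ y))
  comp_act j Δ d b x := by
    obtain ⟨y, rfl⟩ := exists_quotMap_lift τ Δ x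
    refine (quotMap_schurAct τ _ Δ _ y).symm.trans ((congrArg ((quotMap k A τ).app Δ).hom
      ((schurAlgebra τ).comp_act j Δ d b y)).trans ((quotMap_schurAct τ _ Δ d _).trans ?_))
    exact congrArg (fun z => gzAct τ _ Δ d z) (funext fun i => quotMap_schurAct τ (j i) Δ (b i) _)
  equivariance σ Δ d x := by
    obtain ⟨y, rfl⟩ := exists_quotMap_lift τ Δ x
    exact (quotMap_schurAct τ _ Δ _ y).symm.trans ((congrArg ((quotMap k A τ).app Δ).hom
      (schurAct_relabel τ σ Δ d y)).trans (quotMap_schurAct τ _ Δ d _))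

end GabrielZismanAlgebra

end HyperHom

theorem mainTheorem1 (k A : Type u) [CommRing k] [Ring A] [Algebra k A]
    (τ : Involution k A) :
    (∀ n : ℕ, Nonempty (((AlgebraicTopology.alternatingFaceMapComplex (ModuleCat.{u} k)).obj
        (hyperoctahedralModule k A τ)).homology n ≅
      hyperoctahedralHomology k A τ n)) ∧
    (barrattEccles k).IsEInfinity ∧
    ∃ (ν' : AlgebraOver (barrattEccles k) (schur k A τ))
      (ν : AlgebraOver (barrattEccles k) (hyperoctahedralModule k A τ)),
      (∀ (m : ℕ) (j : Fin m → ℕ) (Δ : SimplexCategoryᵒᵖ)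
        (s : ComposableArrows (EG (Equiv.Perm (Fin m))) Δ.unop.len)
        (t : ∀ i, ComposableArrows (Under (DeltaHPlus.mk (j i))) Δ.unop.len)
        (a : ∀ i, Fin (j i) → A),
        ν'.act m Δ (Finsupp.single s (1 : k)) (fun i => schurMk k A τ Δ (t i) (a i)) =
          schurMk k A τ Δ (nerveOp (underComp j) s t)
            (fun l => a (finSigmaFinEquiv.symm l).1 (finSigmaFinEquiv.symm l).2)) ∧
      (∀ Δ : SimplexCategoryᵒᵖ,
        Function.Surjective ((quotMap k A τ).app Δ).hom) ∧
      (∀ (m : ℕ) (Δ : SimplexCategoryᵒᵖ) (d : ((barrattEccles k).ar m).obj Δ)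
        (y : Fin m → (schur k A τ).obj Δ),
        ((quotMap k A τ).app Δ).hom (ν'.act m Δ d y) =
          ν.act m Δ d (fun i => ((quotMap k A τ).app Δ).hom (y i))) := by
  exact ⟨fun n => ⟨hyperoctahedralHomologyIso k A τ n⟩, barrattEccles_isEInfinity,
    schurAlgebra τ, gzAlgebra τ, fun m j Δ s t a => schurAct_mk τ s j t a,
    quotMap_surjective τ, quotMap_schurAct τ⟩
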